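/- Let $B$ be a smooth projective variety over $\mathbb C$, let $n\ge 2$, and let $E=\bigoplus_{j=1}^n L_j$ and $F=\bigoplus_{i=1}^n M_i$ be sums of line bundles on $B$. Let $X_+=\operatorname{Tot}(\mathcal O_{\mathbb P(E)}(-1)\otimes F^\vee)$ and $X_-=\operatorname{Tot}(\mathcal O_{\mathbb P(F^\vee)}(-1)\otimes E)$, with the action of $\mathbb T=(\mathbb C^*)^{2n}$ that scales the summands of $E$ and $F$. Put $x_j=c_1^{\mathbb T}(L_j^\vee)$, $z_i=c_1^{\mathbb T}(M_i^\vee)$, so that the completed equivariant cohomology rings are $\hat H_{\mathbb T}(B)=H^*(B)[[x_j,z_i]]$, $$\hat H_{\mathbb T}(X_+)=\hat H_{\mathbb T}(B)[y]\Big/\prod_{j}(-x_j-y),\qquad \hat H_{\mathbb T}(X_-)=\hat H_{\mathbb T}(B)[y]\Big/\prod_{i}(z_i+y).$$ The fixed loci are copies $B_l^+$, $B_k^-$ ($1\le k,l\le n$) of $B$, to which $y$ restricts as $-x_l$ and $-z_k$ respectively. Let $N_l^+$, $N_k^-$ be their normal bundles. After localization (inverting the nonzero homogeneous elements of $H_{\mathbb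 T}(pt)$), let $\mathbb U_H\colon \hat H_{\mathbb T}(X_-)_{loc}\to \hat H_{\mathbb T}(X_+)_{loc}$ be the linear map that sends the pushforward of $\alpha/e_{\mathbb T}(N_k^-)$ from $B_k^-$ to $$\sum_{l=1}^n e^{(n-1)(x_l-z_k)/2}\prod_{i\ne k}\frac{\sin((x_l-z_i)/2\mathrm i)}{\sin((z_k-z_i)/2\mathrm i)}\;\frac{\alpha}{e_{\mathbb T}(N_l^+)},$$ where the $l$-th term is pushed forward from $B_l^+$ and the fixed loci are identified with $B$. For a curve class $\beta$ on $B$, let $$H_{X_+,\beta}(q_+)=\sum_{e\in\mathbb Z}\frac{q_+^{-y/2\pi\mathrm i+e}}{\prod_{j=1}^n\Gamma\big(1+\tfrac{-x_j-y}{2\pi\mathrm i}+\beta\cdot L_j+e\big)\Gamma\big(1+\tfrac{z_j+y}{2\pi\mathrm i}-\beta\cdot M_j-e\big)}\in\hat H_{\mathbb T}(X_+),$$ $$H_{X_-,\beta}(q_-)=\sum_{d\in\mathbb Z}\frac{q_-^{y/2\pi\mathrm i+d}}{\prod_{j=1}^n\Gamma\big(1+\tfrac{-x_j-y}{2\pi\mathrm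 i}+\beta\cdot L_j-d\big)\Gamma\big(1+\tfrac{z_j+y}{2\pi\mathrm i}-\beta\cdot M_j+d\big)}\in\hat H_{\mathbb T}(X_-),$$ where $1/\Gamma$ is expanded as a power series in the cohomology classes, as functions of $\log q_\pm$. Then both series converge coefficientwise for $|q_\pm|<1$. Moreover, let $\gamma$ be a path in the $\log q_+$-plane from $\operatorname{Re}=-\infty$ to $\operatorname{Re}=+\infty$ that crosses the line $\operatorname{Re}=0$ only between the consecutive singular points $(n-2)\pi\mathrm i$ and $n\pi\mathrm i$ (for example through $(n-1)\pi\mathrm i$). Then $H_{X_+,\beta}$ has an analytic continuation $\widetilde{H_{X_+,\beta}}$ along $\gamma$, coefficientwise, and near the end of $\gamma$ $$\mathbb U_H\,H_{X_-,\beta}(q_-)=\widetilde{H_{X_+,\beta}}(q_+),\qquad \log q_-=-\log q_+ .$$ -/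

import Mathlib

universe u v

open Filter Topology

noncomputable section

namespace ToricFlop

/-! ### Singular chains and cochains of the base, line bundles, degrees -/

/-- Singular `k`-simplices of a topological space. -/
abbrev Simp (k : ℕ) (Y : Type*) [TopologicalSpace Y] : Type _ :=
  C(stdSimplex ℝ (Fin (k + 1)), Y)

/-- The simplex obtained from `σ` by precomposing with the affine map of standard simplices that is
given on vertices by `f`. -/
def Simp.pull {Y : Type*} [TopologicalSpace Y] {k l : ℕ} (f : Fin (k + 1) → Fin (l + 1))
    (σ : Simp l Y) : Simp k Y :=
  σ.comp ⟨stdSimplex.map f, stdSimplex.continuous_map f⟩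

/-- The singular coboundary of a cochain. -/
def coboundary {Y : Type*} [TopologicalSpace Y] {R : Type*} [CommRing R] {k : ℕ}
    (c : Simp k Y → R) : Simp (k + 1) Y → R :=
  fun σ => ∑ i : Fin (k + 2), (-1) ^ (i : ℕ) * c (σ.pull i.succAbove)

/-- The singular boundary of an integral 2-chain. -/
def boundary {Y : Type*} [TopologicalSpace Y] (b : Simp 2 Y →₀ ℤ) : Simp 1 Y →₀ ℤ :=
  b.sum fun σ m => ∑ i : Fin 3, Finsupp.single (σ.pull i.succAbove) ((-1) ^ (i : ℕ) * m)

/-- Integral singular 2-cycles; they represent the curve classes in `H₂(Y; ℤ)`. -/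
def TwoCycle (Y : Type*) [TopologicalSpace Y] : Type _ :=
  {b : Simp 2 Y →₀ ℤ // boundary b = 0}

/-- Complex cocycles of even degree `2k`. -/
def EvenCocycle (Y : Type*) [TopologicalSpace Y] (k : ℕ) : Type _ :=
  {a : Simp (2 * k) Y → ℂ // coboundary a = 0}

/-- The symbol `[a]` of an even cocycle. -/
def sym {Y : Type*} [TopologicalSpace Y] {k : ℕ} (a : EvenCocycle Y k) :
    MvPolynomial (Σ k, EvenCocycle Y k) ℂ :=
  MvPolynomial.X ⟨k, a⟩

/-- The relations between the symbols of even cocycles: `[a]` is linear in `a`, coboundaries vanish,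
the constant cochain `1` is the unit, and the product is the cup product, that is, the value of
`a ∪ b` on a simplex is the value of `a` on its front face times that of `b` on its back face. -/
inductive CohomologyRel (Y : Type*) [TopologicalSpace Y] :
    MvPolynomial (Σ k, EvenCocycle Y k) ℂ → Prop
  | add {k : ℕ} (a b c : EvenCocycle Y k) (h : ∀ σ, c.1 σ = a.1 σ + b.1 σ) :
      CohomologyRel Y (sym c - (sym a + sym b))
  | smul {k : ℕ} (r : ℂ) (a c : EvenCocycle Y k) (h : ∀ σ, c.1 σ = r * a.1 σ) :
      CohomologyRel Y (sym c - MvPolynomial.C r * sym a)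
  | exact {k : ℕ} (a : EvenCocycle Y (k + 1)) (p : Simp (2 * k + 1) Y → ℂ)
      (h : a.1 = coboundary p) : CohomologyRel Y (sym a)
  | one (a : EvenCocycle Y 0) (h : ∀ σ, a.1 σ = 1) : CohomologyRel Y (sym a - 1)
  | cup {k l : ℕ} (a : EvenCocycle Y k) (b : EvenCocycle Y l) (c : EvenCocycle Y (k + l))
      (h : ∀ σ, c.1 σ =
        a.1 (σ.pull fun i => ⟨i, by omega⟩) * b.1 (σ.pull fun i => ⟨2 * k + i, by omega⟩)) :
      CohomologyRel Y (sym c - sym a * sym b)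

/-- The even-degree singular cohomology ring `H^{2*}(Y; ℂ)`, with the cup product: the commutative
algebra generated by the classes of even cocycles. (Cup product is commutative in even
degrees, so that this presentation gives the usual ring.) -/
abbrev EvenCohomology (Y : Type*) [TopologicalSpace Y] : Type _ :=
  MvPolynomial (Σ k, EvenCocycle Y k) ℂ ⧸ Ideal.span {p | CohomologyRel Y p}

/-- A (topological) complex line bundle. -/
structure ComplexLineBundle (Y : Type u) [TopologicalSpace Y] where
  fiber : Y → Type v
  [addCommGroup : ∀ b, AddCommGroup (fiber b)]
  [module : ∀ b, Module ℂ (fiber b)]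
  [topFiber : ∀ b, TopologicalSpace (fiber b)]
  [topTotal : TopologicalSpace (Bundle.TotalSpace ℂ fiber)]
  [fiberBundle : FiberBundle ℂ fiber]
  [vectorBundle : VectorBundle ℂ ℂ fiber]

attribute [instance] ComplexLineBundle.addCommGroup ComplexLineBundle.module
  ComplexLineBundle.topFiber ComplexLineBundle.topTotal ComplexLineBundle.fiberBundle
  ComplexLineBundle.vectorBundle

namespace ComplexLineBundle

variable {Y : Type u} [TopologicalSpace Y] (L : ComplexLineBundle.{u, v} Y)

/-- The zero section. -/
def zeroSection : C(Y, Bundle.TotalSpace ℂ L.fiber) :=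
  ⟨Bundle.zeroSection ℂ L.fiber, Bundle.Trivialization.continuous_zeroSection ℂ⟩

/-- `c` is a cocycle that represents the Thom class of `L`: it vanishes on simplices in the
complement of the zero section, and it takes the value `1` on every fibrewise triangle with vertices
`v`, `ωv`, `ω²v`, where `v ≠ 0` and `ω = exp(2πi/3)`. -/
structure IsThomCocycle (c : Simp 2 (Bundle.TotalSpace ℂ L.fiber) → ℤ) : Prop where
  closed : coboundary c = 0
  relative : ∀ σ, (∀ p, (σ p).2 ≠ 0) → c σ = 0
  normalized : ∀ (b : Y) (e : L.fiber b), e ≠ 0 → ∀ σ : Simp 2 (Bundle.TotalSpace ℂ L.fiber),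
    (∀ p, σ p = ⟨b, (∑ i : Fin 3,
      (p i : ℂ) * Complex.exp (2 * Real.pi * Complex.I / 3) ^ (i : ℕ)) • e⟩) → c σ = 1

/-- A cocycle that represents `c₁(L)`: the restriction of a Thom cocycle to the zero section. -/
def chernCocycle : Simp 2 Y → ℤ :=
  fun σ => Classical.epsilon L.IsThomCocycle (L.zeroSection.comp σ)

/-- The degree `β · L = ⟨c₁(L), β⟩`. -/
def degree (β : TwoCycle Y) : ℤ :=
  β.1.sum fun σ m => m * L.chernCocycle σ

end ComplexLineBundle

/-! ### Equivariant cohomology of the base and of `X₊`, `X₋`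

`A` stands for the (even) cohomology ring of the base `B`. The torus acts trivially on `B` and scales
the summands of `E` and `F` independently, so that `H_T(B)` is the polynomial ring over `H^*(B)` in
the equivariant classes `x_j = c₁(L_j^∨)`, `z_i = c₁(M_i^∨)`. With `y` the Chern class of the dual of
the line bundle given by the standard representation of `GL₁`, the rings `H_T(X_±)` are generated by
`y` over `H_T(B)`, with one relation. -/

/-- The two chambers: `plus` is `X₊ = Tot(𝒪_{ℙ(E)}(-1) ⊗ F^∨)` and `minus` is
`X₋ = Tot(𝒪_{ℙ(F^∨)}(-1) ⊗ E)`, where `E = ⨁ L_j` and `F = ⨁ M_i`. -/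
inductive Chamber
  | plus
  | minus

/-- The opposite chamber. -/
def Chamber.swap : Chamber → Chamber
  | plus => minus
  | minus => plus

/-- Names of the generators over `H^*(B)`: `inl j` is `x_j = c₁(L_j^∨)`, and `inr i` is
`z_i = c₁(M_i^∨)` (equivariant Chern classes). -/
abbrev BaseVar (n : ℕ) : Type := Fin n ⊕ Fin n

/-- The completed equivariant cohomology `Ĥ_T(B) = H^*(B)[[x_j, z_i]]`. -/
abbrev HBase (n : ℕ) (A : Type*) : Type _ := MvPowerSeries (BaseVar n) A

/-- `H^*(B)[[x_j, z_i, y]]`; `none` is the name of `y`. -/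
abbrev HFree (n : ℕ) (A : Type*) : Type _ := MvPowerSeries (Option (BaseVar n)) A

section Geometry

variable {n : ℕ} {A : Type*} [CommRing A]

variable (n A) in
/-- The class `x_j` in `Ĥ_T(B)`. -/
def xB (j : Fin n) : HBase n A := MvPowerSeries.X (Sum.inl j)

variable (n A) in
/-- The class `z_i` in `Ĥ_T(B)`. -/
def zB (i : Fin n) : HBase n A := MvPowerSeries.X (Sum.inr i)

variable (n A) in
/-- The symbol `x_j`. -/
def xF (j : Fin n) : HFree n A := MvPowerSeries.X (some (Sum.inl j))

variable (n A) in
/-- The symbol `z_i`. -/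
def zF (i : Fin n) : HFree n A := MvPowerSeries.X (some (Sum.inr i))

variable (n A) in
/-- The symbol `y`. -/
def yF : HFree n A := MvPowerSeries.X none

variable (A) in
/-- The Chern roots of the relative tangent bundle of `X_± → B` (up to the summand `𝒪` in the
Euler sequence): `weight plus j = -x_j - y` and `weight minus i = z_i + y`. In each chamber the first
family belongs to the directions along the projective bundle. -/
def weight : Chamber → Fin n → HFree n A
  | .plus, j => -xF n A j - yF n A
  | .minus, i => zF n A i + yF n A

variable (n A) in
/-- The defining relation of the cohomology of `X_±`: `∏ (-x_j - y)` for `X₊`, and `∏ (z_i + y)` for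
`X₋`. -/
def relation (s : Chamber) : HFree n A := ∏ i, weight A s i

variable (n A) in
/-- The completed equivariant cohomology ring `Ĥ_T(X_±)`. -/
abbrev HX (s : Chamber) : Type _ := HFree n A ⧸ Ideal.span {relation n A s}

/-- The restriction of `y` to the `k`-th fixed locus of `X_±`. -/
def root : Chamber → Fin n → HBase n A
  | .plus, k => -xB n A k
  | .minus, k => -zB n A k

/-- The images of the generators under restriction to the `k`-th fixed locus. -/
def restrictVar (s : Chamber) (k : Fin n) : Option (BaseVar n) → HBase n A
  | none => root s k
  | some i => MvPowerSeries.X i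

theorem restrictVar_hasSubst (s : Chamber) (k : Fin n) :
    MvPowerSeries.HasSubst (restrictVar (A := A) s k) := by
  apply MvPowerSeries.hasSubst_of_constantCoeff_zero
  rintro (_ | i)
  · cases s <;> simp [restrictVar, root, xB, zB]
  · simp [restrictVar]

/-- The substitution of the restriction of `y` to the `k`-th fixed locus for `y`. -/
def restrictFree (s : Chamber) (k : Fin n) : HFree n A →ₐ[A] HBase n A :=
  MvPowerSeries.substAlgHom (restrictVar_hasSubst s k)

theorem restrictFree_X (s : Chamber) (k : Fin n) (i : Option (BaseVar n)) :
    restrictFree (A := A) s k (MvPowerSeries.X i) = restrictVar s k i := by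
  exact MvPowerSeries.substAlgHom_X (R := A) (restrictVar_hasSubst s k) i

theorem restrictFree_weight_self (s : Chamber) (k : Fin n) :
    restrictFree (A := A) s k (weight A s k) = 0 := by
  cases s <;>
    simp [weight, xF, zF, yF, restrictFree_X, restrictVar, root, xB, zB]

theorem restrictFree_relation (s : Chamber) (k : Fin n) :
    restrictFree (A := A) s k (relation n A s) = 0 := by
  rw [relation, map_prod]
  exact Finset.prod_eq_zero (Finset.mem_univ k) (restrictFree_weight_self s k)

/-- Restriction `Ĥ_T(X_±) → Ĥ_T(B_k)` to the `k`-th fixed locus `B_k ≅ B`. -/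
def restrict (s : Chamber) (k : Fin n) : HX n A s →+* HBase n A :=
  Ideal.Quotient.lift _ (restrictFree s k).toRingHom (by
    intro a ha
    have h : Ideal.span {relation n A s} ≤ RingHom.ker (restrictFree (A := A) s k).toRingHom := by
      rw [Ideal.span_le]
      rintro _ rfl
      exact restrictFree_relation s k
    exact h ha)

theorem some_hasSubst :
    MvPowerSeries.HasSubst
      (fun i : BaseVar n => (MvPowerSeries.X (some i) : HFree n A)) :=
  MvPowerSeries.hasSubst_of_constantCoeff_zero (by simp)

variable (n A) in
/-- The pullback `Ĥ_T(B) → Ĥ_T(X_±)`. -/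
def pullback (s : Chamber) : HBase n A →+* HX n A s :=
  (Ideal.Quotient.mk _).comp (MvPowerSeries.substAlgHom (some_hasSubst (n := n) (A := A))).toRingHom

theorem restrict_pullback (s : Chamber) (k : Fin n) (f : HBase n A) :
    restrict s k (pullback n A s f) = f := by
  have h := MvPowerSeries.substAlgHom_comp_substAlgHom_apply (R := A) (S := A) (T := A)
    (some_hasSubst (n := n) (A := A)) (restrictVar_hasSubst (A := A) s k) f
  change MvPowerSeries.substAlgHom (R := A) (restrictVar_hasSubst s k)
    (MvPowerSeries.substAlgHom (R := A) (some_hasSubst (n := n) (A := A)) f) = f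
  rw [h, MvPowerSeries.substAlgHom_apply]
  have h2 : (fun i : BaseVar n => MvPowerSeries.substAlgHom (R := A)
      (restrictVar_hasSubst (A := A) s k) (MvPowerSeries.X (some i) : HFree n A)) =
      MvPowerSeries.X := by
    funext i
    exact MvPowerSeries.substAlgHom_X (R := A) (restrictVar_hasSubst s k) (some i)
  rw [h2, MvPowerSeries.subst_self]
  rfl

/-- The class of the `k`-th fixed locus in `X_±`. -/
def fixedClass (s : Chamber) (k : Fin n) : HX n A s :=
  Ideal.Quotient.mk _ ((∏ j ∈ Finset.univ.erase k, weight A s j) * ∏ i, weight A s.swap i)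

/-- The equivariant Euler class of the normal bundle of the `k`-th fixed locus in `X_±`. -/
def eulerNormal (s : Chamber) (k : Fin n) : HBase n A :=
  (∏ j ∈ Finset.univ.erase k, restrictFree s k (weight A s j)) *
    ∏ i, restrictFree s k (weight A s.swap i)

theorem restrict_fixedClass (s : Chamber) (m k : Fin n) :
    restrict (A := A) s m (fixedClass s k) = if m = k then eulerNormal s k else 0 := by
  change restrictFree s m ((∏ j ∈ Finset.univ.erase k, weight A s j) *
    ∏ i, weight A s.swap i) = _
  rw [map_mul, map_prod, map_prod]
  split_ifs with h
  · subst h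
    rfl
  · rw [Finset.prod_eq_zero (i := m) (by simp [h]) (restrictFree_weight_self s m), zero_mul]

/-! ### Localization -/

variable [Algebra ℂ A]

/-- The nonzero homogeneous polynomials in the classes `x_j`, `z_i`. These differ from the
equivariant parameters only by non-equivariant Chern classes of the base; as those are nilpotent,
inverting these polynomials is the same as inverting the nonzero homogeneous elements of
`H_T(pt)`. -/
def homogeneous (n : ℕ) : Submonoid (MvPolynomial (BaseVar n) ℂ) where
  carrier := {p | p ≠ 0 ∧ ∃ d, p.IsHomogeneous d}
  one_mem' := ⟨one_ne_zero, 0, MvPolynomial.isHomogeneous_one _ _⟩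
  mul_mem' := by
    rintro p q ⟨hp, d, hd⟩ ⟨hq, e, he⟩
    exact ⟨mul_ne_zero hp hq, d + e, hd.mul he⟩

variable (n A) in
/-- Polynomials in the `x_j`, `z_i` as elements of `Ĥ_T(B)`. -/
def ofPoly : MvPolynomial (BaseVar n) ℂ →+* HBase n A :=
  (MvPolynomial.aeval fun i => (MvPowerSeries.X i : HBase n A) :
    MvPolynomial (BaseVar n) ℂ →ₐ[ℂ] HBase n A).toRingHom

variable (n A) in
/-- The multiplicative set inverted in `Ĥ_T(B)`. -/
def baseDenominators : Submonoid (HBase n A) := (homogeneous n).map (ofPoly n A)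

variable (n A) in
/-- The multiplicative set inverted in `Ĥ_T(X_±)`. -/
def denominators (s : Chamber) : Submonoid (HX n A s) :=
  (baseDenominators n A).map (pullback n A s)

variable (n A) in
/-- The localized equivariant cohomology of `B`. -/
abbrev HBaseLoc : Type _ := Localization (baseDenominators n A)

variable (n A) in
/-- The localized equivariant cohomology of `X_±`. -/
abbrev HXLoc (s : Chamber) : Type _ := Localization (denominators n A s)

variable (n A) in
/-- The localization map `Ĥ_T(X_±) → Ĥ_T(X_±)_loc`. -/
def toLoc (s : Chamber) : HX n A s →+* HXLoc n A s :=
  algebraMap (HX n A s) (HXLoc n A s)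

/-- Restriction to the `k`-th fixed locus in localized cohomology. -/
def restrictLoc (s : Chamber) (k : Fin n) : HXLoc n A s →+* HBaseLoc n A :=
  IsLocalization.map (M := denominators n A s) (S := HXLoc n A s) (T := baseDenominators n A)
    (HBaseLoc n A) (restrict s k) (by
    rintro _ ⟨f, hf, rfl⟩
    change restrict s k (pullback n A s f) ∈ baseDenominators n A
    rwa [restrict_pullback])

variable (n A) in
/-- Pullback from `B` in localized cohomology. -/
def pullbackLoc (s : Chamber) : HBaseLoc n A →+* HXLoc n A s :=
  IsLocalization.map (M := baseDenominators n A) (S := HBaseLoc n A) (T := denominators n A s)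
    (HXLoc n A s) (pullback n A s) (by
      intro f hf
      exact ⟨f, hf, rfl⟩)

/-- Pushforward along the inclusion of the `k`-th fixed locus. -/
def pushforward (s : Chamber) (k : Fin n) (α : HBaseLoc n A) : HXLoc n A s :=
  pullbackLoc n A s α * algebraMap (HX n A s) _ (fixedClass s k)

/-- Division by the Euler class of the normal bundle of the `k`-th fixed locus. -/
def divEuler (s : Chamber) (k : Fin n) (α : HBaseLoc n A) : HBaseLoc n A :=
  α * Ring.inverse (algebraMap (HBase n A) _ (eulerNormal s k))

/-! ### The transformation `U_H` -/

/-- `exp(f)`. -/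
def expS {σ : Type*} (f : MvPowerSeries σ A) : MvPowerSeries σ A :=
  (PowerSeries.exp ℂ).subst f

/-- `sin(f / 2i)`. -/
def sinHalf (f : HBase n A) : HBase n A :=
  (PowerSeries.sin ℂ).subst ((1 / (2 * Complex.I) : ℂ) • f)

variable (A) in
/-- The coefficient
`C_{k,l} = e^{(n-1)(x_l - z_k)/2} ∏_{i ≠ k} sin((x_l - z_i)/2i) / sin((z_k - z_i)/2i)`. -/
def coeffC (k l : Fin n) : HBaseLoc n A :=
  algebraMap (HBase n A) _
      (expS ((((n : ℂ) - 1) / 2) • (xB n A l - zB n A k)) *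
        ∏ i ∈ Finset.univ.erase k, sinHalf (xB n A l - zB n A i)) *
    Ring.inverse (algebraMap (HBase n A) _
      (∏ i ∈ Finset.univ.erase k, sinHalf (zB n A k - zB n A i)))

variable (n A) in
/-- The map `U_H`. By the localization theorem every `γ` is the sum over `k` of the pushforwards of
`γ|_{B_k} / e(N_k)`; the summand with index `k` is sent to the sum over `l` of the pushforwards of
`C_{k,l} γ|_{B_k} / e(N_l)`. See `UH_pushforward`. -/
def UH : HXLoc n A .minus →+ HXLoc n A .plus where
  toFun γ := ∑ k, ∑ l, pushforward .plus l (divEuler .plus l (coeffC A k l * restrictLoc .minus k γ))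
  map_zero' := by simp [pushforward, divEuler]
  map_add' γ γ' := by
    simp [pushforward, divEuler, mul_add, add_mul, Finset.sum_add_distrib]

theorem restrictLoc_algebraMap (s : Chamber) (k : Fin n) (f : HX n A s) :
    restrictLoc s k (algebraMap (HX n A s) (HXLoc n A s) f) =
      algebraMap (HBase n A) (HBaseLoc n A) (restrict s k f) :=
  IsLocalization.map_eq _ f

theorem pullbackLoc_algebraMap (s : Chamber) (f : HBase n A) :
    pullbackLoc n A s (algebraMap (HBase n A) (HBaseLoc n A) f) =
      algebraMap (HX n A s) (HXLoc n A s) (pullback n A s f) :=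
  IsLocalization.map_eq _ f

theorem restrictLoc_pullbackLoc (s : Chamber) (k : Fin n) (α : HBaseLoc n A) :
    restrictLoc s k (pullbackLoc n A s α) = α := by
  have h : (restrictLoc s k).comp (pullbackLoc n A s) = RingHom.id _ := by
    apply IsLocalization.ringHom_ext (baseDenominators n A)
    refine RingHom.ext fun f => ?_
    change restrictLoc s k (pullbackLoc n A s (algebraMap (HBase n A) (HBaseLoc n A) f)) =
      algebraMap (HBase n A) (HBaseLoc n A) f
    rw [pullbackLoc_algebraMap, restrictLoc_algebraMap, restrict_pullback]
  exact congrArg (fun g => g α) h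

theorem restrictLoc_pushforward (s : Chamber) (m k : Fin n) (α : HBaseLoc n A) :
    restrictLoc s m (pushforward s k α) =
      if m = k then α * algebraMap (HBase n A) _ (eulerNormal s k) else 0 := by
  rw [pushforward, map_mul, restrictLoc_pullbackLoc, restrictLoc_algebraMap, restrict_fixedClass]
  split_ifs <;> simp

theorem sub_mem_baseDenominators {i j : BaseVar n} (h : i ≠ j) :
    (MvPowerSeries.X i - MvPowerSeries.X j : HBase n A) ∈ baseDenominators n A := by
  refine ⟨MvPolynomial.X i - MvPolynomial.X j, ⟨?_, 1, ?_⟩, ?_⟩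
  · exact sub_ne_zero.mpr fun e => h (MvPolynomial.X_injective e)
  · exact (MvPolynomial.isHomogeneous_X ℂ i).sub (MvPolynomial.isHomogeneous_X ℂ j)
  · simp [ofPoly]

theorem eulerNormal_mem (s : Chamber) (k : Fin n) :
    eulerNormal (A := A) s k ∈ baseDenominators n A := by
  refine mul_mem (prod_mem fun j hj => ?_) (prod_mem fun i _ => ?_)
  · have hjk : j ≠ k := Finset.ne_of_mem_erase hj
    cases s
    · have h : restrictFree (A := A) .plus k (weight A .plus j) =
          MvPowerSeries.X (Sum.inl k) - MvPowerSeries.X (Sum.inl j) := by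
        simp [weight, xF, yF, restrictFree_X, restrictVar, root, xB]
        ring
      rw [h]
      exact sub_mem_baseDenominators (by simpa using hjk.symm)
    · have h : restrictFree (A := A) .minus k (weight A .minus j) =
          MvPowerSeries.X (Sum.inr j) - MvPowerSeries.X (Sum.inr k) := by
        simp [weight, zF, yF, restrictFree_X, restrictVar, root, zB]
        ring
      rw [h]
      exact sub_mem_baseDenominators (by simpa using hjk)
  · cases s
    · have h : restrictFree (A := A) .plus k (weight A .minus i) =
          MvPowerSeries.X (Sum.inr i) - MvPowerSeries.X (Sum.inl k) := by
        simp [weight, zF, yF, restrictFree_X, restrictVar, root, xB]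
        ring
      rw [Chamber.swap, h]
      exact sub_mem_baseDenominators (by simp)
    · have h : restrictFree (A := A) .minus k (weight A .plus i) =
          MvPowerSeries.X (Sum.inr k) - MvPowerSeries.X (Sum.inl i) := by
        simp [weight, xF, yF, restrictFree_X, restrictVar, root, zB]
        ring
      rw [Chamber.swap, h]
      exact sub_mem_baseDenominators (by simp)

theorem isUnit_eulerNormal (s : Chamber) (k : Fin n) :
    IsUnit (algebraMap (HBase n A) (HBaseLoc n A) (eulerNormal s k)) :=
  IsLocalization.map_units (M := baseDenominators n A) (HBaseLoc n A)
    ⟨eulerNormal s k, eulerNormal_mem s k⟩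

/-- `U_H` is given on the localized classes of the fixed loci by the coefficients `C_{k,l}`. -/
theorem UH_pushforward (k : Fin n) (α : HBaseLoc n A) :
    UH n A (pushforward .minus k (divEuler .minus k α)) =
      ∑ l, pushforward .plus l (divEuler .plus l (coeffC A k l * α)) := by
  change ∑ m, ∑ l, pushforward .plus l (divEuler .plus l (coeffC A m l *
    restrictLoc .minus m (pushforward .minus k (divEuler .minus k α)))) = _
  rw [Finset.sum_eq_single k]
  · have h : restrictLoc .minus k (pushforward .minus k (divEuler .minus k α)) = α := by
      rw [restrictLoc_pushforward, if_pos rfl, divEuler, mul_assoc,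
        Ring.inverse_mul_cancel _ (isUnit_eulerNormal _ k), mul_one]
    simp only [h]
  · intro m _ hm
    rw [restrictLoc_pushforward, if_neg hm]
    simp [divEuler, pushforward]
  · simp

/-- `U_H` is linear over the localized cohomology of `B`. -/
theorem UH_pullbackLoc_mul (c : HBaseLoc n A) (γ : HXLoc n A .minus) :
    UH n A (pullbackLoc n A .minus c * γ) = pullbackLoc n A .plus c * UH n A γ := by
  change ∑ k, ∑ l, pushforward .plus l (divEuler .plus l (coeffC A k l *
    restrictLoc .minus k (pullbackLoc n A .minus c * γ))) = pullbackLoc n A .plus c *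
      ∑ k, ∑ l, pushforward .plus l (divEuler .plus l (coeffC A k l * restrictLoc .minus k γ))
  rw [Finset.mul_sum]
  refine Finset.sum_congr rfl fun k _ => ?_
  rw [Finset.mul_sum]
  refine Finset.sum_congr rfl fun l _ => ?_
  rw [map_mul, restrictLoc_pullbackLoc]
  simp only [pushforward, divEuler, map_mul]
  ring

/-- The denominators of the coefficients `C_{k,l}` are invertible. -/
theorem isUnit_sinHalf_sub {i k : Fin n} (h : k ≠ i) :
    IsUnit (algebraMap (HBase n A) (HBaseLoc n A) (sinHalf (zB n A k - zB n A i))) := by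
  obtain ⟨g, hg⟩ : (PowerSeries.X : PowerSeries ℂ) ∣ PowerSeries.sin ℂ := by
    rw [PowerSeries.X_dvd_iff, ← PowerSeries.coeff_zero_eq_constantCoeff_apply]
    simp [PowerSeries.sin]
  obtain ⟨f, hf⟩ : (PowerSeries.X : PowerSeries ℂ) ∣ g - 1 := by
    have h1 : PowerSeries.coeff 1 (PowerSeries.sin ℂ) = 1 := by simp [PowerSeries.sin]
    rw [hg, show (1 : ℕ) = 0 + 1 from rfl, PowerSeries.coeff_succ_X_mul] at h1
    rw [PowerSeries.X_dvd_iff, map_sub, ← PowerSeries.coeff_zero_eq_constantCoeff_apply, h1]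
    simp
  set u : HBase n A := (1 / (2 * Complex.I) : ℂ) • (zB n A k - zB n A i) with hu
  have hu0 : MvPowerSeries.constantCoeff u = 0 := by
    rw [hu, ← MvPowerSeries.coeff_zero_eq_constantCoeff_apply, algebra_compatible_smul A, map_smul]
    simp [zB]
  have hs : PowerSeries.HasSubst u := PowerSeries.HasSubst.of_constantCoeff_zero hu0
  have key : sinHalf (zB n A k - zB n A i) =
      (zB n A k - zB n A i) * ((1 / (2 * Complex.I) : ℂ) • (1 + u * f.subst u)) := by
    have e : PowerSeries.sin ℂ = PowerSeries.X * (1 + PowerSeries.X * f) := by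
      rw [hg, ← hf]
      ring
    have e1 : (1 : PowerSeries ℂ).subst u = 1 := by
      rw [← PowerSeries.coe_substAlgHom hs, map_one]
    rw [sinHalf, ← hu, e, PowerSeries.subst_mul hs, PowerSeries.subst_add hs,
      PowerSeries.subst_mul hs, PowerSeries.subst_X hs, e1, mul_smul_comm, ← smul_mul_assoc, ← hu]
  have hunit : IsUnit ((1 / (2 * Complex.I) : ℂ) • (1 + u * f.subst u)) := by
    rw [MvPowerSeries.isUnit_iff_constantCoeff,
      ← MvPowerSeries.coeff_zero_eq_constantCoeff_apply, algebra_compatible_smul A, map_smul,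
      MvPowerSeries.coeff_zero_eq_constantCoeff_apply, map_add, map_mul, hu0, zero_mul, add_zero,
      map_one, smul_eq_mul, mul_one]
    exact (IsUnit.mk0 _ (by simp)).map (algebraMap ℂ A)
  rw [key, map_mul]
  refine IsUnit.mul ?_ (hunit.map _)
  exact IsLocalization.map_units (M := baseDenominators n A) (HBaseLoc n A)
    ⟨_, sub_mem_baseDenominators (i := Sum.inr k) (j := Sum.inr i) (by simpa using h)⟩

end Geometry

/-! ### Convergence and analyticity in `Ĥ_T(X_±)` -/

section Analysis

variable {n : ℕ} {A : Type*} [CommRing A] [Algebra ℂ A] {s : Chamber}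

/-- The linear functionals on `Ĥ_T(X_±)` that only depend on finitely many coefficients of a
representing power series. -/
def IsCoeffFunctional (φ : HX n A s →ₗ[ℂ] ℂ) : Prop :=
  ∃ D : Finset (Option (BaseVar n) →₀ ℕ), ∀ f : HFree n A,
    (∀ m ∈ D, MvPowerSeries.coeff m f = 0) → φ (Ideal.Quotient.mk _ f) = 0

/-- The topology of coefficientwise convergence on `Ĥ_T(X_±)`, which is a product of copies of the
base cohomology. -/
instance : TopologicalSpace (HX n A s) :=
  ⨅ φ : {φ : HX n A s →ₗ[ℂ] ℂ // IsCoeffFunctional φ},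
    TopologicalSpace.induced (fun f => φ.1 f) inferInstance

/-- `F` is analytic at `w`, coefficientwise. -/
def CoeffAnalyticAt (F : ℂ → HX n A s) (w : ℂ) : Prop :=
  ∀ φ : HX n A s →ₗ[ℂ] ℂ, IsCoeffFunctional φ → AnalyticAt ℂ (fun u => φ (F u)) w

/-- `F` is an analytic continuation along the path `γ` of the function `f`, which is given near the
initial part of the path: `F t` is a function that is analytic at `γ t`, nearby values of `t` give
functions with the same germs, and near the beginning of `γ` the germ is that of `f`. -/
structure IsAnalyticContinuation (γ : ℝ → ℂ) (f : ℂ → HX n A s) (F : ℝ → ℂ → HX n A s) : Prop where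
  analytic : ∀ t, CoeffAnalyticAt (F t) (γ t)
  compatible : ∀ t, ∀ᶠ t' in 𝓝 t, F t' =ᶠ[𝓝 (γ t')] F t
  initial : ∀ᶠ t in atBot, F t =ᶠ[𝓝 (γ t)] f

/-- The paths of analytic continuation in the plane of `log q_+`: paths from `q_+ = 0` to
`q_+ = ∞`, that is, from `Re = -∞` to `Re = +∞`, which cross the line `Re = 0` only between the
two singular points `(n - 2)πi` and `nπi`, in particular those through the point `(n - 1)πi`. The
singular points are `nπi + 2πiℤ`, so that all these paths are homotopic. (The imaginary part at the
two ends is irrelevant, as `H_{X_±}` are single-valued in the half planes `Re ≠ 0`.) -/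
structure IsContinuationPath (n : ℕ) (γ : ℝ → ℂ) : Prop where
  continuous : Continuous γ
  start : Tendsto (fun t => (γ t).re) atBot atBot
  finish : Tendsto (fun t => (γ t).re) atTop atTop
  crossing : ∀ t, (γ t).re = 0 → |(γ t).im - ((n : ℝ) - 1) * Real.pi| < Real.pi

end Analysis

/-! ### The functions `H_{X_±, β}` -/

/-- The Taylor series at `u = 0` of the entire function `1 / Γ(1 + N + u)`. -/
def rGamma (N : ℤ) : PowerSeries ℂ :=
  PowerSeries.mk fun m =>
    iteratedDeriv m (fun u : ℂ => (Complex.Gamma (1 + N + u))⁻¹) 0 / (m.factorial : ℂ)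

section Hypergeometric

variable {n : ℕ} (A : Type*) [CommRing A] [Algebra ℂ A]

/-- The class `1 / Γ(1 + f / 2πi + N)`, for `f` without constant term. -/
def rGammaAt (N : ℤ) (f : HFree n A) : HFree n A :=
  (rGamma N).subst ((1 / (2 * Real.pi * Complex.I) : ℂ) • f)

/-- The summand of index `e` of `H_{X_+}`, where `w = log q_+` and `a j = β · L_j`,
`b i = β · M_i`. -/
def plusTerm (a b : Fin n → ℤ) (w : ℂ) (e : ℤ) : HX n A .plus :=
  Ideal.Quotient.mk _
    (Complex.exp (e * w) • expS ((-w / (2 * Real.pi * Complex.I)) • yF n A) *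
      ∏ j, (rGammaAt A (a j + e) (-xF n A j - yF n A) * rGammaAt A (-b j - e) (zF n A j + yF n A)))

/-- The summand of index `d` of `H_{X_-}`, where `w = log q_-` and `a j = β · L_j`,
`b i = β · M_i`. -/
def minusTerm (a b : Fin n → ℤ) (w : ℂ) (d : ℤ) : HX n A .minus :=
  Ideal.Quotient.mk _
    (Complex.exp (d * w) • expS ((w / (2 * Real.pi * Complex.I)) • yF n A) *
      ∏ j, (rGammaAt A (a j - d) (-xF n A j - yF n A) * rGammaAt A (-b j + d) (zF n A j + yF n A)))

/-- `H_{X_+, β}` as a function of `log q_+`. -/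
def HPlus (a b : Fin n → ℤ) (w : ℂ) : HX n A .plus := ∑' e : ℤ, plusTerm A a b w e

/-- `H_{X_-, β}` as a function of `log q_-`. -/
def HMinus (a b : Fin n → ℤ) (w : ℂ) : HX n A .minus := ∑' d : ℤ, minusTerm A a b w d

end Hypergeometric

end ToricFlop

end

open ToricFlop

/-!
The analytic continuation is a Barnes integral, carried out with coefficients in a ring of power
series.

All terms of `H_{X_±}` come from one family `Ψ(s) ∈ ℂ[[x, z, y]]` (`hyperTerm`), which is entire in
the complexified summation index `s` and depends on `s` and `y` only through `s - y/2πi`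
(`isTransportedAt_hyperTerm`): `H_{X₊}` is the class of the sum of the `Ψ(m)`, and `H_{X₋}`, at
`log q₋ = -log q₊`, is the class of the same formal sum in another quotient. The terms with `m`
small are divisible by the relation of `X₊` and those with `m` large by the relation of `X₋`
(`exists_cutoff`), so that both sums are effectively half-infinite.

Let `η = e^{-y}` and `ζ_i = e^{z_i}`. The integrand (`barnesKernel`, up to the factor `e^{ws}`) is

  `Ψ(s)|_{y = 0} · 2πi e^{2πis} / (e^{2πis} - η) · ∏_i (η - ζ_i) / (e^{2πis} - ζ_i)`.

Because `η` and the `ζ_i` have constant term `1`, each coefficient of the integrand is a meromorphic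
function of `s` with poles only at the integers. The residue of the first part
`Ψ(s)|_{y = 0} · 2πi e^{2πis} / (e^{2πis} - η)` at `m` is `Ψ(m)` with its full dependence on `y`:
since `Ψ` is a function of `s - y/2πi` and the kernel one of `s + y/2πi`, a derivative with respect
to `y` is turned into one with respect to `s`, and integration by parts applies
(`rectInt_coeff_mul_shiftedKernel`). Partial fractions in `e^{2πis}`, that is, Lagrange
interpolation with the nodes `ζ_i`, then give the residue of the integrand
(`nodeDiscr_mul_barnesResidue`) as

  `Ψ(m) - ∑_k ∏_{i ≠ k} (η - ζ_i) / (ζ_k - ζ_i) · Ψ(m)|_{y = -z_k}`.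

For large `m` the sum vanishes, and the residue is `Ψ(m)` (`barnesResidue_eq`).

A bound for `1 / (Γ(p) Γ(q))` with `p + q` bounded (`pairBound_inv_Gamma`) shows that the integral
over a vertical line converges and is analytic for `|Im w - (n - 1)π| < π`, with `w = log q₊`
(`isBarnesKernel_coeff`), which is the strip through which the path crosses the imaginary axis.
Closing the contour to the right for `Re w < 0` gives `H_{X₊}` (`hyperSum_Ici_eq_middleSum`), and
closing it to the left for `Re w > 0` (`mk_rightSum_eq_mk_middleSum`) leaves

  `∑_k ∏_{i ≠ k} (η - ζ_i) / (ζ_k - ζ_i) · ∑_m Ψ(m)|_{y = -z_k}`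

(`nodeDiscr_mul_rightSum`). The restriction to the `l`-th fixed locus of `X₊` sends `η` to
`e^{x_l}`, and the coefficients become those of `U_H` (`coeffC_mul_nodeProd`), while
`Ψ(m)|_{y = -z_k}` is the restriction to the `k`-th fixed locus of `X₋`. By the localization theorem
(`toLoc_eq_sum_pushforward`) the restrictions determine a class. Coefficientwise limits in the
cohomology of `X_±` are unique because the ideal of relations is homogeneous, hence closed
(`eq_zero_of_isCoeffFunctional`).
-/

namespace ToricFlop

noncomputable section

/-! ### Substitution of power series, coefficient by coefficient -/

section Formal

variable {σ τ : Type*} {R : Type*} [CommRing R] [Algebra ℂ R]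

/-- A coefficient of `g(ℓ)` is a finite linear combination of the coefficients of `g`, and the
combination does not depend on `g`. -/
theorem exists_coeff_subst_eq_sum {ℓ : MvPowerSeries τ R} (hℓ : PowerSeries.HasSubst ℓ)
    (α : τ →₀ ℕ) : ∃ D : Finset ℕ, (∀ r, r ∉ D → MvPowerSeries.coeff α (ℓ ^ r) = 0) ∧
      ∀ g : PowerSeries ℂ, MvPowerSeries.coeff α (g.subst ℓ) =
        ∑ r ∈ D, PowerSeries.coeff r g • MvPowerSeries.coeff α (ℓ ^ r) := by
  have hfin := PowerSeries.coeff_subst_finite hℓ (PowerSeries.mk fun _ => (1 : ℂ)) α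
  simp only [PowerSeries.coeff_mk, one_smul] at hfin
  have h0 : ∀ r, r ∉ hfin.toFinset → MvPowerSeries.coeff α (ℓ ^ r) = 0 := by
    intro r hr
    by_contra h
    exact hr (hfin.mem_toFinset.2 h)
  refine ⟨hfin.toFinset, h0, fun g => ?_⟩
  rw [PowerSeries.coeff_subst hℓ]
  refine finsum_eq_sum_of_support_subset _ fun r hr => ?_
  by_contra h
  exact hr (by simp [h0 r h])

theorem subst_one' {ℓ : MvPowerSeries τ R} (hℓ : PowerSeries.HasSubst ℓ) :
    (1 : PowerSeries ℂ).subst ℓ = 1 := by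
  rw [← PowerSeries.coe_substAlgHom hℓ, map_one]

/-- Coefficientwise extension of scalars from `ℂ` commutes with substitution into a power series. -/
theorem map_subst_complex {ℓ : MvPowerSeries τ ℂ} (hℓ : PowerSeries.HasSubst ℓ)
    (g : PowerSeries ℂ) :
    MvPowerSeries.map (algebraMap ℂ R) (g.subst ℓ) =
      g.subst (MvPowerSeries.map (algebraMap ℂ R) ℓ) := by
  have hℓ' : PowerSeries.HasSubst (MvPowerSeries.map (algebraMap ℂ R) ℓ) := by
    rw [PowerSeries.hasSubst_iff] at hℓ ⊢
    exact hℓ.map _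
  rw [PowerSeries.map_subst hℓ]
  ext α
  rw [PowerSeries.coeff_subst hℓ', PowerSeries.coeff_subst hℓ']
  refine finsum_congr fun r => ?_
  rw [PowerSeries.coeff_map, smul_eq_mul, Algebra.smul_def]

theorem hasSubst_smul {ℓ : MvPowerSeries τ R} (hℓ : MvPowerSeries.constantCoeff ℓ = 0) (c : ℂ) :
    PowerSeries.HasSubst (c • ℓ) := by
  apply PowerSeries.HasSubst.of_constantCoeff_zero
  rw [← MvPowerSeries.coeff_zero_eq_constantCoeff_apply, algebra_compatible_smul R, map_smul,
    MvPowerSeries.coeff_zero_eq_constantCoeff_apply, hℓ, smul_zero]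

theorem constantCoeff_csmul (ℓ : MvPowerSeries τ R) (c : ℂ) :
    MvPowerSeries.constantCoeff (c • ℓ) = c • MvPowerSeries.constantCoeff ℓ := by
  rw [← MvPowerSeries.coeff_zero_eq_constantCoeff_apply, algebra_compatible_smul R, map_smul,
    MvPowerSeries.coeff_zero_eq_constantCoeff_apply, algebraMap_smul]

theorem coeff_csmul (ℓ : MvPowerSeries τ R) (c : ℂ) (α : τ →₀ ℕ) :
    MvPowerSeries.coeff α (c • ℓ) = c • MvPowerSeries.coeff α ℓ := by
  rw [algebra_compatible_smul R, map_smul, algebraMap_smul]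

theorem map_csmul (ℓ : MvPowerSeries τ ℂ) (c : ℂ) :
    MvPowerSeries.map (algebraMap ℂ R) (c • ℓ) =
      c • MvPowerSeries.map (algebraMap ℂ R) ℓ := by
  ext α
  rw [MvPowerSeries.coeff_map, coeff_csmul, coeff_csmul, MvPowerSeries.coeff_map, smul_eq_mul,
    map_mul, Algebra.smul_def]

/-- An algebra homomorphism between power series rings that is given by substitution commutes with
the substitution into a power series in one variable. -/
theorem algHom_subst {a : σ → MvPowerSeries τ R} (ha : MvPowerSeries.HasSubst a)
    {ℓ : MvPowerSeries σ R} (hℓ : PowerSeries.HasSubst ℓ) (g : PowerSeries ℂ) :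
    MvPowerSeries.substAlgHom (R := R) ha (g.subst ℓ) =
      g.subst (MvPowerSeries.substAlgHom (R := R) ha ℓ) := by
  have h := MvPowerSeries.subst_comp_subst_apply (R := ℂ) hℓ.const ha g
  rw [MvPowerSeries.substAlgHom_apply, MvPowerSeries.substAlgHom_apply]
  exact h

theorem algHom_csmul {a : σ → MvPowerSeries τ R} (ha : MvPowerSeries.HasSubst a)
    (ℓ : MvPowerSeries σ R) (c : ℂ) :
    MvPowerSeries.substAlgHom (R := R) ha (c • ℓ) =
      c • MvPowerSeries.substAlgHom (R := R) ha ℓ := by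
  rw [algebra_compatible_smul R, map_smul, algebraMap_smul]

/-- Substitution commutes with extension of scalars from `ℂ`. -/
theorem map_substAlgHom {a : σ → MvPowerSeries τ ℂ} (ha : MvPowerSeries.HasSubst a)
    {a' : σ → MvPowerSeries τ R} (ha' : MvPowerSeries.HasSubst a')
    (h : ∀ i, MvPowerSeries.map (algebraMap ℂ R) (a i) = a' i) (f : MvPowerSeries σ ℂ) :
    MvPowerSeries.map (algebraMap ℂ R) (MvPowerSeries.substAlgHom (R := ℂ) ha f) =
      MvPowerSeries.substAlgHom (R := R) ha' (MvPowerSeries.map (algebraMap ℂ R) f) := by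
  rw [MvPowerSeries.substAlgHom_apply, MvPowerSeries.substAlgHom_apply, MvPowerSeries.map_subst ha]
  congr 1
  exact funext h

/-- A coefficient of the result of a substitution is a finite linear combination of the coefficients
of the given series, and the combination does not depend on the series. -/
theorem exists_coeff_substAlgHom_eq_sum {R : Type*} [CommRing R] {a : σ → MvPowerSeries τ R}
    (ha : MvPowerSeries.HasSubst a) (β : τ →₀ ℕ) :
    ∃ (D : Finset (σ →₀ ℕ)) (c : (σ →₀ ℕ) → R), ∀ f : MvPowerSeries σ R,
      MvPowerSeries.coeff β (MvPowerSeries.substAlgHom (R := R) ha f) =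
        ∑ α ∈ D, MvPowerSeries.coeff α f * c α := by
  have hfin := MvPowerSeries.coeff_subst_finite ha (fun _ => (1 : R) : MvPowerSeries σ R) β
  have h1 : ∀ d : σ →₀ ℕ, MvPowerSeries.coeff d (fun _ => (1 : R) : MvPowerSeries σ R) = 1 :=
    fun d => rfl
  simp only [h1, one_smul] at hfin
  refine ⟨hfin.toFinset, fun d => MvPowerSeries.coeff β (d.prod fun s e => a s ^ e), fun f => ?_⟩
  rw [MvPowerSeries.substAlgHom_apply, MvPowerSeries.coeff_subst ha]
  refine finsum_eq_sum_of_support_subset _ fun r hr => ?_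
  by_contra h
  have h0 : MvPowerSeries.coeff β (r.prod fun s e => a s ^ e) = 0 := by
    by_contra h'
    exact h (hfin.mem_toFinset.2 h')
  exact hr (by simp [h0])

/-! ### The formal exponential -/

theorem exp_subst_add_bivariate :
    (PowerSeries.exp ℂ).subst (MvPowerSeries.X 0 + MvPowerSeries.X 1 : MvPowerSeries (Fin 2) ℂ) =
      (PowerSeries.exp ℂ).subst (MvPowerSeries.X 0 : MvPowerSeries (Fin 2) ℂ) *
        (PowerSeries.exp ℂ).subst (MvPowerSeries.X 1 : MvPowerSeries (Fin 2) ℂ) := by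
  ext e
  rw [PowerSeries.coeff_subst_X_zero_add_X_one, PowerSeries.coeff_subst_X_zero_subst_mul_X_one]
  simp only [PowerSeries.coeff_exp, map_div₀, map_one, map_natCast]
  have h : ((e 0 + e 1).choose (e 0) * (e 0).factorial * (e 1).factorial : ℂ) =
      (e 0 + e 1).factorial := by
    exact_mod_cast Nat.choose_symm_add (a := e 0) (b := e 1) ▸
      Nat.add_choose_mul_factorial_mul_factorial (e 0) (e 1)
  have h0 : ((e 0).factorial : ℂ) ≠ 0 := by exact_mod_cast (e 0).factorial_ne_zero
  have h1 : ((e 1).factorial : ℂ) ≠ 0 := by exact_mod_cast (e 1).factorial_ne_zero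
  have h2 : ((e 0 + e 1).factorial : ℂ) ≠ 0 := by exact_mod_cast (e 0 + e 1).factorial_ne_zero
  field_simp
  linear_combination h

theorem expS_add {f g : MvPowerSeries τ R} (hf : MvPowerSeries.constantCoeff f = 0)
    (hg : MvPowerSeries.constantCoeff g = 0) : expS (f + g) = expS f * expS g := by
  have ha : MvPowerSeries.HasSubst ![f, g] :=
    MvPowerSeries.hasSubst_of_constantCoeff_zero fun i => by fin_cases i <;> simp [hf, hg]
  have hs : ∀ ℓ : MvPowerSeries (Fin 2) ℂ, MvPowerSeries.constantCoeff ℓ = 0 →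
      MvPowerSeries.subst ![f, g] ((PowerSeries.exp ℂ).subst ℓ) =
        (PowerSeries.exp ℂ).subst (MvPowerSeries.subst ![f, g] ℓ) := fun ℓ hℓ =>
    MvPowerSeries.subst_comp_subst_apply (R := ℂ)
      (PowerSeries.HasSubst.of_constantCoeff_zero hℓ).const ha _
  have h := congrArg (MvPowerSeries.subst ![f, g]) exp_subst_add_bivariate
  rw [MvPowerSeries.subst_mul ha, hs _ (by simp), hs _ (by simp), hs _ (by simp),
    MvPowerSeries.subst_add ha, MvPowerSeries.subst_X ha, MvPowerSeries.subst_X ha] at h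
  exact h

theorem expS_zero : expS (0 : MvPowerSeries τ R) = 1 := by
  rw [expS, PowerSeries.subst_zero_eq_C_constantCoeff]
  simp

theorem constantCoeff_expS {f : MvPowerSeries τ R} (hf : MvPowerSeries.constantCoeff f = 0) :
    MvPowerSeries.constantCoeff (expS f) = 1 := by
  have hs := PowerSeries.HasSubst.of_constantCoeff_zero hf
  obtain ⟨g, hg⟩ : (PowerSeries.X : PowerSeries ℂ) ∣ PowerSeries.exp ℂ - 1 := by
    rw [PowerSeries.X_dvd_iff]
    simp
  have : expS f = 1 + f * g.subst f := by
    rw [expS, show PowerSeries.exp ℂ = 1 + PowerSeries.X * g by rw [← hg]; ring,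
      PowerSeries.subst_add hs, PowerSeries.subst_mul hs, PowerSeries.subst_X hs, subst_one' hs]
  simp [this, hf]

theorem expS_nsmul {f : MvPowerSeries τ R} (hf : MvPowerSeries.constantCoeff f = 0) (m : ℕ) :
    expS ((m : ℂ) • f) = expS f ^ m := by
  induction m with
  | zero => simp [expS_zero]
  | succ m ih =>
    rw [Nat.cast_succ, add_smul, one_smul, expS_add _ hf, ih, pow_succ]
    rw [constantCoeff_csmul, hf, smul_zero]

theorem subst_rescale {ℓ : MvPowerSeries τ R} (hℓ : MvPowerSeries.constantCoeff ℓ = 0) (c : ℂ)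
    (g : PowerSeries ℂ) : (PowerSeries.rescale c g).subst ℓ = g.subst (c • ℓ) := by
  ext α
  rw [PowerSeries.coeff_subst (PowerSeries.HasSubst.of_constantCoeff_zero hℓ),
    PowerSeries.coeff_subst (hasSubst_smul hℓ c)]
  refine finsum_congr fun r => ?_
  rw [PowerSeries.coeff_rescale, smul_pow, coeff_csmul, smul_smul, mul_comm]

theorem two_I_smul_sin : (2 * Complex.I) • PowerSeries.sin ℂ =
    PowerSeries.rescale Complex.I (PowerSeries.exp ℂ) -
      PowerSeries.rescale (-Complex.I) (PowerSeries.exp ℂ) := by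
  ext m
  rw [map_smul, map_sub, PowerSeries.coeff_rescale, PowerSeries.coeff_rescale,
    PowerSeries.coeff_exp, PowerSeries.sin, PowerSeries.coeff_mk]
  rcases Nat.even_or_odd m with h | h
  · simp [h, h.neg_pow]
  · rw [if_neg (Nat.not_even_iff_odd.2 h), h.neg_pow]
    obtain ⟨k, rfl⟩ := h
    have : (2 * k + 1) / 2 = k := by omega
    rw [this, pow_succ, pow_mul, Complex.I_sq]
    simp
    ring

theorem sinHalf_mul {n : ℕ} {f : HBase n R} (hf : MvPowerSeries.constantCoeff f = 0) :
    (2 * Complex.I : ℂ) • sinHalf f = expS ((1 / 2 : ℂ) • f) - expS ((-1 / 2 : ℂ) • f) := by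
  have h1 : MvPowerSeries.constantCoeff ((1 / (2 * Complex.I) : ℂ) • f) = 0 := by
    rw [constantCoeff_csmul, hf, smul_zero]
  have hs := PowerSeries.HasSubst.of_constantCoeff_zero h1
  rw [sinHalf, ← PowerSeries.subst_smul hs, two_I_smul_sin, PowerSeries.subst_sub hs,
    subst_rescale h1, subst_rescale h1, smul_smul, smul_smul, expS, expS]
  have e1 : Complex.I * (1 / (2 * Complex.I)) = 1 / 2 := by
    field_simp
  have e2 : -Complex.I * (1 / (2 * Complex.I)) = -1 / 2 := by
    field_simp
  rw [e1, e2]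

end Formal

/-! ### Growth of products of reciprocal Gamma functions -/

section Gamma

/-- The product `g(p) h(q)` grows at most like a power of `|p|` times `e^{π |Im p|}`, as long as
`p + q` stays bounded. -/
def PairBound (g h : ℂ → ℂ) : Prop :=
  ∀ K : ℝ, ∃ (C : ℝ) (N : ℕ), 0 ≤ C ∧ ∀ p q : ℂ, ‖p + q‖ ≤ K →
    ‖g p * h q‖ ≤ C * (1 + ‖p‖) ^ N * Real.exp (Real.pi * |p.im|)

theorem norm_betaIntegral_le_one {s t : ℂ} (hs : 1 ≤ s.re) (ht : 1 ≤ t.re) :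
    ‖Complex.betaIntegral s t‖ ≤ 1 := by
  have h : ∀ x ∈ Set.uIoc (0 : ℝ) 1, ‖(x : ℂ) ^ (s - 1) * (1 - (x : ℂ)) ^ (t - 1)‖ ≤ 1 := by
    intro x hx
    rw [Set.uIoc_of_le zero_le_one] at hx
    rw [norm_mul, Complex.norm_cpow_eq_rpow_re_of_pos hx.1]
    have h1 : x ^ (s - 1).re ≤ 1 := Real.rpow_le_one hx.1.le hx.2 (by simpa using hs)
    have h2 : ‖(1 - (x : ℂ)) ^ (t - 1)‖ ≤ 1 := by
      have e : (1 - (x : ℂ)) = ((1 - x : ℝ) : ℂ) := by push_cast; ring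
      rw [e]
      rcases hx.2.eq_or_lt with rfl | hlt
      · rw [sub_self, Complex.ofReal_zero]
        by_cases h0 : t - 1 = 0
        · simp [h0]
        · simp [Complex.zero_cpow h0]
      · rw [Complex.norm_cpow_eq_rpow_re_of_pos (by linarith)]
        exact Real.rpow_le_one (by linarith) (by linarith [hx.1]) (by simpa using ht)
    exact mul_le_one₀ h1 (norm_nonneg _) h2
  simpa [Complex.betaIntegral] using intervalIntegral.norm_integral_le_of_norm_le_const h

/-- The reflection formula for `1/Γ`, which also holds at the zeros of the sine. -/
theorem inv_Gamma_eq_of_re_nonpos {q : ℂ} (hq : q.re ≤ 0) :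
    (Complex.Gamma q)⁻¹ = Complex.Gamma (1 - q) * (Complex.sin (Real.pi * q) / Real.pi) := by
  have h := Complex.Gamma_mul_Gamma_one_sub q
  have hne : Complex.Gamma (1 - q) ≠ 0 :=
    Complex.Gamma_ne_zero_of_re_pos (by rw [Complex.sub_re, Complex.one_re]; linarith)
  have hpi : (Real.pi : ℂ) ≠ 0 := by exact_mod_cast Real.pi_ne_zero
  by_cases hs : Complex.sin (Real.pi * q) = 0
  · rw [hs, div_zero] at h
    rcases mul_eq_zero.1 h with h | h
    · simp [h, hs]
    · exact absurd h hne
  · have hG : Complex.Gamma q ≠ 0 := by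
      intro h0
      rw [h0, zero_mul, eq_comm, div_eq_zero_iff] at h
      exact h.elim hpi hs
    rw [eq_div_iff hs] at h
    rw [eq_comm, ← mul_div_assoc, div_eq_iff hpi, inv_mul_eq_div, eq_div_iff hG]
    linear_combination h

theorem norm_sin_le (z : ℂ) : ‖Complex.sin z‖ ≤ Real.exp |z.im| := by
  have h1 : ‖Complex.exp (-z * Complex.I)‖ ≤ Real.exp |z.im| := by
    rw [Complex.norm_exp]
    simpa using le_abs_self z.im
  have h2 : ‖Complex.exp (z * Complex.I)‖ ≤ Real.exp |z.im| := by
    rw [Complex.norm_exp]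
    simpa using neg_le_abs z.im
  rw [Complex.sin, norm_div, norm_mul, Complex.norm_I, mul_one, Complex.norm_ofNat]
  have := norm_sub_le (Complex.exp (-z * Complex.I)) (Complex.exp (z * Complex.I))
  linarith

theorem abs_im_le_of_norm_add_le {p q : ℂ} {K : ℝ} (h : ‖p + q‖ ≤ K) : |q.im| ≤ |p.im| + K := by
  have h1 := (Complex.abs_im_le_norm (p + q)).trans h
  rw [Complex.add_im] at h1
  rw [abs_le] at h1 ⊢
  constructor <;> cases abs_cases p.im <;> linarith

/-- The function `1/Γ` is bounded on discs. -/
theorem exists_norm_inv_Gamma_le (K : ℝ) :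
    ∃ M : ℝ, 0 ≤ M ∧ ∀ z : ℂ, ‖z‖ ≤ K → ‖(Complex.Gamma z)⁻¹‖ ≤ M := by
  obtain ⟨M, hM⟩ := (isCompact_closedBall (0 : ℂ) K).exists_bound_of_continuousOn
    Complex.differentiable_one_div_Gamma.continuous.continuousOn
  exact ⟨max M 0, le_max_right _ _, fun z hz =>
    (hM z (by simpa using hz)).trans (le_max_left _ _)⟩

/-- In the half plane `Re q ≤ 0`, the reflection formula and the beta integral bound
`1 / (Γ(p) Γ(q)) = sin(πq) B(1 - q, p + q - 1) / (π Γ(p + q - 1))`. -/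
theorem exists_norm_inv_Gamma_mul_le_of_re_nonpos (K : ℝ) : ∃ M : ℝ, 0 ≤ M ∧ ∀ p q : ℂ,
    ‖p + q‖ ≤ K → 2 ≤ (p + q).re → q.re ≤ 0 →
      ‖(Complex.Gamma p)⁻¹ * (Complex.Gamma q)⁻¹‖ ≤ M * Real.exp (Real.pi * |p.im|) := by
  obtain ⟨M, hM0, hM⟩ := exists_norm_inv_Gamma_le (K + 1)
  refine ⟨M * Real.exp (Real.pi * K), by positivity, fun p q hK h2 hq => ?_⟩
  have hre : (p + q).re = p.re + q.re := Complex.add_re p q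
  have hu : 1 ≤ (1 - q).re := by rw [Complex.sub_re, Complex.one_re]; linarith
  have ht : 1 ≤ (p + q - 1).re := by rw [Complex.sub_re, Complex.one_re]; linarith
  have hB := Complex.Gamma_mul_Gamma_eq_betaIntegral (s := 1 - q) (t := p + q - 1)
    (by linarith) (by linarith)
  rw [show 1 - q + (p + q - 1) = p by ring] at hB
  have hp : Complex.Gamma p ≠ 0 := Complex.Gamma_ne_zero_of_re_pos (by linarith)
  have hg : Complex.Gamma (p + q - 1) ≠ 0 := Complex.Gamma_ne_zero_of_re_pos (by linarith)
  have hpi : (Real.pi : ℂ) ≠ 0 := by exact_mod_cast Real.pi_ne_zero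
  have e : (Complex.Gamma p)⁻¹ * (Complex.Gamma q)⁻¹ = Complex.betaIntegral (1 - q) (p + q - 1) *
      (Complex.sin (Real.pi * q) / Real.pi) * (Complex.Gamma (p + q - 1))⁻¹ := by
    rw [inv_Gamma_eq_of_re_nonpos hq]
    rw [inv_mul_eq_iff_eq_mul₀ hp, ← mul_assoc, eq_mul_inv_iff_mul_eq₀ hg]
    linear_combination (Complex.sin (Real.pi * q) / Real.pi) * hB
  have h1 := norm_betaIntegral_le_one hu ht
  have h3 : ‖Complex.sin (Real.pi * q) / Real.pi‖ ≤
      Real.exp (Real.pi * K) * Real.exp (Real.pi * |p.im|) := by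
    rw [norm_div, Complex.norm_real, Real.norm_of_nonneg Real.pi_pos.le]
    refine (div_le_self (norm_nonneg _) (by linarith [Real.pi_gt_three])).trans ?_
    refine (norm_sin_le _).trans ?_
    rw [← Real.exp_add, Real.exp_le_exp, Complex.im_ofReal_mul, abs_mul,
      abs_of_pos Real.pi_pos]
    nlinarith [abs_im_le_of_norm_add_le hK, Real.pi_pos]
  have h4 : ‖(Complex.Gamma (p + q - 1))⁻¹‖ ≤ M := by
    refine hM _ ((norm_sub_le _ _).trans ?_)
    rw [norm_one]
    linarith
  rw [e, norm_mul, norm_mul]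
  calc _ ≤ 1 * (Real.exp (Real.pi * K) * Real.exp (Real.pi * |p.im|)) * M := by gcongr
    _ = _ := by ring

/-- Moving the strip `m < Re q ≤ m + 1` to the left with the functional equation costs a factor
`p / (q - 1)`, which is harmless except near the real axis, where compactness is used. -/
theorem exists_norm_inv_Gamma_mul_le_of_re_le (K : ℝ) (m : ℕ) : ∃ (C : ℝ) (N : ℕ), 0 ≤ C ∧
    ∀ p q : ℂ, ‖p + q‖ ≤ K → 2 ≤ (p + q).re → q.re ≤ m →
      ‖(Complex.Gamma p)⁻¹ * (Complex.Gamma q)⁻¹‖ ≤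
        C * (1 + ‖p‖) ^ N * Real.exp (Real.pi * |p.im|) := by
  induction m with
  | zero =>
    obtain ⟨M, hM0, hM⟩ := exists_norm_inv_Gamma_mul_le_of_re_nonpos K
    exact ⟨M, 0, hM0, fun p q h1 h2 h3 => by simpa using hM p q h1 h2 (by simpa using h3)⟩
  | succ m ih =>
    obtain ⟨C, N, hC, h⟩ := ih
    obtain ⟨M, hM0, hM⟩ := exists_norm_inv_Gamma_le (K + (m + 2))
    refine ⟨C * 2 ^ N + M * M, N + 1, by positivity, fun p q h1 h2 h3 => ?_⟩
    have hx : (1 : ℝ) ≤ 1 + ‖p‖ := by linarith [norm_nonneg p]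
    have hE : 1 ≤ Real.exp (Real.pi * |p.im|) :=
      Real.one_le_exp (mul_nonneg Real.pi_pos.le (abs_nonneg _))
    have hK : 0 ≤ K := (norm_nonneg _).trans h1
    by_cases hm : q.re ≤ m
    · refine (h p q h1 h2 hm).trans ?_
      gcongr ?_ * ?_ * _
      · have : (1 : ℝ) ≤ 2 ^ N := one_le_pow₀ one_le_two
        nlinarith [mul_nonneg hM0 hM0]
      · exact pow_le_pow_right₀ hx (Nat.le_succ N)
    -- Away from the real axis `q - 1` is bounded below; near it `p` and `q` stay in a compact set.
    by_cases him : 1 ≤ |q.im|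
    · have e1 := Complex.one_div_Gamma_eq_self_mul_one_div_Gamma_add_one p
      have e2 := Complex.one_div_Gamma_eq_self_mul_one_div_Gamma_add_one (q - 1)
      rw [sub_add_cancel] at e2
      have hq1 : 1 ≤ ‖q - 1‖ := by
        refine him.trans ?_
        simpa using Complex.abs_im_le_norm (q - 1)
      have hq0 : q - 1 ≠ 0 := norm_pos_iff.1 (by linarith)
      have hb := h (p + 1) (q - 1) (by rwa [show p + 1 + (q - 1) = p + q by ring])
        (by rwa [show p + 1 + (q - 1) = p + q by ring])
        (by rw [Complex.sub_re, Complex.one_re]; push_cast at h3; linarith)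
      have e3 : (Complex.Gamma p)⁻¹ * (Complex.Gamma q)⁻¹ =
          p * (q - 1)⁻¹ * ((Complex.Gamma (p + 1))⁻¹ * (Complex.Gamma (q - 1))⁻¹) := by
        rw [e1, e2]
        field_simp
      rw [e3, norm_mul, norm_mul, norm_inv]
      have h5 : ‖p‖ * ‖q - 1‖⁻¹ ≤ 1 + ‖p‖ := by
        have := inv_le_one_of_one_le₀ hq1
        nlinarith [norm_nonneg p]
      have h6 : (1 + ‖p + 1‖) ^ N ≤ (2 * (1 + ‖p‖)) ^ N := by
        gcongr
        have := norm_add_le p 1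
        rw [norm_one] at this
        linarith [norm_nonneg p]
      have h7 : (p + 1).im = p.im := by simp
      rw [h7] at hb
      calc _ ≤ (1 + ‖p‖) * (C * (2 * (1 + ‖p‖)) ^ N * Real.exp (Real.pi * |p.im|)) := by
            refine mul_le_mul h5 (hb.trans ?_) (norm_nonneg _) (by linarith)
            gcongr
        _ = C * 2 ^ N * (1 + ‖p‖) ^ (N + 1) * Real.exp (Real.pi * |p.im|) := by
            rw [mul_pow]; ring
        _ ≤ _ := by
            gcongr
            nlinarith [mul_nonneg hM0 hM0]
    · push Not at hm him
      have hq : ‖q‖ ≤ m + 2 := by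
        refine (Complex.norm_le_abs_re_add_abs_im q).trans ?_
        have : |q.re| ≤ m + 1 := by
          push_cast at h3
          rw [abs_le]
          constructor <;> linarith [(Nat.cast_nonneg m : (0 : ℝ) ≤ m)]
        linarith
      have hp : ‖p‖ ≤ K + (m + 2) := by
        have := norm_sub_le (p + q) q
        rw [add_sub_cancel_right] at this
        linarith
      rw [norm_mul]
      calc _ ≤ M * M := by
            gcongr
            · exact hM p hp
            · exact hM q (by linarith)
        _ ≤ (C * 2 ^ N + M * M) * 1 * 1 := by
            have : 0 ≤ C * 2 ^ N := by positivity
            linarith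
        _ ≤ _ := by
            gcongr
            exact one_le_pow₀ hx

/-- If `Re q` is large, then `Re p` is negative, and the two factors change their roles. -/
theorem exists_norm_inv_Gamma_mul_le_of_two_le (K : ℝ) : ∃ (C : ℝ) (N : ℕ), 0 ≤ C ∧
    ∀ p q : ℂ, ‖p + q‖ ≤ K → 2 ≤ (p + q).re →
      ‖(Complex.Gamma p)⁻¹ * (Complex.Gamma q)⁻¹‖ ≤
        C * (1 + ‖p‖) ^ N * Real.exp (Real.pi * |p.im|) := by
  obtain ⟨m, hm⟩ := exists_nat_ge K
  obtain ⟨C, N, hC, h⟩ := exists_norm_inv_Gamma_mul_le_of_re_le K m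
  obtain ⟨M, hM0, hM⟩ := exists_norm_inv_Gamma_mul_le_of_re_nonpos K
  refine ⟨C + M * Real.exp (Real.pi * K), N, by positivity, fun p q h1 h2 => ?_⟩
  have hx : (1 : ℝ) ≤ 1 + ‖p‖ := by linarith [norm_nonneg p]
  by_cases hq : q.re ≤ m
  · refine (h p q h1 h2 hq).trans ?_
    gcongr
    have : 0 ≤ M * Real.exp (Real.pi * K) := by positivity
    linarith
  · push Not at hq
    have hre : (p + q).re ≤ K := (Complex.re_le_norm _).trans h1
    rw [Complex.add_re] at hre
    have hb := hM q p (by rwa [add_comm]) (by rwa [add_comm]) (by linarith)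
    rw [mul_comm] at hb
    calc _ ≤ M * Real.exp (Real.pi * |q.im|) := hb
      _ ≤ M * (Real.exp (Real.pi * K) * Real.exp (Real.pi * |p.im|)) := by
          rw [← Real.exp_add]
          gcongr
          nlinarith [abs_im_le_of_norm_add_le h1, Real.pi_pos]
      _ = (M * Real.exp (Real.pi * K)) * 1 * Real.exp (Real.pi * |p.im|) := by ring
      _ ≤ _ := by
          gcongr
          · linarith
          · exact one_le_pow₀ hx

/-- The basic estimate for the Barnes integral: `1 / (Γ(p) Γ(q))` has exponential type `π` in the
imaginary direction, and only polynomial growth in the real direction, if `p + q` stays bounded. -/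
theorem pairBound_inv_Gamma :
    PairBound (fun z => (Complex.Gamma z)⁻¹) (fun z => (Complex.Gamma z)⁻¹) := by
  -- The real part of `p + q` is raised with the functional equation `1/Γ(p) = p/Γ(p + 1)`.
  have key : ∀ (k : ℕ) (K : ℝ), ∃ (C : ℝ) (N : ℕ), 0 ≤ C ∧
      ∀ p q : ℂ, ‖p + q‖ ≤ K → 2 ≤ (p + q).re + k →
        ‖(Complex.Gamma p)⁻¹ * (Complex.Gamma q)⁻¹‖ ≤
          C * (1 + ‖p‖) ^ N * Real.exp (Real.pi * |p.im|) := by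
    intro k
    induction k with
    | zero => simpa using exists_norm_inv_Gamma_mul_le_of_two_le
    | succ k ih =>
      intro K
      obtain ⟨C, N, hC, h⟩ := ih (K + 1)
      refine ⟨C * 2 ^ N, N + 1, by positivity, fun p q h1 h2 => ?_⟩
      have hb := h (p + 1) q (by
        rw [show p + 1 + q = p + q + 1 by ring]
        refine (norm_add_le _ _).trans ?_
        rw [norm_one]
        linarith) (by
        rw [show p + 1 + q = p + q + 1 by ring, Complex.add_re _ 1, Complex.one_re]
        push_cast at h2
        linarith)
      rw [Complex.one_div_Gamma_eq_self_mul_one_div_Gamma_add_one p, mul_assoc, norm_mul]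
      have h6 : (1 + ‖p + 1‖) ^ N ≤ (2 * (1 + ‖p‖)) ^ N := by
        gcongr
        have := norm_add_le p 1
        rw [norm_one] at this
        linarith [norm_nonneg p]
      have h7 : (p + 1).im = p.im := by simp
      rw [h7] at hb
      calc _ ≤ (1 + ‖p‖) * (C * (2 * (1 + ‖p‖)) ^ N * Real.exp (Real.pi * |p.im|)) := by
            refine mul_le_mul (by linarith) (hb.trans ?_) (norm_nonneg _) (by positivity)
            gcongr
        _ = _ := by
            rw [mul_pow]; ring
  intro K
  obtain ⟨k, hk⟩ := exists_nat_ge (2 + K)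
  obtain ⟨C, N, hC, h⟩ := key k K
  refine ⟨C, N, hC, fun p q h1 => h p q h1 ?_⟩
  have := (abs_le.1 ((Complex.abs_re_le_norm _).trans h1)).1
  linarith

theorem PairBound.symm {g h : ℂ → ℂ} (hb : PairBound g h) : PairBound h g := by
  intro K
  obtain ⟨C, N, hC, hb⟩ := hb K
  refine ⟨C * (1 + |K|) ^ N * Real.exp (Real.pi * K), N, by positivity, fun p q hK => ?_⟩
  have h1 := hb q p (by rwa [add_comm])
  have hK0 : 0 ≤ K := (norm_nonneg _).trans hK
  have h2 : 1 + ‖q‖ ≤ (1 + |K|) * (1 + ‖p‖) := by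
    have := norm_sub_le (p + q) p
    rw [add_sub_cancel_left] at this
    rw [abs_of_nonneg hK0]
    nlinarith [norm_nonneg p]
  rw [mul_comm]
  calc _ ≤ _ := h1
    _ ≤ C * ((1 + |K|) * (1 + ‖p‖)) ^ N *
        (Real.exp (Real.pi * K) * Real.exp (Real.pi * |p.im|)) := by
        rw [← Real.exp_add]
        gcongr
        nlinarith [abs_im_le_of_norm_add_le hK, Real.pi_pos]
    _ = _ := by rw [mul_pow]; ring

/-- By Cauchy's estimates, derivatives satisfy the same kind of bound. -/
theorem PairBound.iteratedDeriv_left {g h : ℂ → ℂ} (hb : PairBound g h) (hg : Differentiable ℂ g)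
    (r : ℕ) : PairBound (iteratedDeriv r g) h := by
  intro K
  obtain ⟨C, N, hC, hb⟩ := hb (K + 1)
  refine ⟨r.factorial * (C * 2 ^ N * Real.exp Real.pi), N, by positivity, fun p q hK => ?_⟩
  have hd : Differentiable ℂ fun z => g z * h q := hg.mul_const _
  have hs : ∀ z ∈ Metric.sphere p 1, ‖g z * h q‖ ≤
      C * (2 * (1 + ‖p‖)) ^ N * (Real.exp Real.pi * Real.exp (Real.pi * |p.im|)) := by
    intro z hz
    rw [mem_sphere_iff_norm] at hz
    have hz1 : ‖z‖ ≤ ‖p‖ + 1 := by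
      have := norm_add_le p (z - p)
      rw [add_sub_cancel] at this
      linarith
    have hz2 : |z.im| ≤ 1 + |p.im| := by
      have h1 := (Complex.abs_im_le_norm (z - p)).trans hz.le
      rw [Complex.sub_im] at h1
      have := abs_add_le (z.im - p.im) p.im
      rw [sub_add_cancel] at this
      linarith
    refine (hb z q ?_).trans ?_
    · have := norm_add_le (p + q) (z - p)
      rw [show p + q + (z - p) = z + q by ring] at this
      linarith
    · rw [← Real.exp_add]
      gcongr
      · linarith [norm_nonneg p]
      · nlinarith [Real.pi_pos]
  have h1 := Complex.norm_iteratedDeriv_le_of_forall_mem_sphere_norm_le r one_pos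
    hd.diffContOnCl hs
  have h2 : iteratedDeriv r (fun z => g z * h q) p = iteratedDeriv r g p * h q := by
    have := iteratedDeriv_const_mul_field (n := r) (x := p) (h q) g
    simpa only [mul_comm (h q)] using this
  rw [h2, one_pow, div_one] at h1
  refine h1.trans (le_of_eq ?_)
  rw [mul_pow]
  ring

/-- The Taylor series of the entire function `1/Γ` at `c`. -/
def rGammaTaylor (c : ℂ) : PowerSeries ℂ :=
  PowerSeries.mk fun m =>
    iteratedDeriv m (fun u : ℂ => (Complex.Gamma u)⁻¹) c / (m.factorial : ℂ)

theorem rGamma_eq_rGammaTaylor (N : ℤ) : rGamma N = rGammaTaylor (1 + N) := by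
  ext m
  rw [rGamma, rGammaTaylor, PowerSeries.coeff_mk, PowerSeries.coeff_mk]
  congr 1
  have := congrFun (iteratedDeriv_comp_const_add m (fun u : ℂ => (Complex.Gamma u)⁻¹) (1 + N)) 0
  simpa using this

theorem pairBound_iteratedDeriv_inv_Gamma (r r' : ℕ) :
    PairBound (iteratedDeriv r fun z => (Complex.Gamma z)⁻¹)
      (iteratedDeriv r' fun z => (Complex.Gamma z)⁻¹) :=
  ((pairBound_inv_Gamma.iteratedDeriv_left Complex.differentiable_one_div_Gamma r).symm
    |>.iteratedDeriv_left Complex.differentiable_one_div_Gamma r').symm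

theorem hasDerivAt_iteratedDeriv_inv_Gamma (r : ℕ) (c : ℂ) :
    HasDerivAt (iteratedDeriv r fun z => (Complex.Gamma z)⁻¹)
      (iteratedDeriv (r + 1) (fun z => (Complex.Gamma z)⁻¹) c) c := by
  rw [iteratedDeriv_succ]
  have h : ContDiff ℂ (r + 1) fun z : ℂ => (Complex.Gamma z)⁻¹ :=
    Complex.differentiable_one_div_Gamma.contDiff
  exact ((h.differentiable_iteratedDeriv r (by exact_mod_cast Nat.lt_succ_self r)) c).hasDerivAt

theorem hasDerivAt_coeff_rGammaTaylor (r : ℕ) (c : ℂ) :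
    HasDerivAt (fun c => PowerSeries.coeff r (rGammaTaylor c))
      ((r + 1) * PowerSeries.coeff (r + 1) (rGammaTaylor c)) c := by
  simp only [rGammaTaylor, PowerSeries.coeff_mk]
  refine ((hasDerivAt_iteratedDeriv_inv_Gamma r c).div_const (r.factorial : ℂ)).congr_deriv ?_
  have : (r.factorial : ℂ) ≠ 0 := by exact_mod_cast r.factorial_ne_zero
  have h' : ((r : ℂ) + 1) ≠ 0 := by exact_mod_cast r.succ_ne_zero
  rw [Nat.factorial_succ]
  push_cast
  field_simp

theorem coeff_zero_rGammaTaylor_of_nonpos {N : ℤ} (hN : N ≤ 0) :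
    PowerSeries.coeff 0 (rGammaTaylor N) = 0 := by
  obtain ⟨m, rfl⟩ : ∃ m : ℕ, N = -(m : ℤ) := ⟨N.natAbs, by omega⟩
  simp [rGammaTaylor, Complex.Gamma_neg_nat_eq_zero]

end Gamma

/-! ### Residues at the integers as rectangle integrals -/

section Rect

open Complex in
/-- `1 / 2πi` times the integral over the boundary of `[m - 1/2, m + 1/2] × [-1, 1]`. For functions
that are holomorphic off the integers, it is the residue at `m`. -/
def rectInt (g : ℂ → ℂ) (m : ℤ) : ℂ :=
  (2 * Real.pi * I)⁻¹ * ((∫ x in (m - 1 / 2 : ℝ)..(m + 1 / 2 : ℝ), g (x + (-1 : ℝ) * I)) -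
    (∫ x in (m - 1 / 2 : ℝ)..(m + 1 / 2 : ℝ), g (x + (1 : ℝ) * I)) +
    I * (∫ y in (-1 : ℝ)..1, g ((m + 1 / 2 : ℝ) + y * I)) -
    I * ∫ y in (-1 : ℝ)..1, g ((m - 1 / 2 : ℝ) + y * I))

/-- The lines with real part in `ℤ + 1/2` and the half planes `|Im s| ≥ 1`. This set stays away from
the integers and contains the boundaries of the rectangles. -/
def contourRegion : Set ℂ := {s | (∃ m : ℤ, s.re = m + 1 / 2) ∨ 1 ≤ |s.im|}

/-- The complement of the integers. -/
def offIntegers : Set ℂ := {s | Complex.exp (2 * Real.pi * Complex.I * s) ≠ 1}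

theorem isOpen_offIntegers : IsOpen offIntegers :=
  isOpen_ne_fun (by fun_prop) continuous_const

theorem norm_exp_two_pi_I_mul (s : ℂ) :
    ‖Complex.exp (2 * Real.pi * Complex.I * s)‖ = Real.exp (-(2 * Real.pi * s.im)) := by
  rw [Complex.norm_exp]
  simp [Complex.mul_re, Complex.mul_im]

/-- On the contours, `e^{2πis} - 1` is comparable with `1 + |e^{2πis}|`. -/
theorem le_norm_exp_sub_one {s : ℂ} (hs : s ∈ contourRegion) :
    (1 + ‖Complex.exp (2 * Real.pi * Complex.I * s)‖) / 2 ≤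
      ‖Complex.exp (2 * Real.pi * Complex.I * s) - 1‖ := by
  rcases hs with ⟨m, hm⟩ | him
  · have e : Complex.exp (2 * Real.pi * Complex.I * s) =
        -(Real.exp (-(2 * Real.pi * s.im)) : ℝ) := by
      have : (2 * Real.pi * Complex.I * s : ℂ) =
          (-(2 * Real.pi * s.im) : ℝ) + m * (2 * Real.pi * Complex.I) + Real.pi * Complex.I := by
        apply Complex.ext <;> simp [hm]
        ring
      rw [this, Complex.exp_add, Complex.exp_add, Complex.exp_int_mul_two_pi_mul_I,
        Complex.exp_pi_mul_I, Complex.ofReal_exp]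
      ring
    have hpos := Real.exp_pos (-(2 * Real.pi * s.im))
    rw [e, norm_neg, Complex.norm_real, Real.norm_of_nonneg hpos.le, ← neg_add', norm_neg,
      ← Complex.ofReal_one, ← Complex.ofReal_add, Complex.norm_real, Real.norm_of_nonneg]
    all_goals linarith
  · have h1 := norm_exp_two_pi_I_mul s
    set v := Complex.exp (2 * Real.pi * Complex.I * s)
    have h3 := Real.pi_gt_three
    rcases le_abs.1 him with h | h
    · have h2 : ‖v‖ ≤ 1 / 3 := by
        rw [h1, Real.exp_neg, one_div]
        apply inv_anti₀ (by norm_num)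
        have := Real.add_one_le_exp (2 * Real.pi * s.im)
        nlinarith
      have := norm_sub_norm_le 1 v
      rw [norm_one, norm_sub_rev] at this
      linarith
    · have h2 : 3 ≤ ‖v‖ := by
        rw [h1]
        have := Real.add_one_le_exp (-(2 * Real.pi * s.im))
        nlinarith
      have := norm_sub_norm_le v 1
      rw [norm_one] at this
      linarith

theorem contourRegion_subset : contourRegion ⊆ offIntegers := by
  intro s hs h
  have := le_norm_exp_sub_one hs
  rw [h] at this
  norm_num at this

theorem vertical_mem (m : ℤ) (y : ℝ) : ((m + 1 / 2 : ℝ) + y * Complex.I : ℂ) ∈ contourRegion :=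
  Or.inl ⟨m, by simp⟩

theorem vertical_mem' (m : ℤ) (y : ℝ) : ((m - 1 / 2 : ℝ) + y * Complex.I : ℂ) ∈ contourRegion :=
  Or.inl ⟨m - 1, by simp; ring⟩

theorem horizontal_mem (x : ℝ) {y : ℝ} (hy : 1 ≤ |y|) :
    ((x : ℂ) + y * Complex.I : ℂ) ∈ contourRegion :=
  Or.inr (by simpa using hy)

theorem continuous_vertical {g : ℂ → ℂ} (hg : ContinuousOn g contourRegion) (m : ℤ) :
    Continuous fun y : ℝ => g ((m + 1 / 2 : ℝ) + y * Complex.I) :=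
  hg.comp_continuous (by fun_prop) (vertical_mem m)

theorem continuous_vertical' {g : ℂ → ℂ} (hg : ContinuousOn g contourRegion) (m : ℤ) :
    Continuous fun y : ℝ => g ((m - 1 / 2 : ℝ) + y * Complex.I) :=
  hg.comp_continuous (by fun_prop) (vertical_mem' m)

theorem continuous_horizontal {g : ℂ → ℂ} (hg : ContinuousOn g contourRegion) {y : ℝ}
    (hy : 1 ≤ |y|) : Continuous fun x : ℝ => g (x + y * Complex.I) :=
  hg.comp_continuous (by fun_prop) fun x => horizontal_mem x hy

theorem rectInt_add {g h : ℂ → ℂ} (hg : ContinuousOn g contourRegion)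
    (hh : ContinuousOn h contourRegion) (m : ℤ) :
    rectInt (fun s => g s + h s) m = rectInt g m + rectInt h m := by
  have i1 := fun (k : ℂ → ℂ) (hk : ContinuousOn k contourRegion) (a b : ℝ) =>
    (continuous_horizontal hk (y := -1) (by simp)).intervalIntegrable a b
      (μ := MeasureTheory.volume)
  have i2 := fun (k : ℂ → ℂ) (hk : ContinuousOn k contourRegion) (a b : ℝ) =>
    (continuous_horizontal hk (y := 1) (by simp)).intervalIntegrable a b
      (μ := MeasureTheory.volume)
  have i3 := fun (k : ℂ → ℂ) (hk : ContinuousOn k contourRegion) (a b : ℝ) =>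
    (continuous_vertical hk m).intervalIntegrable a b (μ := MeasureTheory.volume)
  have i4 := fun (k : ℂ → ℂ) (hk : ContinuousOn k contourRegion) (a b : ℝ) =>
    (continuous_vertical' hk m).intervalIntegrable a b (μ := MeasureTheory.volume)
  simp only [rectInt]
  rw [intervalIntegral.integral_add (i1 g hg _ _) (i1 h hh _ _),
    intervalIntegral.integral_add (i2 g hg _ _) (i2 h hh _ _),
    intervalIntegral.integral_add (i3 g hg _ _) (i3 h hh _ _),
    intervalIntegral.integral_add (i4 g hg _ _) (i4 h hh _ _)]
  ring

theorem rectInt_const_mul (c : ℂ) (g : ℂ → ℂ) (m : ℤ) :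
    rectInt (fun s => c * g s) m = c * rectInt g m := by
  simp only [rectInt, intervalIntegral.integral_const_mul]
  ring

theorem rectInt_sum {ι : Type*} (D : Finset ι) (g : ι → ℂ → ℂ)
    (hg : ∀ i ∈ D, ContinuousOn (g i) contourRegion) (m : ℤ) :
    rectInt (fun s => ∑ i ∈ D, g i s) m = ∑ i ∈ D, rectInt (g i) m := by
  classical
  induction D using Finset.induction_on with
  | empty => simp [rectInt]
  | insert i D hi ih =>
    simp only [Finset.sum_insert hi]
    rw [rectInt_add (hg i (Finset.mem_insert_self i D)), ih]
    · exact fun j hj => hg j (Finset.mem_insert_of_mem hj)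
    · exact continuousOn_finsetSum D fun j hj => hg j (Finset.mem_insert_of_mem hj)

theorem rectInt_congr {g h : ℂ → ℂ} (H : ∀ s ∈ contourRegion, g s = h s) (m : ℤ) :
    rectInt g m = rectInt h m := by
  simp only [rectInt]
  rw [funext fun x : ℝ => H _ (horizontal_mem x (y := -1) (by simp)),
    funext fun x : ℝ => H _ (horizontal_mem x (y := 1) (by simp)),
    funext fun y : ℝ => H _ (vertical_mem m y), funext fun y : ℝ => H _ (vertical_mem' m y)]

theorem rectInt_deriv_eq_zero {G g : ℂ → ℂ} (hG : ∀ s ∈ contourRegion, HasDerivAt G (g s) s)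
    (hg : ContinuousOn g contourRegion) (m : ℤ) : rectInt g m = 0 := by
  have hh : ∀ (y a b : ℝ), 1 ≤ |y| → ∫ x in a..b, g (x + y * Complex.I) =
      G (b + y * Complex.I) - G (a + y * Complex.I) := by
    intro y a b hy
    refine intervalIntegral.integral_eq_sub_of_hasDerivAt
      (f := fun x : ℝ => G (x + y * Complex.I)) (fun x _ => ?_)
      ((continuous_horizontal hg hy).intervalIntegrable a b)
    have h1 : HasDerivAt (fun x : ℝ => (x : ℂ) + y * Complex.I) 1 x :=
      (Complex.ofRealCLM.hasDerivAt).add_const _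
    simpa [Function.comp_def] using
      HasDerivAt.scomp (𝕜 := ℝ) (𝕜' := ℂ) x (hG _ (horizontal_mem x hy)) h1
  have hv : ∀ (c a b : ℝ), (∀ y : ℝ, (c + y * Complex.I : ℂ) ∈ contourRegion) →
      Complex.I * ∫ y in a..b, g (c + y * Complex.I) =
        G (c + b * Complex.I) - G (c + a * Complex.I) := by
    intro c a b hc
    rw [← intervalIntegral.integral_const_mul]
    refine intervalIntegral.integral_eq_sub_of_hasDerivAt
      (f := fun y : ℝ => G (c + y * Complex.I)) (fun y _ => ?_)
      ((continuous_const.mul (hg.comp_continuous (by fun_prop) hc)).intervalIntegrable a b)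
    have h1 : HasDerivAt (fun y : ℝ => (c : ℂ) + y * Complex.I) Complex.I y := by
      simpa using ((Complex.ofRealCLM.hasDerivAt (x := y)).mul_const Complex.I).const_add (c : ℂ)
    simpa [Function.comp_def] using
      HasDerivAt.scomp (𝕜 := ℝ) (𝕜' := ℂ) y (hG _ (hc y)) h1
  rw [rectInt, hh _ _ _ (by simp), hh _ _ _ (by simp), hv _ _ _ (vertical_mem m),
    hv _ _ _ (vertical_mem' m)]
  ring

/-- Integration by parts. -/
theorem rectInt_mul_deriv {h h' g g' : ℂ → ℂ} (hh : ∀ s, HasDerivAt h (h' s) s)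
    (hh' : Continuous h') (hg : ∀ s ∈ contourRegion, HasDerivAt g (g' s) s)
    (hg' : ContinuousOn g' contourRegion) (m : ℤ) :
    rectInt (fun s => h s * g' s) m = -rectInt (fun s => h' s * g s) m := by
  have c1 : ContinuousOn g contourRegion := fun s hs => (hg s hs).continuousAt.continuousWithinAt
  have c2 : Continuous h := continuous_iff_continuousAt.2 fun s => (hh s).continuousAt
  have := rectInt_deriv_eq_zero (G := fun s => h s * g s) (fun s hs => (hh s).mul (hg s hs))
    ((hh'.continuousOn.mul c1).add (c2.continuousOn.mul hg')) m
  rw [rectInt_add (g := fun s => h' s * g s) (h := fun s => h s * g' s)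
    (hh'.continuousOn.mul c1) (c2.continuousOn.mul hg')] at this
  exact eq_neg_of_add_eq_zero_right this

/-- The integral over a rectangle of a function that is holomorphic inside except possibly at the
point `m`, where it is only assumed to be continuous. -/
theorem rectInt_eq_zero {g : ℂ → ℂ} (m : ℤ)
    (hc : ContinuousOn g ({(m : ℂ)} ∪ offIntegers))
    (hd : ∀ s ∈ offIntegers, DifferentiableAt ℂ g s) : rectInt g m = 0 := by
  set z : ℂ := (m - 1 / 2 : ℝ) + (-1 : ℝ) * Complex.I with hz
  set w : ℂ := (m + 1 / 2 : ℝ) + (1 : ℝ) * Complex.I with hw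
  have hsub : (Set.uIcc z.re w.re ×ℂ Set.uIcc z.im w.im) ⊆ {(m : ℂ)} ∪ offIntegers := by
    intro s hs
    by_cases h : Complex.exp (2 * Real.pi * Complex.I * s) = 1
    · left
      obtain ⟨k, hk⟩ := Complex.exp_eq_one_iff.1 h
      have hs' : s = k := by
        have h2 : (2 * Real.pi * Complex.I : ℂ) ≠ 0 := Complex.two_pi_I_ne_zero
        apply mul_left_cancel₀ h2
        rw [hk]
        ring
      have h1 := (Complex.mem_reProdIm.1 hs).1
      simp only [hs', hz, hw, Complex.intCast_re] at h1
      rw [Set.mem_uIcc] at h1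
      simp at h1
      have h3 : k = m := by
        rcases h1 with h1 | h1
        · have a : (m : ℝ) - 1 < k := by linarith [h1.1]
          have b : (k : ℝ) < m + 1 := by linarith [h1.2]
          have a' : m - 1 < k := by exact_mod_cast a
          have b' : k < m + 1 := by exact_mod_cast b
          omega
        · linarith [h1.1, h1.2]
      simp [hs', h3]
    · exact Or.inr h
  have key := Complex.integral_boundary_rect_eq_zero_of_differentiable_on_off_countable g z w
    {(m : ℂ)} (Set.countable_singleton _) (hc.mono hsub) (by
      rintro s ⟨hs, hm⟩
      refine hd s ((hsub ?_).resolve_left hm)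
      obtain ⟨h1, h2⟩ := Complex.mem_reProdIm.1 hs
      exact Complex.mem_reProdIm.2 ⟨Set.Ioo_subset_Icc_self h1, Set.Ioo_subset_Icc_self h2⟩)
  have e1 : z.re = (m - 1 / 2 : ℝ) := by simp [hz]
  have e2 : z.im = (-1 : ℝ) := by simp [hz]
  have e3 : w.re = (m + 1 / 2 : ℝ) := by simp [hw]
  have e4 : w.im = (1 : ℝ) := by simp [hw]
  rw [e1, e2, e3, e4] at key
  rw [rectInt]
  simp only [smul_eq_mul] at key
  rw [key, mul_zero]

/-- The function `2πi / (1 - e^{-2πis})`, with simple poles of residue `1` at the integers. -/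
def expKernel (s : ℂ) : ℂ :=
  2 * Real.pi * Complex.I * Complex.exp (2 * Real.pi * Complex.I * s) *
    (Complex.exp (2 * Real.pi * Complex.I * s) - 1)⁻¹

theorem hasDerivAt_exp_two_pi_I (s : ℂ) :
    HasDerivAt (fun s => Complex.exp (2 * Real.pi * Complex.I * s))
      (2 * Real.pi * Complex.I * Complex.exp (2 * Real.pi * Complex.I * s)) s := by
  have := ((hasDerivAt_id s).const_mul (2 * Real.pi * Complex.I : ℂ)).cexp
  simpa [mul_comm] using this

theorem differentiableAt_expKernel {s : ℂ} (hs : s ∈ offIntegers) :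
    DifferentiableAt ℂ expKernel s := by
  have h : Complex.exp (2 * Real.pi * Complex.I * s) - 1 ≠ 0 := sub_ne_zero.2 hs
  have := (hasDerivAt_exp_two_pi_I s).differentiableAt
  unfold expKernel
  exact ((this.const_mul _)).mul ((this.sub_const 1).inv h)

theorem exp_add_intCast (m : ℤ) (s : ℂ) : Complex.exp (2 * Real.pi * Complex.I * (s + m)) =
    Complex.exp (2 * Real.pi * Complex.I * s) := by
  rw [show (2 * Real.pi * Complex.I * (s + m) : ℂ) =
    2 * Real.pi * Complex.I * s + m * (2 * Real.pi * Complex.I) by ring, Complex.exp_add,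
    Complex.exp_int_mul_two_pi_mul_I, mul_one]

theorem expKernel_add_intCast (m : ℤ) (s : ℂ) : expKernel (s + m) = expKernel s := by
  rw [expKernel, exp_add_intCast, expKernel]

/-- The vertical sides cancel by periodicity. On the horizontal sides the kernel differs from `2πi`
or from `0` by the derivative of a periodic logarithm. -/
theorem rectInt_expKernel (m : ℤ) : rectInt expKernel m = 1 := by
  have hc : ContinuousOn expKernel contourRegion := fun s hs =>
    (differentiableAt_expKernel (contourRegion_subset hs)).continuousAt.continuousWithinAt
  have hv : (fun y : ℝ => expKernel ((m + 1 / 2 : ℝ) + y * Complex.I)) =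
      fun y : ℝ => expKernel ((m - 1 / 2 : ℝ) + y * Complex.I) := by
    funext y
    rw [← expKernel_add_intCast 1 (((m - 1 / 2 : ℝ) : ℂ) + _)]
    congr 1
    push_cast
    ring
  have hexp : ∀ y : ℝ, Complex.exp (2 * Real.pi * Complex.I * ((m + 1 / 2 : ℝ) + y * Complex.I)) =
      Complex.exp (2 * Real.pi * Complex.I * ((m - 1 / 2 : ℝ) + y * Complex.I)) := by
    intro y
    rw [← exp_add_intCast 1 (((m - 1 / 2 : ℝ) : ℂ) + _)]
    congr 2
    push_cast
    ring
  have hlin : ∀ (y x : ℝ), HasDerivAt (fun x : ℝ => (x : ℂ) + y * Complex.I) 1 x := fun y x =>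
    (Complex.ofRealCLM.hasDerivAt).add_const _
  have hslit : ∀ u : ℂ, ‖u‖ < 1 → 1 - u ∈ Complex.slitPlane := by
    intro u hu
    left
    rw [Complex.sub_re, Complex.one_re]
    linarith [Complex.re_le_norm u]
  have htop : ∫ x in (m - 1 / 2 : ℝ)..(m + 1 / 2 : ℝ), expKernel (x + (1 : ℝ) * Complex.I) = 0 := by
    have := intervalIntegral.integral_eq_sub_of_hasDerivAt (a := (m - 1 / 2 : ℝ))
      (b := (m + 1 / 2 : ℝ))
      (f := fun x : ℝ => Complex.log (1 - Complex.exp (2 * Real.pi * Complex.I *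
        (x + (1 : ℝ) * Complex.I)))) (f' := fun x : ℝ => expKernel (x + (1 : ℝ) * Complex.I))
      (fun x _ => ?_) ((continuous_horizontal hc (y := 1) (by simp)).intervalIntegrable _ _)
    · rw [this, hexp, sub_self]
    · set s : ℂ := x + (1 : ℝ) * Complex.I with hs
      have hlt : ‖Complex.exp (2 * Real.pi * Complex.I * s)‖ < 1 := by
        rw [norm_exp_two_pi_I_mul, Real.exp_lt_one_iff]
        simp [hs, Real.pi_pos]
      have h1 := ((hasDerivAt_exp_two_pi_I s).const_sub 1).clog (hslit _ hlt)
      have h2 := HasDerivAt.scomp (𝕜 := ℝ) (𝕜' := ℂ) x h1 (hlin 1 x)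
      refine h2.congr_deriv ?_
      have hne : Complex.exp (2 * Real.pi * Complex.I * s) - 1 ≠ 0 :=
        sub_ne_zero.2 (contourRegion_subset (horizontal_mem x (y := 1) (by simp)))
      have hne' : 1 - Complex.exp (2 * Real.pi * Complex.I * s) ≠ 0 := by
        rw [← neg_sub]; exact neg_ne_zero.2 hne
      rw [expKernel, one_smul]
      field_simp
      ring
  have hbot : ∫ x in (m - 1 / 2 : ℝ)..(m + 1 / 2 : ℝ), expKernel (x + (-1 : ℝ) * Complex.I) =
      2 * Real.pi * Complex.I := by
    have := intervalIntegral.integral_eq_sub_of_hasDerivAt (a := (m - 1 / 2 : ℝ))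
      (b := (m + 1 / 2 : ℝ))
      (f := fun x : ℝ => 2 * Real.pi * Complex.I * x +
        Complex.log (1 - (Complex.exp (2 * Real.pi * Complex.I *
          (x + (-1 : ℝ) * Complex.I)))⁻¹))
      (f' := fun x : ℝ => expKernel (x + (-1 : ℝ) * Complex.I))
      (fun x _ => ?_) ((continuous_horizontal hc (y := -1) (by simp)).intervalIntegrable _ _)
    · rw [this, hexp]
      push_cast
      ring
    · set s : ℂ := x + (-1 : ℝ) * Complex.I with hs
      have hne0 := Complex.exp_ne_zero (2 * Real.pi * Complex.I * s)
      have hlt : ‖(Complex.exp (2 * Real.pi * Complex.I * s))⁻¹‖ < 1 := by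
        rw [norm_inv]
        apply inv_lt_one_of_one_lt₀
        rw [norm_exp_two_pi_I_mul, Real.one_lt_exp_iff]
        simp [hs, Real.pi_pos]
      have h1 := (((hasDerivAt_exp_two_pi_I s).inv hne0).const_sub 1).clog (hslit _ hlt)
      have h2 := HasDerivAt.scomp (𝕜 := ℝ) (𝕜' := ℂ) x h1 (hlin (-1) x)
      have h3 : HasDerivAt (fun x : ℝ => 2 * Real.pi * Complex.I * (x : ℂ))
          (2 * Real.pi * Complex.I) x := by
        simpa using (Complex.ofRealCLM.hasDerivAt (x := x)).const_mul (2 * Real.pi * Complex.I)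
      refine (h3.add h2).congr_deriv ?_
      have hne : Complex.exp (2 * Real.pi * Complex.I * s) - 1 ≠ 0 :=
        sub_ne_zero.2 (contourRegion_subset (horizontal_mem x (y := -1) (by simp)))
      rw [expKernel, one_smul]
      have hne' : 1 - (Complex.exp (2 * Real.pi * Complex.I * s))⁻¹ ≠ 0 := by
        intro h0
        apply hne
        have := congrArg (fun z => z * Complex.exp (2 * Real.pi * Complex.I * s)) h0
        simpa [sub_mul, hne0] using this
      rw [Pi.inv_apply]
      field_simp
      ring
  rw [rectInt, hv, htop, hbot, sub_zero, add_sub_cancel_right]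
  exact inv_mul_cancel₀ Complex.two_pi_I_ne_zero

/-- The residue theorem for an entire multiple of the kernel. -/
theorem rectInt_mul_expKernel {h : ℂ → ℂ} (hh : Differentiable ℂ h) (m : ℤ) :
    rectInt (fun s => h s * expKernel s) m = h m := by
  have hk : ContinuousOn expKernel contourRegion := fun s hs =>
    (differentiableAt_expKernel (contourRegion_subset hs)).continuousAt.continuousWithinAt
  set E : ℂ → ℂ := fun s => Complex.exp (2 * Real.pi * Complex.I * s) - 1 with hE
  have hEd : ∀ s, HasDerivAt E (2 * Real.pi * Complex.I *
      Complex.exp (2 * Real.pi * Complex.I * s)) s := fun s =>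
    (hasDerivAt_exp_two_pi_I s).sub_const 1
  have hEm : Complex.exp (2 * Real.pi * Complex.I * m) = 1 := by
    have := exp_add_intCast m 0
    simpa using this
  -- `(h(s) - h(m))` times the kernel, written as a quotient of difference quotients
  set G : ℂ → ℂ := fun s => dslope h m s * (2 * Real.pi * Complex.I *
    Complex.exp (2 * Real.pi * Complex.I * s) * (dslope E m s)⁻¹) with hG
  have hGk : ∀ s ∈ offIntegers, G s = (h s - h m) * expKernel s := by
    intro s hs
    have hsm : s ≠ m := by
      rintro rfl
      exact hs hEm
    have h0 : s - m ≠ 0 := sub_ne_zero.2 hsm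
    have hne : Complex.exp (2 * Real.pi * Complex.I * s) - 1 ≠ 0 := sub_ne_zero.2 hs
    have hEs : E s - E m = Complex.exp (2 * Real.pi * Complex.I * s) - 1 := by
      simp [hE, hEm]
    simp only [hG, dslope_of_ne _ hsm, slope_def_field, hEs, expKernel]
    field_simp
  have hz : rectInt G m = 0 := by
    apply rectInt_eq_zero
    · have c1 : Continuous (dslope h m) :=
        continuous_iff_continuousAt.2 fun s => by
          rcases eq_or_ne s m with rfl | hs
          · exact continuousAt_dslope_same.2 (hh _)
          · exact (continuousAt_dslope_of_ne hs).2 (hh s).continuousAt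
      have c2 : Continuous (dslope E m) :=
        continuous_iff_continuousAt.2 fun s => by
          rcases eq_or_ne s m with rfl | hs
          · exact continuousAt_dslope_same.2 (hEd _).differentiableAt
          · exact (continuousAt_dslope_of_ne hs).2 (hEd s).continuousAt
      refine c1.continuousOn.mul (ContinuousOn.mul (by fun_prop) (c2.continuousOn.inv₀ ?_))
      rintro s (hs | hs)
      · rw [Set.mem_singleton_iff.1 hs, dslope_same, (hEd m).deriv, hEm, mul_one]
        exact Complex.two_pi_I_ne_zero
      · have hsm : s ≠ m := by
          rintro rfl
          exact hs hEm
        rw [dslope_of_ne _ hsm, slope_def_field, div_ne_zero_iff]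
        refine ⟨?_, sub_ne_zero.2 hsm⟩
        simp only [hE, hEm, sub_self, sub_zero]
        exact sub_ne_zero.2 hs
    · intro s hs
      have : G =ᶠ[𝓝 s] fun s => (h s - h m) * expKernel s :=
        Filter.eventually_of_mem (isOpen_offIntegers.mem_nhds hs) hGk
      rw [this.differentiableAt_iff]
      exact ((hh s).sub_const _).mul (differentiableAt_expKernel hs)
  have hsplit : rectInt (fun s => h s * expKernel s) m =
      rectInt (fun s => G s + h m * expKernel s) m :=
    rectInt_congr (fun s hs => by rw [hGk s (contourRegion_subset hs)]; ring) m
  rw [hsplit, rectInt_add (h := fun s => h m * expKernel s) _ (continuousOn_const.mul hk), hz,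
    rectInt_const_mul, rectInt_expKernel, zero_add, mul_one]
  exact (((hh.continuous.sub continuous_const).continuousOn.mul hk)).congr fun s hs =>
    hGk s (contourRegion_subset hs)

end Rect

/-! ### Vertical line integrals and their shifts -/

section Line

theorem exists_one_add_pow_mul_exp_le (N : ℕ) {δ : ℝ} (hδ : 0 < δ) : ∃ C : ℝ, 0 ≤ C ∧
    ∀ t : ℝ, (1 + |t|) ^ N * Real.exp (-(δ * |t|)) ≤ C * (1 + t ^ 2)⁻¹ := by
  refine ⟨(N + 2).factorial / δ ^ (N + 2) * Real.exp δ, by positivity, fun t => ?_⟩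
  have h0 := abs_nonneg t
  have h1 := Real.pow_div_factorial_le_exp (δ * (1 + |t|)) (by positivity) (N + 2)
  have h2 : (1 + |t|) ^ (N + 2) ≤
      (N + 2).factorial / δ ^ (N + 2) * (Real.exp δ * Real.exp (δ * |t|)) := by
    rw [← Real.exp_add]
    rw [mul_pow, div_le_iff₀ (by positivity)] at h1
    rw [div_mul_eq_mul_div, le_div_iff₀ (by positivity)]
    calc _ = δ ^ (N + 2) * (1 + |t|) ^ (N + 2) := by ring
      _ ≤ _ := h1
      _ = _ := by rw [mul_add, mul_one]; ring
  have h3 : 1 + t ^ 2 ≤ (1 + |t|) ^ 2 := by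
    rw [← sq_abs t]
    nlinarith
  have h4 : 0 < 1 + t ^ 2 := by positivity
  rw [← div_eq_mul_inv, le_div_iff₀ h4]
  calc (1 + |t|) ^ N * Real.exp (-(δ * |t|)) * (1 + t ^ 2)
      ≤ (1 + |t|) ^ N * Real.exp (-(δ * |t|)) * (1 + |t|) ^ 2 := by gcongr
    _ = (1 + |t|) ^ (N + 2) * Real.exp (-(δ * |t|)) := by ring
    _ ≤ (N + 2).factorial / δ ^ (N + 2) * (Real.exp δ * Real.exp (δ * |t|)) *
        Real.exp (-(δ * |t|)) := by gcongr
    _ = (N + 2).factorial / δ ^ (N + 2) * Real.exp δ *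
        (Real.exp (δ * |t|) * Real.exp (-(δ * |t|))) := by ring
    _ = _ := by rw [← Real.exp_add, add_neg_cancel, Real.exp_zero, mul_one]

theorem integrable_one_add_pow_mul_exp (N : ℕ) {δ : ℝ} (hδ : 0 < δ) :
    MeasureTheory.Integrable fun t : ℝ => (1 + |t|) ^ N * Real.exp (-(δ * |t|)) := by
  obtain ⟨C, hC, h⟩ := exists_one_add_pow_mul_exp_le N hδ
  refine (integrable_inv_one_add_sq.const_mul C).mono'
    (Continuous.aestronglyMeasurable (by fun_prop)) (Filter.Eventually.of_forall fun t => ?_)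
  rw [Real.norm_of_nonneg (by positivity)]
  exact h t

theorem summable_one_add_pow_mul_exp (N : ℕ) {δ : ℝ} (hδ : 0 < δ) :
    Summable fun m : ℤ => (1 + |(m : ℝ)|) ^ N * Real.exp (-(δ * |(m : ℝ)|)) := by
  obtain ⟨C, hC, h⟩ := exists_one_add_pow_mul_exp_le N hδ
  have hs : Summable fun m : ℤ => ((m : ℝ) ^ 2)⁻¹ := by
    simpa using (Real.summable_one_div_int_pow (p := 2)).2 one_lt_two
  have hs' : Summable fun m : ℤ => (1 + (m : ℝ) ^ 2)⁻¹ := by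
    refine Summable.of_norm_bounded_eventually hs ?_
    rw [Filter.eventually_cofinite]
    refine (Set.finite_singleton (0 : ℤ)).subset fun m hm => ?_
    by_contra h0
    apply hm
    have : (m : ℝ) ≠ 0 := by exact_mod_cast h0
    rw [Real.norm_of_nonneg (by positivity)]
    apply inv_anti₀ (by positivity)
    linarith
  exact Summable.of_nonneg_of_le (fun m => by positivity) (fun m => h m) (hs'.mul_left C)

/-- Differentiation under the integral sign for `w ↦ ∫ e^{w s(t)} g(t) dμ(t)`. -/
theorem differentiableAt_integral_exp_mul {μ : MeasureTheory.Measure ℝ} {s g : ℝ → ℂ}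
    (hs : Continuous s) (hg : MeasureTheory.AEStronglyMeasurable g μ) {w₀ : ℂ} {ε : ℝ}
    (hε : 0 < ε) {bound : ℝ → ℝ} (hbi : MeasureTheory.Integrable bound μ)
    (hb : ∀ᵐ t ∂μ, ∀ w ∈ Metric.ball w₀ ε, (1 + ‖s t‖) * ‖Complex.exp (w * s t) * g t‖ ≤ bound t) :
    DifferentiableAt ℂ (fun w => ∫ t, Complex.exp (w * s t) * g t ∂μ) w₀ := by
  have hm : ∀ w : ℂ, MeasureTheory.AEStronglyMeasurable (fun t => Complex.exp (w * s t) * g t) μ :=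
    fun w => (Continuous.aestronglyMeasurable (by fun_prop)).mul hg
  refine (hasDerivAt_integral_of_dominated_loc_of_deriv_le
    (F' := fun w t => s t * (Complex.exp (w * s t) * g t)) (Metric.ball_mem_nhds w₀ hε)
    (Filter.Eventually.of_forall hm) ?_ (hs.aestronglyMeasurable.mul (hm w₀)) ?_ hbi ?_
    ).2.differentiableAt
  · refine hbi.mono' (hm w₀) (hb.mono fun t ht => ?_)
    refine le_trans ?_ (ht w₀ (Metric.mem_ball_self hε))
    have := norm_nonneg (Complex.exp (w₀ * s t) * g t)
    nlinarith [norm_nonneg (s t)]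
  · refine hb.mono fun t ht w hw => ?_
    refine le_trans ?_ (ht w hw)
    rw [norm_mul]
    gcongr
    linarith
  · refine Filter.Eventually.of_forall fun t w _ => ?_
    have := (((hasDerivAt_id w).mul_const (s t)).cexp).mul_const (g t)
    refine this.congr_deriv ?_
    simp only [id, one_mul]
    ring

/-- Functions that are holomorphic off the integers and satisfy, on the contours, the bound that
makes `∫ e^{ws} ψ(s) ds` converge in the strip `|Im w - b| < π`. -/
structure IsBarnesKernel (b : ℝ) (ψ : ℂ → ℂ) : Prop where
  differentiableAt : ∀ s ∈ offIntegers, DifferentiableAt ℂ ψ s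
  bound : ∃ (C : ℝ) (N : ℕ), 0 ≤ C ∧ ∀ s ∈ contourRegion,
    ‖ψ s‖ ≤ C * (1 + ‖s‖) ^ N * Real.exp (b * s.im - Real.pi * |s.im|)

/-- The normalized integral of `e^{ws} ψ(s)` over the line `Re s = m - 1/2`. -/
def lineInt (ψ : ℂ → ℂ) (m : ℤ) (w : ℂ) : ℂ :=
  (2 * Real.pi : ℂ)⁻¹ * ∫ y : ℝ, Complex.exp (w * ((m - 1 / 2 : ℝ) + y * Complex.I)) *
    ψ ((m - 1 / 2 : ℝ) + y * Complex.I)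

variable {b : ℝ} {ψ : ℂ → ℂ}

theorem IsBarnesKernel.continuousOn (hψ : IsBarnesKernel b ψ) : ContinuousOn ψ contourRegion :=
  fun s hs => (hψ.differentiableAt s (contourRegion_subset hs)).continuousAt.continuousWithinAt

/-- The region of convergence of the line integrals. -/
def barnesStrip (b : ℝ) : Set ℂ := {w | |w.im - b| < Real.pi}

theorem isOpen_barnesStrip (b : ℝ) : IsOpen (barnesStrip b) :=
  isOpen_lt (by fun_prop) continuous_const

theorem one_add_norm_add_mul_I_le (c t : ℝ) :
    1 + ‖(c + t * Complex.I : ℂ)‖ ≤ (1 + |c|) * (1 + |t|) := by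
  have := norm_add_le (c : ℂ) (t * Complex.I)
  simp only [Complex.norm_mul, Complex.norm_I, mul_one, Complex.norm_real, Real.norm_eq_abs]
    at this
  nlinarith [abs_nonneg c, abs_nonneg t]

/-- The decay of the integrand in vertical direction. -/
theorem IsBarnesKernel.exists_norm_exp_mul_le (hψ : IsBarnesKernel b ψ) :
    ∃ (C : ℝ) (N : ℕ), 0 ≤ C ∧ ∀ (w : ℂ) (c t : ℝ),
      (c + t * Complex.I : ℂ) ∈ contourRegion →
      ‖Complex.exp (w * (c + t * Complex.I)) * ψ (c + t * Complex.I)‖ ≤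
        C * (1 + |c|) ^ N * Real.exp (c * w.re) *
          ((1 + |t|) ^ N * Real.exp (-((Real.pi - |w.im - b|) * |t|))) := by
  obtain ⟨C, N, hC, h⟩ := hψ.bound
  refine ⟨C, N, hC, fun w c t hm => ?_⟩
  have h1 := h _ hm
  have h2 := one_add_norm_add_mul_I_le c t
  rw [norm_mul, Complex.norm_exp]
  have e1 : (w * (c + t * Complex.I)).re = c * w.re - w.im * t := by
    simp [Complex.mul_re]
    ring
  have e2 : (c + t * Complex.I : ℂ).im = t := by simp
  rw [e2] at h1
  rw [e1]
  calc _ ≤ Real.exp (c * w.re - w.im * t) *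
        (C * ((1 + |c|) * (1 + |t|)) ^ N * Real.exp (b * t - Real.pi * |t|)) := by
        gcongr
        refine h1.trans ?_
        gcongr
    _ = C * (1 + |c|) ^ N * (1 + |t|) ^ N *
        (Real.exp (c * w.re - w.im * t) * Real.exp (b * t - Real.pi * |t|)) := by
        rw [mul_pow]; ring
    _ ≤ C * (1 + |c|) ^ N * (1 + |t|) ^ N *
        (Real.exp (c * w.re) * Real.exp (-((Real.pi - |w.im - b|) * |t|))) := by
        rw [← Real.exp_add, ← Real.exp_add]
        refine mul_le_mul_of_nonneg_left (Real.exp_le_exp.2 ?_) (by positivity)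
        have h3 : -((w.im - b) * t) ≤ |w.im - b| * |t| := by
          rw [← abs_mul]
          exact neg_le_abs _
        linarith
    _ = _ := by ring

theorem continuous_exp_mul_vertical (hψ : IsBarnesKernel b ψ) (w : ℂ) (m : ℤ) :
    Continuous fun y : ℝ => Complex.exp (w * ((m - 1 / 2 : ℝ) + y * Complex.I)) *
      ψ ((m - 1 / 2 : ℝ) + y * Complex.I) :=
  Continuous.mul (by fun_prop) (continuous_vertical' hψ.continuousOn m)

theorem IsBarnesKernel.integrable (hψ : IsBarnesKernel b ψ) {w : ℂ} (hw : w ∈ barnesStrip b)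
    (m : ℤ) : MeasureTheory.Integrable fun y : ℝ =>
      Complex.exp (w * ((m - 1 / 2 : ℝ) + y * Complex.I)) *
        ψ ((m - 1 / 2 : ℝ) + y * Complex.I) := by
  obtain ⟨C, N, hC, h⟩ := hψ.exists_norm_exp_mul_le
  refine ((integrable_one_add_pow_mul_exp N (sub_pos.2 hw)).const_mul _).mono'
    (continuous_exp_mul_vertical hψ w m).aestronglyMeasurable
    (Filter.Eventually.of_forall fun y => h w _ y (vertical_mem' m y))

theorem IsBarnesKernel.differentiableOn_lineInt (hψ : IsBarnesKernel b ψ) (m : ℤ) :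
    DifferentiableOn ℂ (lineInt ψ m) (barnesStrip b) := by
  intro w₀ hw₀
  apply DifferentiableAt.differentiableWithinAt
  obtain ⟨C, N, hC, h⟩ := hψ.exists_norm_exp_mul_le
  set δ := Real.pi - |w₀.im - b| with hδ
  have hδ0 : 0 < δ := sub_pos.2 hw₀
  set c : ℝ := m - 1 / 2 with hc
  refine (differentiableAt_integral_exp_mul (μ := MeasureTheory.volume)
    (s := fun y : ℝ => (c : ℂ) + y * Complex.I) (g := fun y : ℝ => ψ (c + y * Complex.I))
    (by fun_prop) (continuous_vertical' hψ.continuousOn m).aestronglyMeasurable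
    (ε := δ / 2) (by positivity)
    (bound := fun t => C * (1 + |c|) ^ (N + 1) * Real.exp (|c| * (|w₀.re| + δ / 2)) *
      ((1 + |t|) ^ (N + 1) * Real.exp (-(δ / 2 * |t|))))
    ((integrable_one_add_pow_mul_exp (N + 1) (by positivity)).const_mul _)
    (Filter.Eventually.of_forall fun t w hw => ?_)).const_mul _
  have h1 := h w c t (vertical_mem' m t)
  rw [Metric.mem_ball, dist_eq_norm] at hw
  have h2 := one_add_norm_add_mul_I_le c t
  have h3 : c * w.re ≤ |c| * (|w₀.re| + δ / 2) := by
    have := (Complex.abs_re_le_norm (w - w₀)).trans hw.le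
    rw [Complex.sub_re] at this
    calc c * w.re ≤ |c * w.re| := le_abs_self _
      _ = |c| * |w.re| := abs_mul _ _
      _ ≤ _ := by
        gcongr
        have := abs_add_le (w.re - w₀.re) w₀.re
        rw [sub_add_cancel] at this
        linarith
  have h4 : |w.im - b| ≤ Real.pi - δ / 2 := by
    have := (Complex.abs_im_le_norm (w - w₀)).trans hw.le
    rw [Complex.sub_im] at this
    have h5 := abs_add_le (w.im - w₀.im) (w₀.im - b)
    rw [sub_add_sub_cancel] at h5
    linarith
  calc _ ≤ ((1 + |c|) * (1 + |t|)) * (C * (1 + |c|) ^ N * Real.exp (|c| * (|w₀.re| + δ / 2)) *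
        ((1 + |t|) ^ N * Real.exp (-(δ / 2 * |t|)))) := by
        refine mul_le_mul h2 (h1.trans ?_) (norm_nonneg _) (by positivity)
        gcongr
        linarith
    _ = _ := by ring

/-- The residue of `e^{ws} ψ(s)` at `m`, as a function of `w`. -/
def residueInt (ψ : ℂ → ℂ) (m : ℤ) (w : ℂ) : ℂ :=
  rectInt (fun s => Complex.exp (w * s) * ψ s) m

theorem differentiable_intervalIntegral_exp_mul {s g : ℝ → ℂ} (hs : Continuous s)
    (hg : Continuous g) (p q : ℝ) :
    Differentiable ℂ fun w => ∫ t in p..q, Complex.exp (w * s t) * g t := by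
  intro w₀
  have key : ∀ p q : ℝ, DifferentiableAt ℂ
      (fun w => ∫ t in Set.Ioc p q, Complex.exp (w * s t) * g t) w₀ := by
    intro p q
    have hcb : Continuous fun t =>
        (1 + ‖s t‖) * (Real.exp ((‖w₀‖ + 1) * ‖s t‖) * ‖g t‖) := by fun_prop
    refine differentiableAt_integral_exp_mul hs hg.aestronglyMeasurable one_pos
      (bound := fun t => (1 + ‖s t‖) * (Real.exp ((‖w₀‖ + 1) * ‖s t‖) * ‖g t‖))
      (hcb.integrableOn_Icc.mono_set Set.Ioc_subset_Icc_self)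
      (Filter.Eventually.of_forall fun t w hw => ?_)
    rw [Metric.mem_ball, dist_eq_norm] at hw
    rw [norm_mul, Complex.norm_exp]
    gcongr
    refine (Complex.re_le_norm _).trans ?_
    rw [norm_mul]
    gcongr
    have := norm_add_le (w - w₀) w₀
    rw [sub_add_cancel] at this
    linarith
  exact (key p q).sub (key q p)

theorem IsBarnesKernel.differentiable_residueInt (hψ : IsBarnesKernel b ψ) (m : ℤ) :
    Differentiable ℂ (residueInt ψ m) := by
  have h := hψ.continuousOn
  exact (((differentiable_intervalIntegral_exp_mul (by fun_prop)
    (continuous_horizontal h (y := -1) (by simp)) _ _).sub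
    (differentiable_intervalIntegral_exp_mul (by fun_prop)
      (continuous_horizontal h (y := 1) (by simp)) _ _)).add
    ((differentiable_intervalIntegral_exp_mul (by fun_prop)
      (continuous_vertical h m) _ _).const_mul _) |>.sub
    ((differentiable_intervalIntegral_exp_mul (by fun_prop)
      (continuous_vertical' h m) _ _).const_mul _)).const_mul _

/-- Entire functions `f_m`, indexed by the integers, that grow like the terms of a Laurent series in
`e^w` with coefficients of polynomial growth, uniformly for `w` in bounded sets. -/
structure IsLaurentLike (f : ℤ → ℂ → ℂ) : Prop where
  differentiable : ∀ m, Differentiable ℂ (f m)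
  bound : ∀ R : ℝ, ∃ (C : ℝ) (N : ℕ), 0 ≤ C ∧ ∀ w : ℂ, ‖w‖ ≤ R → ∀ m : ℤ,
    ‖f m w‖ ≤ C * (1 + |(m : ℝ)|) ^ N * Real.exp (m * w.re)

theorem IsBarnesKernel.isLaurentLike_residueInt (hψ : IsBarnesKernel b ψ) :
    IsLaurentLike (residueInt ψ) := by
  refine ⟨hψ.differentiable_residueInt, fun R => ?_⟩
  obtain ⟨C, N, hC, h⟩ := hψ.bound
  refine ⟨C * 3 ^ N * Real.exp |b| * Real.exp (2 * R), N, by positivity, fun w hw m => ?_⟩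
  set B := C * (3 * (1 + |(m : ℝ)|)) ^ N * Real.exp |b| * (Real.exp (2 * R) * Real.exp (m * w.re))
    with hB
  have hB0 : 0 ≤ B := by positivity
  have key : ∀ c t : ℝ, |c - m| ≤ 1 / 2 → |t| ≤ 1 → (c + t * Complex.I : ℂ) ∈ contourRegion →
      ‖Complex.exp (w * (c + t * Complex.I)) * ψ (c + t * Complex.I)‖ ≤ B := by
    intro c t hc ht hm
    rw [norm_mul, Complex.norm_exp]
    have h1 := h _ hm
    have e1 : (w * (c + t * Complex.I)).re = m * w.re + ((c - m) * w.re - w.im * t) := by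
      simp [Complex.mul_re]
      ring
    have e2 : (c + t * Complex.I : ℂ).im = t := by simp
    rw [e2] at h1
    rw [e1]
    have h2 : 1 + ‖(c + t * Complex.I : ℂ)‖ ≤ 3 * (1 + |(m : ℝ)|) := by
      have := norm_add_le (c : ℂ) (t * Complex.I)
      simp only [Complex.norm_mul, Complex.norm_I, mul_one, Complex.norm_real, Real.norm_eq_abs]
        at this
      have h5 := abs_add_le (c - m) m
      rw [sub_add_cancel] at h5
      linarith [abs_nonneg (m : ℝ)]
    have h3 : b * t - Real.pi * |t| ≤ |b| := by
      have : b * t ≤ |b| * |t| := by rw [← abs_mul]; exact le_abs_self _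
      nlinarith [Real.pi_pos, abs_nonneg t, abs_nonneg b]
    have h4 : (c - m) * w.re - w.im * t ≤ 2 * R := by
      have a1 : (c - m) * w.re ≤ |c - m| * |w.re| := by rw [← abs_mul]; exact le_abs_self _
      have a2 : -(w.im * t) ≤ |w.im| * |t| := by rw [← abs_mul]; exact neg_le_abs _
      have a3 := (Complex.abs_re_le_norm w).trans hw
      have a4 := (Complex.abs_im_le_norm w).trans hw
      nlinarith [abs_nonneg w.re, abs_nonneg w.im, abs_nonneg t, abs_nonneg (c - m)]
    calc _ ≤ Real.exp (m * w.re + 2 * R) * (C * (3 * (1 + |(m : ℝ)|)) ^ N * Real.exp |b|) := by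
          gcongr
          refine h1.trans ?_
          gcongr
      _ = _ := by rw [Real.exp_add, hB]; ring
  have hh : ∀ y : ℝ, |y| = 1 → ‖∫ x in (m - 1 / 2 : ℝ)..(m + 1 / 2 : ℝ),
      Complex.exp (w * (x + y * Complex.I)) * ψ (x + y * Complex.I)‖ ≤ B := by
    intro y hy
    refine (intervalIntegral.norm_integral_le_of_norm_le_const (C := B) fun x hx => ?_).trans ?_
    · rw [Set.uIoc_of_le (by linarith)] at hx
      refine key x y ?_ hy.le (horizontal_mem x hy.ge)
      rw [abs_le]
      constructor <;> linarith [hx.1, hx.2]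
    · rw [show (m + 1 / 2 : ℝ) - (m - 1 / 2) = 1 by ring, abs_one, mul_one]
  have hv : ∀ c : ℝ, |c - m| ≤ 1 / 2 → (∀ y : ℝ, (c + y * Complex.I : ℂ) ∈ contourRegion) →
      ‖Complex.I * ∫ y in (-1 : ℝ)..1,
        Complex.exp (w * (c + y * Complex.I)) * ψ (c + y * Complex.I)‖ ≤ 2 * B := by
    intro c hc hm
    rw [norm_mul, Complex.norm_I, one_mul]
    refine (intervalIntegral.norm_integral_le_of_norm_le_const (C := B) fun y hy => ?_).trans ?_
    · rw [Set.uIoc_of_le (by norm_num)] at hy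
      exact key c y hc (abs_le.2 ⟨hy.1.le, hy.2⟩) (hm y)
    · norm_num
      linarith
  have h1 := hh (-1) (by simp)
  have h2 := hh 1 (by simp)
  have h3 := hv (m + 1 / 2) (by rw [add_sub_cancel_left]; norm_num [abs_of_pos]) (vertical_mem m)
  have h4 := hv (m - 1 / 2) (by rw [sub_sub_cancel_left, abs_neg]; norm_num [abs_of_pos])
    (vertical_mem' m)
  rw [residueInt, rectInt, norm_mul]
  have h6 : ‖(2 * Real.pi * Complex.I : ℂ)⁻¹‖ ≤ 1 / 6 := by
    rw [norm_inv, one_div]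
    apply inv_anti₀ (by norm_num)
    simp only [norm_mul, Complex.norm_I, Complex.norm_real, Complex.norm_ofNat, mul_one,
      Real.norm_of_nonneg Real.pi_pos.le]
    linarith [Real.pi_gt_three]
  calc _ ≤ 1 / 6 * (B + B + 2 * B + 2 * B) := by
        refine mul_le_mul h6 ?_ (norm_nonneg _) (by norm_num)
        refine (norm_sub_le _ _).trans (add_le_add ?_ h4)
        refine (norm_add_le _ _).trans (add_le_add ?_ h3)
        exact (norm_sub_le _ _).trans (add_le_add h1 h2)
    _ = _ := by
        rw [hB, mul_pow]
        ring

/-- Cauchy's theorem: moving the line of integration across the integer `m` picks up the residue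
at `m`. -/
theorem IsBarnesKernel.lineInt_sub_lineInt (hψ : IsBarnesKernel b ψ) {w : ℂ}
    (hw : w ∈ barnesStrip b) (m : ℤ) :
    lineInt ψ (m + 1) w - lineInt ψ m w = residueInt ψ m w := by
  set g : ℂ → ℂ := fun s => Complex.exp (w * s) * ψ s with hg
  have hgd : ∀ s ∈ offIntegers, DifferentiableAt ℂ g s := fun s hs =>
    DifferentiableAt.mul (by fun_prop) (hψ.differentiableAt s hs)
  have hgc : ContinuousOn g contourRegion := fun s hs =>
    (hgd s (contourRegion_subset hs)).continuousAt.continuousWithinAt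
  -- `H y` is the integral over the horizontal segment at height `y`, and `V p q` is the difference
  -- of the integrals over the two vertical segments between the heights `p` and `q`.
  set H : ℝ → ℂ := fun y => ∫ x in (m - 1 / 2 : ℝ)..(m + 1 / 2 : ℝ), g (x + y * Complex.I) with hH
  set V : ℝ → ℝ → ℂ := fun p q => (Complex.I * ∫ y in p..q, g ((m + 1 / 2 : ℝ) + y * Complex.I)) -
    Complex.I * ∫ y in p..q, g ((m - 1 / 2 : ℝ) + y * Complex.I) with hV
  have hrect : ∀ p q : ℝ, p ≤ q → (∀ y ∈ Set.Icc p q, 1 ≤ |y|) → H p - H q + V p q = 0 := by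
    intro p q hpq hy
    have := Complex.integral_boundary_rect_eq_zero_of_differentiableOn g
      ((m - 1 / 2 : ℝ) + p * Complex.I) ((m + 1 / 2 : ℝ) + q * Complex.I) (by
        intro s hs
        refine (hgd s (contourRegion_subset (Or.inr ?_))).differentiableWithinAt
        have h2 := (Complex.mem_reProdIm.1 hs).2
        simp only [Complex.add_im, Complex.ofReal_im, Complex.mul_im, Complex.ofReal_re,
          Complex.I_im, Complex.I_re, mul_one, mul_zero, add_zero, zero_add] at h2
        rw [Set.uIcc_of_le hpq] at h2
        exact hy _ h2)
    have r1 : ∀ c d : ℝ, ((c : ℂ) + d * Complex.I).re = c := fun c d => by simp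
    have r2 : ∀ c d : ℝ, ((c : ℂ) + d * Complex.I).im = d := fun c d => by simp
    rw [r1, r1, r2, r2] at this
    simp only [smul_eq_mul] at this
    rw [← this, hH, hV]
    ring
  have hVadd : ∀ T : ℝ, V (-T) T = V (-T) (-1) + V (-1) 1 + V 1 T := by
    intro T
    have i3 := fun p q : ℝ => (continuous_vertical hgc m).intervalIntegrable p q
      (μ := MeasureTheory.volume)
    have i4 := fun p q : ℝ => (continuous_vertical' hgc m).intervalIntegrable p q
      (μ := MeasureTheory.volume)
    simp only [hV]
    rw [← intervalIntegral.integral_add_adjacent_intervals (i3 (-T) (-1)) (i3 (-1) T),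
      ← intervalIntegral.integral_add_adjacent_intervals (i3 (-1) 1) (i3 1 T),
      ← intervalIntegral.integral_add_adjacent_intervals (i4 (-T) (-1)) (i4 (-1) T),
      ← intervalIntegral.integral_add_adjacent_intervals (i4 (-1) 1) (i4 1 T)]
    ring
  have hres : residueInt ψ m w = (2 * Real.pi * Complex.I)⁻¹ * (H (-1) - H 1 + V (-1) 1) := by
    rw [residueInt, rectInt, hH, hV]
    congr 1
    ring
  have hT : ∀ T : ℝ, 1 ≤ T → V (-T) T + (H (-T) - H T) = H (-1) - H 1 + V (-1) 1 := by
    intro T hT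
    have h1 := hrect (-T) (-1) (by linarith) fun y hy => by
      rw [le_abs]; right; linarith [hy.2]
    have h2 := hrect 1 T hT fun y hy => by
      rw [le_abs]; left; linarith [hy.1]
    rw [hVadd]
    linear_combination h1 + h2
  obtain ⟨C, N, hC, hb⟩ := hψ.exists_norm_exp_mul_le
  have hδ : 0 < Real.pi - |w.im - b| := sub_pos.2 hw
  -- the horizontal sides tend to zero
  have hlimH : ∀ σ : ℝ, |σ| = 1 → Tendsto (fun T : ℝ => H (σ * T)) atTop (𝓝 0) := by
    intro σ hσ
    obtain ⟨C', hC', hdec⟩ := exists_one_add_pow_mul_exp_le N hδ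
    set M := C * (2 + |(m : ℝ)|) ^ N * Real.exp ((|(m : ℝ)| + 1) * |w.re|) with hM
    have hbd : ∀ᶠ T : ℝ in atTop, ‖H (σ * T)‖ ≤ M * (C' * (1 + T ^ 2)⁻¹) := by
      filter_upwards [eventually_ge_atTop 1] with T hT
      have hσT : |σ * T| = |T| := by rw [abs_mul, hσ, one_mul]
      have hT1 : 1 ≤ |σ * T| := by rw [hσT]; exact hT.trans (le_abs_self T)
      refine (intervalIntegral.norm_integral_le_of_norm_le_const
        (C := M * (C' * (1 + T ^ 2)⁻¹)) fun x hx => ?_).trans ?_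
      · rw [Set.uIoc_of_le (by linarith)] at hx
        refine (hb w x (σ * T) (horizontal_mem x hT1)).trans ?_
        rw [hσT]
        have hx1 : |x| ≤ |(m : ℝ)| + 1 := by
          have h5 := abs_add_le (x - m) m
          have h6 : |x - m| ≤ 1 := by
            rw [abs_le]
            constructor <;> linarith [hx.1, hx.2]
          rw [sub_add_cancel] at h5
          linarith
        have h7 : x * w.re ≤ (|(m : ℝ)| + 1) * |w.re| := by
          calc x * w.re ≤ |x| * |w.re| := by rw [← abs_mul]; exact le_abs_self _
            _ ≤ _ := by gcongr
        have h8 : 1 + |x| ≤ 2 + |(m : ℝ)| := by linarith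
        exact mul_le_mul (by rw [hM]; gcongr) (hdec T) (by positivity) (by positivity)
      · rw [show (m + 1 / 2 : ℝ) - (m - 1 / 2) = 1 by ring, abs_one, mul_one]
    refine squeeze_zero_norm' hbd ?_
    have h1 : Tendsto (fun T : ℝ => (1 + T ^ 2)⁻¹) atTop (𝓝 0) :=
      tendsto_inv_atTop_zero.comp (tendsto_atTop_add_const_left _ 1
        (tendsto_pow_atTop (two_ne_zero)))
    simpa using (h1.const_mul C').const_mul M
  have hlimV : Tendsto (fun T : ℝ => V (-T) T) atTop
      (𝓝 (2 * Real.pi * Complex.I * (lineInt ψ (m + 1) w - lineInt ψ m w))) := by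
    have i1 := hψ.integrable hw (m + 1)
    have i2 := hψ.integrable hw m
    have e : (((m + 1 : ℤ) : ℝ) - 1 / 2) = (m + 1 / 2 : ℝ) := by push_cast; ring
    rw [e] at i1
    have t1 := MeasureTheory.intervalIntegral_tendsto_integral i1 tendsto_neg_atTop_atBot
      tendsto_id
    have t2 := MeasureTheory.intervalIntegral_tendsto_integral i2 tendsto_neg_atTop_atBot
      tendsto_id
    have := (t1.const_mul Complex.I).sub (t2.const_mul Complex.I)
    have hpi : (Real.pi : ℂ) ≠ 0 := by exact_mod_cast Real.pi_ne_zero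
    have hval : 2 * Real.pi * Complex.I * (lineInt ψ (m + 1) w - lineInt ψ m w) =
        Complex.I * (∫ y : ℝ, g ((m + 1 / 2 : ℝ) + y * Complex.I)) -
          Complex.I * ∫ y : ℝ, g ((m - 1 / 2 : ℝ) + y * Complex.I) := by
      simp only [lineInt, e, hg]
      field_simp
    rw [hval]
    exact this
  have hlim := hlimV.add ((hlimH (-1) (by simp)).sub (hlimH 1 (by simp)))
  have hconst : Tendsto (fun _ : ℝ => H (-1) - H 1 + V (-1) 1) atTop
      (𝓝 (2 * Real.pi * Complex.I * (lineInt ψ (m + 1) w - lineInt ψ m w) + (0 - 0))) := by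
    refine hlim.congr' ?_
    filter_upwards [eventually_ge_atTop 1] with T h1
    rw [neg_one_mul, one_mul]
    exact hT T h1
  have hfin := tendsto_nhds_unique tendsto_const_nhds hconst
  rw [hres, hfin, sub_zero, add_zero, ← mul_assoc, inv_mul_cancel₀ Complex.two_pi_I_ne_zero,
    one_mul]

end Line

/-! ### Half-infinite sums of residues -/

section Sums

/-- Terms of size `e^{mr}`, up to polynomial factors, are summable over a set of indices on which
`mr` tends linearly to `-∞`. -/
theorem summable_indicator_of_bound {g : ℤ → ℂ} {S : Set ℤ} {C δ c r : ℝ} {N : ℕ} (hδ : 0 < δ)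
    (hS : ∀ m ∈ S, m * r ≤ c - δ * |(m : ℝ)|)
    (hg : ∀ m : ℤ, ‖g m‖ ≤ C * (1 + |(m : ℝ)|) ^ N * Real.exp (m * r)) (hC : 0 ≤ C) :
    Summable (S.indicator g) := by
  refine Summable.of_norm_bounded ((summable_one_add_pow_mul_exp N hδ).mul_left
    (C * Real.exp c)) fun m => ?_
  by_cases hm : m ∈ S
  · rw [Set.indicator_of_mem hm]
    refine (hg m).trans ?_
    calc _ ≤ C * (1 + |(m : ℝ)|) ^ N * Real.exp (c - δ * |(m : ℝ)|) := by
          gcongr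
          exact hS m hm
      _ = _ := by rw [sub_eq_add_neg, Real.exp_add]; ring
  · rw [Set.indicator_of_notMem hm, norm_zero]
    positivity

theorem mul_le_of_mem_Ici {m₀ m : ℤ} (hm : m ∈ Set.Ici m₀) {δ r : ℝ} (hδ : 0 < δ)
    (h1 : r ≤ -δ) (h2 : -(3 * δ) ≤ r) : m * r ≤ 4 * δ * |(m₀ : ℝ)| - δ * |(m : ℝ)| := by
  have hm' : (m₀ : ℝ) ≤ m := by exact_mod_cast (Set.mem_Ici.1 hm)
  rcases le_or_gt 0 (m : ℝ) with h | h
  · rw [abs_of_nonneg h]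
    have : 0 ≤ δ * |(m₀ : ℝ)| := by positivity
    nlinarith
  · have h0 : (m₀ : ℝ) < 0 := by linarith
    rw [abs_of_neg h, abs_of_neg h0]
    nlinarith

theorem mul_le_of_mem_Iio {m₁ m : ℤ} (hm : m ∈ Set.Iio m₁) {δ r : ℝ} (hδ : 0 < δ)
    (h1 : δ ≤ r) (h2 : r ≤ 3 * δ) : m * r ≤ 4 * δ * |(m₁ : ℝ)| - δ * |(m : ℝ)| := by
  have := mul_le_of_mem_Ici (m₀ := -m₁) (m := -m) (r := -r) (by
    rw [Set.mem_Ici]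
    have := Set.mem_Iio.1 hm
    omega) hδ (by linarith) (by linarith)
  push_cast at this
  rw [abs_neg, abs_neg] at this
  linarith

variable {f : ℤ → ℂ → ℂ}

theorem IsLaurentLike.differentiableAt_tsum (hf : IsLaurentLike f) {S : Set ℤ} {w₀ : ℂ}
    {δ c ε : ℝ} (hδ : 0 < δ) (hε : 0 < ε)
    (hS : ∀ w ∈ Metric.ball w₀ ε, ∀ m ∈ S, m * w.re ≤ c - δ * |(m : ℝ)|) :
    DifferentiableAt ℂ (fun w => ∑' m, S.indicator (fun m => f m w) m) w₀ := by
  obtain ⟨C, N, hC, h⟩ := hf.bound (‖w₀‖ + ε)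
  have key := Complex.differentiableOn_tsum_of_summable_norm
    (F := fun m w => S.indicator (fun m => f m w) m)
    ((summable_one_add_pow_mul_exp N hδ).mul_left (C * Real.exp c))
    (fun m => by
      by_cases hm : m ∈ S
      · simp only [Set.indicator_of_mem hm]
        exact (hf.differentiable m).differentiableOn
      · simp only [Set.indicator_of_notMem hm]
        exact differentiableOn_const 0)
    (Metric.isOpen_ball (x := w₀) (ε := ε)) (fun m w hw => by
      by_cases hm : m ∈ S
      · rw [Set.indicator_of_mem hm]
        have hw' : ‖w‖ ≤ ‖w₀‖ + ε := by
          rw [Metric.mem_ball, dist_eq_norm] at hw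
          have := norm_add_le (w - w₀) w₀
          rw [sub_add_cancel] at this
          linarith
        refine (h w hw' m).trans ?_
        calc _ ≤ C * (1 + |(m : ℝ)|) ^ N * Real.exp (c - δ * |(m : ℝ)|) := by
              gcongr
              exact hS w hw m hm
          _ = _ := by rw [sub_eq_add_neg, Real.exp_add]; ring
      · rw [Set.indicator_of_notMem hm, norm_zero]
        positivity)
  exact (key w₀ (Metric.mem_ball_self hε)).differentiableAt (Metric.ball_mem_nhds w₀ hε)

theorem IsLaurentLike.summable_Ici (hf : IsLaurentLike f) (m₀ : ℤ) {w : ℂ} (hw : w.re < 0) :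
    Summable ((Set.Ici m₀).indicator fun m => f m w) := by
  obtain ⟨C, N, hC, h⟩ := hf.bound ‖w‖
  exact summable_indicator_of_bound (δ := -w.re) (by linarith)
    (fun m hm => mul_le_of_mem_Ici hm (by linarith) (by linarith) (by linarith)) (h w le_rfl) hC

theorem IsLaurentLike.summable_Iio (hf : IsLaurentLike f) (m₁ : ℤ) {w : ℂ} (hw : 0 < w.re) :
    Summable ((Set.Iio m₁).indicator fun m => f m w) := by
  obtain ⟨C, N, hC, h⟩ := hf.bound ‖w‖
  exact summable_indicator_of_bound (δ := w.re) (by linarith)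
    (fun m hm => mul_le_of_mem_Iio hm (by linarith) (by linarith) (by linarith)) (h w le_rfl) hC

theorem IsLaurentLike.differentiableOn_Ici (hf : IsLaurentLike f) (m₀ : ℤ) :
    DifferentiableOn ℂ (fun w => ∑' m, (Set.Ici m₀).indicator (fun m => f m w) m)
      {w | w.re < 0} := by
  intro w₀ (hw₀ : w₀.re < 0)
  refine (hf.differentiableAt_tsum (δ := -w₀.re / 2) (ε := -w₀.re / 2)
    (c := 4 * (-w₀.re / 2) * |(m₀ : ℝ)|) (by linarith) (by linarith)
    fun w hw m hm => ?_).differentiableWithinAt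
  rw [Metric.mem_ball, dist_eq_norm] at hw
  have := abs_le.1 ((Complex.abs_re_le_norm (w - w₀)).trans hw.le)
  rw [Complex.sub_re] at this
  exact mul_le_of_mem_Ici hm (by linarith) (by linarith [this.2]) (by linarith [this.1])

theorem IsLaurentLike.differentiableOn_Iio (hf : IsLaurentLike f) (m₁ : ℤ) :
    DifferentiableOn ℂ (fun w => ∑' m, (Set.Iio m₁).indicator (fun m => f m w) m)
      {w | 0 < w.re} := by
  intro w₀ (hw₀ : 0 < w₀.re)
  refine (hf.differentiableAt_tsum (δ := w₀.re / 2) (ε := w₀.re / 2)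
    (c := 4 * (w₀.re / 2) * |(m₁ : ℝ)|) (by linarith) (by linarith)
    fun w hw m hm => ?_).differentiableWithinAt
  rw [Metric.mem_ball, dist_eq_norm] at hw
  have := abs_le.1 ((Complex.abs_re_le_norm (w - w₀)).trans hw.le)
  rw [Complex.sub_re] at this
  exact mul_le_of_mem_Iio hm (by linarith) (by linarith [this.1]) (by linarith [this.2])

variable {b : ℝ} {ψ : ℂ → ℂ}

/-- The line integrals decay when the line is moved to infinity in the direction in which `e^{ws}`
decays. -/
theorem IsBarnesKernel.exists_norm_lineInt_le (hψ : IsBarnesKernel b ψ) {w : ℂ}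
    (hw : w ∈ barnesStrip b) : ∃ (C : ℝ) (N : ℕ), 0 ≤ C ∧ ∀ m : ℤ,
      ‖lineInt ψ m w‖ ≤ C * (1 + |(m : ℝ)|) ^ N * Real.exp (m * w.re) := by
  obtain ⟨C, N, hC, h⟩ := hψ.exists_norm_exp_mul_le
  set A := ∫ t : ℝ, (1 + |t|) ^ N * Real.exp (-((Real.pi - |w.im - b|) * |t|)) with hA
  have hA0 : 0 ≤ A := MeasureTheory.integral_nonneg fun t => by positivity
  refine ⟨C * 2 ^ N * Real.exp (-(1 / 2) * w.re) * A, N, by positivity, fun m => ?_⟩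
  rw [lineInt, norm_mul]
  have h6 : ‖(2 * Real.pi : ℂ)⁻¹‖ ≤ 1 := by
    rw [norm_inv]
    apply inv_le_one_of_one_le₀
    simp only [norm_mul, Complex.norm_real, Complex.norm_ofNat, Real.norm_of_nonneg Real.pi_pos.le]
    linarith [Real.pi_gt_three]
  have h7 : 1 + |(m - 1 / 2 : ℝ)| ≤ 2 * (1 + |(m : ℝ)|) := by
    have := abs_sub (m : ℝ) (1 / 2)
    rw [abs_of_pos (by norm_num : (0 : ℝ) < 1 / 2)] at this
    linarith [abs_nonneg (m : ℝ)]
  calc _ ≤ 1 * ∫ t : ℝ, C * (1 + |(m - 1 / 2 : ℝ)|) ^ N * Real.exp ((m - 1 / 2 : ℝ) * w.re) *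
        ((1 + |t|) ^ N * Real.exp (-((Real.pi - |w.im - b|) * |t|))) := by
        refine mul_le_mul h6 (MeasureTheory.norm_integral_le_of_norm_le
          ((integrable_one_add_pow_mul_exp N (sub_pos.2 hw)).const_mul _)
          (Filter.Eventually.of_forall fun y => h w _ y (vertical_mem' m y))) (norm_nonneg _)
          zero_le_one
    _ = C * (1 + |(m - 1 / 2 : ℝ)|) ^ N * Real.exp ((m - 1 / 2 : ℝ) * w.re) * A := by
        rw [one_mul, MeasureTheory.integral_const_mul, hA]
    _ ≤ C * (2 * (1 + |(m : ℝ)|)) ^ N *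
        (Real.exp (-(1 / 2) * w.re) * Real.exp (m * w.re)) * A := by
        rw [← Real.exp_add]
        gcongr
        linarith
    _ = _ := by rw [mul_pow]; ring

/-- Closing the contour to the right. -/
theorem IsBarnesKernel.hasSum_Ici (hψ : IsBarnesKernel b ψ) {w : ℂ} (hw : w ∈ barnesStrip b)
    (hre : w.re < 0) (m₀ : ℤ) :
    HasSum ((Set.Ici m₀).indicator fun m => residueInt ψ m w) (-lineInt ψ m₀ w) := by
  obtain ⟨C, N, hC, h⟩ := hψ.exists_norm_lineInt_le hw
  have hs : Summable ((Set.Ici m₀).indicator fun m => lineInt ψ m w) :=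
    summable_indicator_of_bound (δ := -w.re) (by linarith)
      (fun m hm => mul_le_of_mem_Ici hm (by linarith) (by linarith) (by linarith)) h hC
  have hinj : Function.Injective fun k : ℕ => m₀ + (k : ℤ) := fun i j hij => by simpa using hij
  have hlim : Tendsto (fun k : ℕ => lineInt ψ (m₀ + k) w) atTop (𝓝 0) := by
    have := hs.tendsto_cofinite_zero.comp (hinj.tendsto_cofinite)
    rw [Nat.cofinite_eq_atTop] at this
    refine this.congr fun k => ?_
    simp
  have hsum := (hψ.isLaurentLike_residueInt.summable_Ici m₀ hre)
  have hsupp : ∀ m, m ∉ Set.range (fun k : ℕ => m₀ + (k : ℤ)) →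
      (Set.Ici m₀).indicator (fun m => residueInt ψ m w) m = 0 := by
    intro m hm
    refine Set.indicator_of_notMem (fun h => hm ⟨(m - m₀).toNat, ?_⟩) _
    have := Set.mem_Ici.1 h
    simp only
    omega
  rw [← hinj.hasSum_iff hsupp]
  have hsum' := (hinj.summable_iff hsupp).2 hsum
  rw [hsum'.hasSum_iff_tendsto_nat]
  -- By Cauchy's theorem the partial sums telescope.
  have htel : ∀ K : ℕ, ∑ k ∈ Finset.range K,
      ((Set.Ici m₀).indicator (fun m => residueInt ψ m w) ∘ fun k : ℕ => m₀ + (k : ℤ)) k =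
        lineInt ψ (m₀ + K) w - lineInt ψ m₀ w := by
    intro K
    induction K with
    | zero => simp
    | succ K ih =>
      rw [Finset.sum_range_succ, ih, Function.comp_apply, Set.indicator_of_mem (by simp),
        ← hψ.lineInt_sub_lineInt hw, Nat.cast_succ, add_assoc]
      ring
  simp only [htel]
  simpa using hlim.sub_const (lineInt ψ m₀ w)

/-- Closing the contour to the left. -/
theorem IsBarnesKernel.hasSum_Iio (hψ : IsBarnesKernel b ψ) {w : ℂ} (hw : w ∈ barnesStrip b)
    (hre : 0 < w.re) (m₁ : ℤ) :
    HasSum ((Set.Iio m₁).indicator fun m => residueInt ψ m w) (lineInt ψ m₁ w) := by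
  obtain ⟨C, N, hC, h⟩ := hψ.exists_norm_lineInt_le hw
  have hs : Summable ((Set.Iio (m₁ + 1)).indicator fun m => lineInt ψ m w) :=
    summable_indicator_of_bound (δ := w.re) (by linarith)
      (fun m hm => mul_le_of_mem_Iio hm (by linarith) (by linarith) (by linarith)) h hC
  have hinj : Function.Injective fun k : ℕ => m₁ - 1 - (k : ℤ) := fun i j hij => by
    simpa using hij
  have hinj' : Function.Injective fun k : ℕ => m₁ - (k : ℤ) := fun i j hij => by
    simpa using hij
  have hlim : Tendsto (fun k : ℕ => lineInt ψ (m₁ - k) w) atTop (𝓝 0) := by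
    have := hs.tendsto_cofinite_zero.comp (hinj'.tendsto_cofinite)
    rw [Nat.cofinite_eq_atTop] at this
    refine this.congr fun k => ?_
    rw [Function.comp_apply, Set.indicator_of_mem]
    rw [Set.mem_Iio]
    omega
  have hsum := (hψ.isLaurentLike_residueInt.summable_Iio m₁ hre)
  have hsupp : ∀ m, m ∉ Set.range (fun k : ℕ => m₁ - 1 - (k : ℤ)) →
      (Set.Iio m₁).indicator (fun m => residueInt ψ m w) m = 0 := by
    intro m hm
    refine Set.indicator_of_notMem (fun h => hm ⟨(m₁ - 1 - m).toNat, ?_⟩) _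
    have := Set.mem_Iio.1 h
    simp only
    omega
  rw [← hinj.hasSum_iff hsupp]
  have hsum' := (hinj.summable_iff hsupp).2 hsum
  rw [hsum'.hasSum_iff_tendsto_nat]
  have htel : ∀ K : ℕ, ∑ k ∈ Finset.range K,
      ((Set.Iio m₁).indicator (fun m => residueInt ψ m w) ∘ fun k : ℕ => m₁ - 1 - (k : ℤ)) k =
        lineInt ψ m₁ w - lineInt ψ (m₁ - K) w := by
    intro K
    induction K with
    | zero => simp
    | succ K ih =>
      have hmem : m₁ - 1 - (K : ℤ) ∈ Set.Iio m₁ := by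
        rw [Set.mem_Iio]
        omega
      rw [Finset.sum_range_succ, ih, Function.comp_apply, Set.indicator_of_mem hmem,
        ← hψ.lineInt_sub_lineInt hw, Nat.cast_succ,
        show m₁ - 1 - (K : ℤ) + 1 = m₁ - K by ring, show m₁ - ((K : ℤ) + 1) = m₁ - 1 - K by ring]
      ring
  simp only [htel]
  simpa using hlim.const_sub (lineInt ψ m₁ w)

end Sums

/-! ### Families of power series that depend on a complex parameter -/

section Families

variable {σ : Type*}

theorem exists_coeff_subst_eq_sum_range {ℓ : MvPowerSeries σ ℂ} (hℓ : PowerSeries.HasSubst ℓ)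
    (α : σ →₀ ℕ) :
    ∃ N : ℕ, ∀ M, N ≤ M → ∀ g : PowerSeries ℂ, MvPowerSeries.coeff α (g.subst ℓ) =
      ∑ r ∈ Finset.range M, PowerSeries.coeff r g * MvPowerSeries.coeff α (ℓ ^ r) := by
  obtain ⟨D, h0, h⟩ := exists_coeff_subst_eq_sum hℓ α
  refine ⟨D.sup id + 1, fun M hM g => ?_⟩
  rw [h g]
  simp only [smul_eq_mul]
  refine Finset.sum_subset (fun r hr => ?_) fun r _ hr => by rw [h0 r hr, mul_zero]
  rw [Finset.mem_range]
  have : r ≤ D.sup id := Finset.le_sup (f := id) hr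
  omega

/-- The chain rule for a linear form `ℓ`. -/
theorem pderiv_subst {i : σ} {ℓ : MvPowerSeries σ ℂ} (hℓ : PowerSeries.HasSubst ℓ) {c : ℂ}
    (hc : MvPowerSeries.pderiv ℂ i ℓ = MvPowerSeries.C c) (g : PowerSeries ℂ) :
    MvPowerSeries.pderiv ℂ i (g.subst ℓ) =
      c • (PowerSeries.derivative ℂ g).subst ℓ := by
  ext α
  obtain ⟨N₁, h₁⟩ := exists_coeff_subst_eq_sum_range hℓ (α + Finsupp.single i 1)
  obtain ⟨N₂, h₂⟩ := exists_coeff_subst_eq_sum_range hℓ α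
  rw [MvPowerSeries.coeff_pderiv, h₁ (max N₁ N₂ + 1) (by omega), coeff_csmul,
    h₂ (max N₁ N₂) (by omega), Finset.sum_range_succ', add_mul,
    Finset.sum_mul, smul_eq_mul, Finset.mul_sum]
  have h0 : PowerSeries.coeff 0 g * MvPowerSeries.coeff (α + Finsupp.single i 1) (ℓ ^ 0) *
      ((α i : ℂ) + 1) = 0 := by
    classical
    rw [pow_zero, MvPowerSeries.coeff_one, if_neg, mul_zero, zero_mul]
    intro h
    have := DFunLike.congr_fun h i
    simp at this
  rw [h0, add_zero]
  refine Finset.sum_congr rfl fun r _ => ?_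
  rw [mul_assoc, ← MvPowerSeries.coeff_pderiv, MvPowerSeries.pderiv_pow, hc,
    PowerSeries.coeff_derivative, mul_comm _ (MvPowerSeries.C c), MvPowerSeries.coeff_C_mul,
    Nat.add_sub_cancel, ← MvPowerSeries.coeff_C_mul]
  have : ((r + 1 : ℕ) : MvPowerSeries σ ℂ) = MvPowerSeries.C ((r : ℂ) + 1) := by
    rw [map_add, map_natCast, map_one]
    push_cast
    rfl
  rw [this, MvPowerSeries.coeff_C_mul, MvPowerSeries.coeff_C_mul]
  ring

/-- Coefficientwise derivative of a family of power series with respect to the parameter. -/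
def HasCoeffDerivAt (Ψ : ℂ → MvPowerSeries σ ℂ) (Ψ' : MvPowerSeries σ ℂ) (s : ℂ) : Prop :=
  ∀ α, HasDerivAt (fun u => MvPowerSeries.coeff α (Ψ u)) (MvPowerSeries.coeff α Ψ') s

theorem HasCoeffDerivAt.mul {Ψ Φ : ℂ → MvPowerSeries σ ℂ} {Ψ' Φ' : MvPowerSeries σ ℂ} {s : ℂ}
    (hΨ : HasCoeffDerivAt Ψ Ψ' s)
    (hΦ : HasCoeffDerivAt Φ Φ' s) :
    HasCoeffDerivAt (fun u => Ψ u * Φ u) (Ψ' * Φ s + Ψ s * Φ') s := by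
  classical
  intro α
  simp only [MvPowerSeries.coeff_mul, map_add]
  rw [← Finset.sum_add_distrib]
  exact HasDerivAt.fun_sum fun p _ => (hΨ p.1).mul (hΦ p.2)

theorem HasCoeffDerivAt.congr {Ψ : ℂ → MvPowerSeries σ ℂ} {Ψ' Ψ'' : MvPowerSeries σ ℂ} {s : ℂ}
    (hΨ : HasCoeffDerivAt Ψ Ψ' s) (h : Ψ' = Ψ'') : HasCoeffDerivAt Ψ Ψ'' s := h ▸ hΨ

theorem hasCoeffDerivAt_const (Ψ : MvPowerSeries σ ℂ) (s : ℂ) :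
    HasCoeffDerivAt (fun _ => Ψ) 0 s := fun α => by
  simpa using hasDerivAt_const s _

theorem HasCoeffDerivAt.C {f : ℂ → ℂ} {f' s : ℂ} (hf : HasDerivAt f f' s) :
    HasCoeffDerivAt (σ := σ) (fun u => MvPowerSeries.C (f u)) (MvPowerSeries.C f') s := by
  classical
  intro α
  simp only [MvPowerSeries.coeff_C]
  split_ifs
  · exact hf
  · exact hasDerivAt_const _ _

theorem HasCoeffDerivAt.smul {f : ℂ → ℂ} {f' s : ℂ} (hf : HasDerivAt f f' s)
    {Ψ : ℂ → MvPowerSeries σ ℂ} {Ψ' : MvPowerSeries σ ℂ}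
    (hΨ : HasCoeffDerivAt Ψ Ψ' s) :
    HasCoeffDerivAt (fun u => f u • Ψ u) (f' • Ψ s + f s • Ψ') s := by
  intro α
  simp only [coeff_csmul, smul_eq_mul, map_add]
  exact hf.mul (hΨ α)

theorem HasCoeffDerivAt.sub {Ψ Φ : ℂ → MvPowerSeries σ ℂ} {Ψ' Φ' : MvPowerSeries σ ℂ} {s : ℂ}
    (hΨ : HasCoeffDerivAt Ψ Ψ' s)
    (hΦ : HasCoeffDerivAt Φ Φ' s) : HasCoeffDerivAt (fun u => Ψ u - Φ u) (Ψ' - Φ') s := fun α => by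
  simp only [map_sub]
  exact (hΨ α).sub (hΦ α)

theorem HasCoeffDerivAt.unique {Ψ : ℂ → MvPowerSeries σ ℂ} {Ψ' Ψ'' : MvPowerSeries σ ℂ} {s : ℂ}
    (h : HasCoeffDerivAt Ψ Ψ' s) (h' : HasCoeffDerivAt Ψ Ψ'' s) : Ψ' = Ψ'' := by
  ext α
  exact (h α).unique (h' α)

theorem hasCoeffDerivAt_rGammaTaylor {ℓ : MvPowerSeries σ ℂ} (hℓ : PowerSeries.HasSubst ℓ)
    (p ε s : ℂ) :
    HasCoeffDerivAt (fun u => (rGammaTaylor (p + ε * u)).subst ℓ)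
      (ε • (PowerSeries.derivative ℂ (rGammaTaylor (p + ε * s))).subst ℓ) s := by
  intro α
  obtain ⟨N, h⟩ := exists_coeff_subst_eq_sum_range hℓ α
  simp only [h N le_rfl, coeff_csmul, smul_eq_mul, Finset.mul_sum, PowerSeries.coeff_derivative]
  refine HasDerivAt.fun_sum fun r _ => ?_
  have h1 : HasDerivAt (fun u : ℂ => p + ε * u) ε s := by
    simpa using ((hasDerivAt_id s).const_mul ε).const_add p
  have h2 := ((hasDerivAt_coeff_rGammaTaylor r (p + ε * s)).comp s h1).mul_const
    (MvPowerSeries.coeff α (ℓ ^ r))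
  refine h2.congr_deriv ?_
  ring

/-- The family `Ψ` is transported with velocity `c` along the variable `i`: formally, `Ψ` is a
function of `s + Xᵢ / c`. -/
def IsTransportedAt (c : ℂ) (i : σ) (Ψ : ℂ → MvPowerSeries σ ℂ) (s : ℂ) : Prop :=
  HasCoeffDerivAt Ψ (c • MvPowerSeries.pderiv ℂ i (Ψ s)) s

theorem IsTransportedAt.mul {c : ℂ} {i : σ} {Ψ Φ : ℂ → MvPowerSeries σ ℂ} {s : ℂ}
    (hΨ : IsTransportedAt c i Ψ s)
    (hΦ : IsTransportedAt c i Φ s) : IsTransportedAt c i (fun u => Ψ u * Φ u) s := by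
  refine (HasCoeffDerivAt.mul hΨ hΦ).congr ?_
  rw [Derivation.leibniz]
  simp only [smul_eq_mul, smul_add, Algebra.mul_smul_comm, Algebra.smul_mul_assoc]
  rw [add_comm]
  congr 2
  ring

theorem IsTransportedAt.prod {c : ℂ} {i : σ} {ι : Type*} (D : Finset ι)
    {Ψ : ι → ℂ → MvPowerSeries σ ℂ} {s : ℂ}
    (hΨ : ∀ j ∈ D, IsTransportedAt c i (Ψ j) s) :
    IsTransportedAt c i (fun u => ∏ j ∈ D, Ψ j u) s := by
  classical
  induction D using Finset.induction_on with
  | empty =>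
    refine (hasCoeffDerivAt_const _ _).congr ?_
    simp
  | insert j D hj ih =>
    simp only [Finset.prod_insert hj]
    exact (hΨ j (Finset.mem_insert_self j D)).mul
      (ih fun k hk => hΨ k (Finset.mem_insert_of_mem hk))

/-- Coefficientwise differentiability of a family of power series. -/
def CoeffDifferentiableAt (Ψ : ℂ → MvPowerSeries σ ℂ) (s : ℂ) : Prop :=
  ∀ α, DifferentiableAt ℂ (fun u => MvPowerSeries.coeff α (Ψ u)) s

theorem HasCoeffDerivAt.differentiableAt {Ψ : ℂ → MvPowerSeries σ ℂ} {Ψ' : MvPowerSeries σ ℂ}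
    {s : ℂ} (h : HasCoeffDerivAt Ψ Ψ' s) : CoeffDifferentiableAt Ψ s :=
  fun α => (h α).differentiableAt

theorem CoeffDifferentiableAt.hasCoeffDerivAt {Ψ : ℂ → MvPowerSeries σ ℂ} {s : ℂ}
    (h : CoeffDifferentiableAt Ψ s) :
    HasCoeffDerivAt Ψ (fun α => deriv (fun u => MvPowerSeries.coeff α (Ψ u)) s) s :=
  fun α => (h α).hasDerivAt

theorem CoeffDifferentiableAt.mul {Ψ Φ : ℂ → MvPowerSeries σ ℂ} {s : ℂ}
    (hΨ : CoeffDifferentiableAt Ψ s)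
    (hΦ : CoeffDifferentiableAt Φ s) : CoeffDifferentiableAt (fun u => Ψ u * Φ u) s :=
  (hΨ.hasCoeffDerivAt.mul hΦ.hasCoeffDerivAt).differentiableAt

theorem CoeffDifferentiableAt.prod {ι : Type*} (D : Finset ι) {Ψ : ι → ℂ → MvPowerSeries σ ℂ}
    {s : ℂ}
    (hΨ : ∀ j ∈ D, CoeffDifferentiableAt (Ψ j) s) :
    CoeffDifferentiableAt (fun u => ∏ j ∈ D, Ψ j u) s := by
  classical
  induction D using Finset.induction_on with
  | empty => exact (hasCoeffDerivAt_const _ _).differentiableAt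
  | insert j D hj ih =>
    simp only [Finset.prod_insert hj]
    exact (hΨ j (Finset.mem_insert_self j D)).mul
      (ih fun k hk => hΨ k (Finset.mem_insert_of_mem hk))

/-- The coefficients of the family `Ψ` are bounded on `Ω` by the weight `ω`, up to polynomial
factors. -/
def CoeffGrowth (Ω : Set ℂ) (ω : ℂ → ℝ) (Ψ : ℂ → MvPowerSeries σ ℂ) : Prop :=
  ∀ α, ∃ (C : ℝ) (N : ℕ), 0 ≤ C ∧ ∀ s ∈ Ω,
    ‖MvPowerSeries.coeff α (Ψ s)‖ ≤ C * (1 + ‖s‖) ^ N * ω s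

theorem exists_bound_sum {ι : Type*} (D : Finset ι) {Ω : Set ℂ} {ω : ℂ → ℝ} (hω : ∀ s, 0 ≤ ω s)
    {f : ι → ℂ → ℂ} (h : ∀ i ∈ D, ∃ (C : ℝ) (N : ℕ), 0 ≤ C ∧ ∀ s ∈ Ω,
      ‖f i s‖ ≤ C * (1 + ‖s‖) ^ N * ω s) :
    ∃ (C : ℝ) (N : ℕ), 0 ≤ C ∧ ∀ s ∈ Ω, ‖∑ i ∈ D, f i s‖ ≤ C * (1 + ‖s‖) ^ N * ω s := by
  classical
  induction D using Finset.induction_on with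
  | empty => exact ⟨0, 0, le_rfl, fun s _ => by simp⟩
  | insert i D hi ih =>
    obtain ⟨C, N, hC, h1⟩ := ih fun j hj => h j (Finset.mem_insert_of_mem hj)
    obtain ⟨C', N', hC', h2⟩ := h i (Finset.mem_insert_self i D)
    refine ⟨C' + C, max N' N, by positivity, fun s hs => ?_⟩
    have hx : (1 : ℝ) ≤ 1 + ‖s‖ := by linarith [norm_nonneg s]
    rw [Finset.sum_insert hi]
    refine (norm_add_le _ _).trans ((add_le_add (h2 s hs) (h1 s hs)).trans ?_)
    rw [add_mul, add_mul]
    have := hω s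
    gcongr
    · exact le_max_left _ _
    · exact le_max_right _ _

theorem CoeffGrowth.mul {Ω : Set ℂ} {ω ω' : ℂ → ℝ} (hω : ∀ s, 0 ≤ ω s) (hω' : ∀ s, 0 ≤ ω' s)
    {Ψ Φ : ℂ → MvPowerSeries σ ℂ} (hΨ : CoeffGrowth Ω ω Ψ) (hΦ : CoeffGrowth Ω ω' Φ) :
    CoeffGrowth Ω (fun s => ω s * ω' s) (fun s => Ψ s * Φ s) := by
  classical
  intro α
  simp only [MvPowerSeries.coeff_mul]
  refine exists_bound_sum _ (fun s => mul_nonneg (hω s) (hω' s)) fun p _ => ?_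
  obtain ⟨C, N, hC, h1⟩ := hΨ p.1
  obtain ⟨C', N', hC', h2⟩ := hΦ p.2
  refine ⟨C * C', N + N', by positivity, fun s hs => ?_⟩
  rw [norm_mul]
  calc _ ≤ (C * (1 + ‖s‖) ^ N * ω s) * (C' * (1 + ‖s‖) ^ N' * ω' s) :=
        mul_le_mul (h1 s hs) (h2 s hs) (norm_nonneg _)
          (mul_nonneg (by positivity) (hω s))
    _ = _ := by rw [pow_add]; ring

theorem coeffGrowth_const (Ω : Set ℂ) (Ψ : MvPowerSeries σ ℂ) :
    CoeffGrowth Ω (fun _ => 1) (fun _ => Ψ) :=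
  fun α => ⟨‖MvPowerSeries.coeff α Ψ‖, 0, norm_nonneg _, fun s _ => by simp⟩

theorem CoeffGrowth.prod {Ω : Set ℂ} {ι : Type*} (D : Finset ι) {ω : ι → ℂ → ℝ}
    (hω : ∀ i s, 0 ≤ ω i s) {Ψ : ι → ℂ → MvPowerSeries σ ℂ}
    (hΨ : ∀ j ∈ D, CoeffGrowth Ω (ω j) (Ψ j)) :
    CoeffGrowth Ω (fun s => ∏ j ∈ D, ω j s) (fun s => ∏ j ∈ D, Ψ j s) := by
  classical
  induction D using Finset.induction_on with
  | empty => simpa using coeffGrowth_const Ω (1 : MvPowerSeries σ ℂ)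
  | insert j D hj ih =>
    simp only [Finset.prod_insert hj]
    exact (hΨ j (Finset.mem_insert_self j D)).mul (hω j)
      (fun s => Finset.prod_nonneg fun i _ => hω i s)
      (ih fun k hk => hΨ k (Finset.mem_insert_of_mem hk))

theorem CoeffGrowth.mono {Ω Ω' : Set ℂ} {ω ω' : ℂ → ℝ} {Ψ : ℂ → MvPowerSeries σ ℂ}
    (hΨ : CoeffGrowth Ω ω Ψ)
    (hΩ : Ω' ⊆ Ω) {c : ℝ} (hc : 0 ≤ c) (h : ∀ s ∈ Ω', ω s ≤ c * ω' s) : CoeffGrowth Ω' ω' Ψ := by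
  intro α
  obtain ⟨C, N, hC, h1⟩ := hΨ α
  refine ⟨C * c, N, by positivity, fun s hs => (h1 s (hΩ hs)).trans ?_⟩
  calc _ ≤ C * (1 + ‖s‖) ^ N * (c * ω' s) := by
        gcongr
        exact h s hs
    _ = _ := by ring

/-- Growth of a product of two shifted reciprocal Gamma functions in opposite directions. -/
theorem coeffGrowth_rGammaTaylor {ℓ ℓ' : MvPowerSeries σ ℂ} (hℓ : PowerSeries.HasSubst ℓ)
    (hℓ' : PowerSeries.HasSubst ℓ') (p q : ℂ) :
    CoeffGrowth Set.univ (fun s => Real.exp (Real.pi * |s.im|)) fun s =>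
      (rGammaTaylor (p + 1 * s)).subst ℓ * (rGammaTaylor (q + (-1) * s)).subst ℓ' := by
  classical
  intro α
  simp only [MvPowerSeries.coeff_mul]
  refine exists_bound_sum _ (fun s => (Real.exp_pos _).le) fun x _ => ?_
  obtain ⟨M, -, hM⟩ := exists_coeff_subst_eq_sum hℓ x.1
  obtain ⟨M', -, hM'⟩ := exists_coeff_subst_eq_sum hℓ' x.2
  simp only [hM, hM', Finset.sum_mul_sum]
  refine exists_bound_sum _ (fun s => (Real.exp_pos _).le) fun r _ => ?_
  refine exists_bound_sum _ (fun s => (Real.exp_pos _).le) fun r' _ => ?_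
  obtain ⟨C, N, hC, h⟩ := pairBound_iteratedDeriv_inv_Gamma r r' ‖p + q‖
  set B := ‖MvPowerSeries.coeff x.1 (ℓ ^ r)‖ * ‖MvPowerSeries.coeff x.2 (ℓ' ^ r')‖ with hB
  refine ⟨B * (C * (1 + ‖p‖) ^ N * Real.exp (Real.pi * |p.im|)), N, by positivity,
    fun s _ => ?_⟩
  have h1 := h (p + s) (q - s) (by rw [add_add_sub_cancel])
  have hf : ∀ k : ℕ, (1 : ℝ) ≤ k.factorial := fun k => by exact_mod_cast Nat.factorial_pos k
  rw [one_mul, neg_one_mul, ← sub_eq_add_neg]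
  simp only [rGammaTaylor, PowerSeries.coeff_mk, smul_eq_mul, norm_mul, norm_div,
    RCLike.norm_natCast]
  rw [norm_mul] at h1
  have h2 : 1 + ‖p + s‖ ≤ (1 + ‖p‖) * (1 + ‖s‖) := by
    nlinarith [norm_add_le p s, norm_nonneg p, norm_nonneg s]
  have h3 : |(p + s).im| ≤ |p.im| + |s.im| := by
    rw [Complex.add_im]
    exact abs_add_le _ _
  calc _ ≤ (‖iteratedDeriv r (fun u => (Complex.Gamma u)⁻¹) (p + s)‖ *
        ‖MvPowerSeries.coeff x.1 (ℓ ^ r)‖) *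
        (‖iteratedDeriv r' (fun u => (Complex.Gamma u)⁻¹) (q - s)‖ *
          ‖MvPowerSeries.coeff x.2 (ℓ' ^ r')‖) := by
        gcongr
        · exact div_le_self (norm_nonneg _) (hf r)
        · exact div_le_self (norm_nonneg _) (hf r')
    _ = B * (‖iteratedDeriv r (fun u => (Complex.Gamma u)⁻¹) (p + s)‖ *
        ‖iteratedDeriv r' (fun u => (Complex.Gamma u)⁻¹) (q - s)‖) := by
        rw [hB]; ring
    _ ≤ B * (C * ((1 + ‖p‖) * (1 + ‖s‖)) ^ N *
        (Real.exp (Real.pi * |p.im|) * Real.exp (Real.pi * |s.im|))) := by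
        rw [← Real.exp_add, ← mul_add]
        refine mul_le_mul_of_nonneg_left (h1.trans ?_) (by positivity)
        gcongr
    _ = _ := by rw [mul_pow]; ring

end Families

/-! ### Specialization of the variable `y` -/

section SetY

variable {n : ℕ} {R : Type*} [CommRing R]

/-- The images of the variables under the substitution of `c` for `y`. -/
def setYVar (c : HFree n R) : Option (BaseVar n) → HFree n R
  | none => c
  | some i => MvPowerSeries.X (some i)

theorem setYVar_hasSubst {c : HFree n R} (hc : MvPowerSeries.constantCoeff c = 0) :
    MvPowerSeries.HasSubst (setYVar c) := by
  apply MvPowerSeries.hasSubst_of_constantCoeff_zero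
  rintro (_ | i)
  · exact hc
  · simp [setYVar]

/-- The substitution of `c` for `y`. -/
def setY {c : HFree n R} (hc : MvPowerSeries.constantCoeff c = 0) : HFree n R →ₐ[R] HFree n R :=
  MvPowerSeries.substAlgHom (setYVar_hasSubst hc)

variable {c : HFree n R} (hc : MvPowerSeries.constantCoeff c = 0)

theorem setY_y : setY hc (yF n R) = c :=
  MvPowerSeries.substAlgHom_X (R := R) (setYVar_hasSubst hc) none

theorem setY_x (j : Fin n) : setY hc (xF n R j) = xF n R j :=
  MvPowerSeries.substAlgHom_X (R := R) (setYVar_hasSubst hc) (some (Sum.inl j))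

theorem setY_z (i : Fin n) : setY hc (zF n R i) = zF n R i :=
  MvPowerSeries.substAlgHom_X (R := R) (setYVar_hasSubst hc) (some (Sum.inr i))

theorem setY_weight_plus (j : Fin n) : setY hc (weight R .plus j) = -xF n R j - c := by
  simp [weight, setY_x, setY_y]

theorem setY_weight_minus (i : Fin n) : setY hc (weight R .minus i) = zF n R i + c := by
  simp [weight, setY_z, setY_y]

/-- A substitution for `y` does nothing to a series in which `y` was replaced before. -/
theorem setY_setY {c' : HFree n R} (hc' : MvPowerSeries.constantCoeff c' = 0)
    (h : setY hc c' = c') (f : HFree n R) : setY hc (setY hc' f) = setY hc' f := by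
  have := MvPowerSeries.substAlgHom_comp_substAlgHom_apply (R := R) (S := R) (T := R)
    (setYVar_hasSubst hc') (setYVar_hasSubst hc) f
  refine this.trans ?_
  rw [setY, MvPowerSeries.substAlgHom_apply, MvPowerSeries.substAlgHom_apply]
  congr 1
  funext i
  rcases i with _ | i
  · exact h
  · exact MvPowerSeries.substAlgHom_X (R := R) (setYVar_hasSubst hc) (some i)

variable (n R) in
/-- The substitution of `0` for `y`. -/
def setYZero : HFree n R →ₐ[R] HFree n R := setY (c := 0) (map_zero _)

theorem coeff_setYZero (f : HFree n R) (α : Option (BaseVar n) →₀ ℕ) :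
    MvPowerSeries.coeff α (setYZero n R f) =
      if α none = 0 then MvPowerSeries.coeff α f else 0 := by
  classical
  have hprod : ∀ d : Option (BaseVar n) →₀ ℕ,
      (d.prod fun i e => setYVar (0 : HFree n R) i ^ e) =
        if d none = 0 then MvPowerSeries.monomial d 1 else 0 := by
    intro d
    split_ifs with h
    · rw [MvPowerSeries.monomial_one_eq]
      refine Finset.prod_congr rfl fun i hi => ?_
      rcases i with _ | i
      · exact absurd h (Finsupp.mem_support_iff.1 hi)
      · rfl
    · refine Finset.prod_eq_zero (i := none) (Finsupp.mem_support_iff.2 h) ?_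
      exact zero_pow h
  rw [setYZero, setY, MvPowerSeries.substAlgHom_apply,
    MvPowerSeries.coeff_subst (setYVar_hasSubst (map_zero _)), finsum_eq_single _ α]
  · rw [hprod]
    split_ifs <;> simp
  · intro d hd
    rw [hprod]
    split_ifs
    · rw [MvPowerSeries.coeff_monomial, if_neg hd.symm, smul_zero]
    · simp

theorem pderiv_setYZero (f : HFree n R) :
    MvPowerSeries.pderiv R none (setYZero n R f) = 0 := by
  ext α
  rw [MvPowerSeries.coeff_pderiv, coeff_setYZero, if_neg, zero_mul, map_zero]
  simp

theorem setY_setYZero (f : HFree n R) : setY hc (setYZero n R f) = setYZero n R f :=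
  setY_setY hc _ (map_zero _) f

end SetY

/-! ### The hypergeometric terms as functions of a complex summation index -/

section Terms

variable {n : ℕ}

theorem constantCoeff_weight {R : Type*} [CommRing R] (s : Chamber) (j : Fin n) :
    MvPowerSeries.constantCoeff (weight R s j) = 0 := by
  cases s <;> simp [weight, xF, yF, zF]

theorem constantCoeff_yF {R : Type*} [CommRing R] :
    MvPowerSeries.constantCoeff (yF n R) = 0 := by
  simp [yF]

/-- The product of the reciprocal Gamma functions in the hypergeometric terms, with the summation
index replaced by a complex number `s`. The arguments `ℓ` and `ℓ'` are the Chern roots. -/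
def gammaProd (a b : Fin n → ℤ) (ℓ ℓ' : Fin n → HFree n ℂ) (s : ℂ) : HFree n ℂ :=
  ∏ j, ((rGammaTaylor ((1 + a j) + 1 * s)).subst ((1 / (2 * Real.pi * Complex.I) : ℂ) • ℓ j) *
    (rGammaTaylor ((1 - b j) + (-1) * s)).subst ((1 / (2 * Real.pi * Complex.I) : ℂ) • ℓ' j))

/-- The hypergeometric term, as a function of the logarithm `w` of the Kähler parameter and of the
complexified summation index `s`. -/
def hyperTerm (a b : Fin n → ℤ) (w s : ℂ) : HFree n ℂ :=
  Complex.exp (s * w) • expS ((-w / (2 * Real.pi * Complex.I)) • yF n ℂ) *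
    gammaProd a b (weight ℂ .plus) (weight ℂ .minus) s

/-- The product of Gamma factors at `y = 0`. -/
def gammaBase (a b : Fin n → ℤ) (s : ℂ) : HFree n ℂ :=
  gammaProd a b (fun j => -xF n ℂ j) (zF n ℂ) s

theorem setY_gammaProd {c : HFree n ℂ} (hc : MvPowerSeries.constantCoeff c = 0)
    (a b : Fin n → ℤ) {ℓ ℓ' : Fin n → HFree n ℂ} (hℓ : ∀ j, MvPowerSeries.constantCoeff (ℓ j) = 0)
    (hℓ' : ∀ j, MvPowerSeries.constantCoeff (ℓ' j) = 0) (s : ℂ) :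
    setY hc (gammaProd a b ℓ ℓ' s) =
      gammaProd a b (fun j => setY hc (ℓ j)) (fun j => setY hc (ℓ' j)) s := by
  rw [gammaProd, map_prod]
  refine Finset.prod_congr rfl fun j _ => ?_
  rw [map_mul, setY, algHom_subst _ (hasSubst_smul (hℓ j) _),
    algHom_subst _ (hasSubst_smul (hℓ' j) _), algHom_csmul, algHom_csmul]

theorem setYZero_gammaProd (a b : Fin n → ℤ) (s : ℂ) :
    setYZero n ℂ (gammaProd a b (weight ℂ .plus) (weight ℂ .minus) s) = gammaBase a b s := by
  rw [setYZero, setY_gammaProd _ _ _ (constantCoeff_weight _) (constantCoeff_weight _), gammaBase]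
  simp [setY_weight_plus, setY_weight_minus]

theorem setYZero_hyperTerm (a b : Fin n → ℤ) (w s : ℂ) :
    setYZero n ℂ (hyperTerm a b w s) = Complex.exp (s * w) • gammaBase a b s := by
  rw [hyperTerm, map_mul, setYZero_gammaProd, map_smul, expS]
  have : setYZero n ℂ ((PowerSeries.exp ℂ).subst
      ((-w / (2 * Real.pi * Complex.I)) • yF n ℂ)) = 1 := by
    rw [setYZero, setY, algHom_subst _ (hasSubst_smul constantCoeff_yF _), algHom_csmul]
    change expS (_ • setY (c := 0) (map_zero _) (yF n ℂ)) = 1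
    rw [setY_y, smul_zero, expS_zero]
  rw [this, smul_mul_assoc, one_mul]

/-! ### Hypergeometric terms with coefficients in the cohomology of the base -/

variable {A : Type*} [CommRing A] [Algebra ℂ A]

theorem map_expS {σ : Type*} {f : MvPowerSeries σ ℂ} (hf : MvPowerSeries.constantCoeff f = 0) :
    MvPowerSeries.map (algebraMap ℂ A) (expS f) =
      expS (MvPowerSeries.map (algebraMap ℂ A) f) :=
  map_subst_complex (PowerSeries.HasSubst.of_constantCoeff_zero hf) _

theorem map_weight (s : Chamber) (j : Fin n) :
    MvPowerSeries.map (algebraMap ℂ A) (weight ℂ s j) = weight A s j := by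
  cases s <;> simp [weight, xF, yF, zF]

theorem map_gammaProd (a b : Fin n → ℤ) (m : ℤ) :
    MvPowerSeries.map (algebraMap ℂ A) (gammaProd a b (weight ℂ .plus) (weight ℂ .minus) m) =
      ∏ j, (rGammaAt A (a j + m) (weight A .plus j) *
        rGammaAt A (-b j - m) (weight A .minus j)) := by
  rw [gammaProd, map_prod]
  refine Finset.prod_congr rfl fun j _ => ?_
  rw [map_mul, map_subst_complex (hasSubst_smul (constantCoeff_weight _ j) _),
    map_subst_complex (hasSubst_smul (constantCoeff_weight _ j) _), map_csmul, map_csmul,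
    map_weight, map_weight, rGammaAt, rGammaAt, rGamma_eq_rGammaTaylor, rGamma_eq_rGammaTaylor]
  have e1 : ((1 : ℂ) + a j + 1 * m) = 1 + ((a j + m : ℤ) : ℂ) := by push_cast; ring
  have e2 : ((1 : ℂ) - b j + -1 * m) = 1 + ((-b j - m : ℤ) : ℂ) := by push_cast; ring
  rw [e1, e2]

theorem map_hyperTerm (a b : Fin n → ℤ) (w : ℂ) (m : ℤ) :
    MvPowerSeries.map (algebraMap ℂ A) (hyperTerm a b w m) =
      Complex.exp (m * w) • expS ((-w / (2 * Real.pi * Complex.I)) • yF n A) *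
        ∏ j, (rGammaAt A (a j + m) (weight A .plus j) *
          rGammaAt A (-b j - m) (weight A .minus j)) := by
  rw [hyperTerm, map_mul, map_gammaProd, map_csmul, map_expS, map_csmul]
  · simp [yF]
  · rw [constantCoeff_csmul, constantCoeff_yF, smul_zero]

theorem plusTerm_eq (a b : Fin n → ℤ) (w : ℂ) (m : ℤ) :
    plusTerm A a b w m =
      Ideal.Quotient.mk _ (MvPowerSeries.map (algebraMap ℂ A) (hyperTerm a b w m)) := by
  rw [map_hyperTerm]
  rfl

theorem minusTerm_neg_eq (a b : Fin n → ℤ) (w : ℂ) (m : ℤ) :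
    minusTerm A a b (-w) (-m) =
      Ideal.Quotient.mk _ (MvPowerSeries.map (algebraMap ℂ A) (hyperTerm a b w m)) := by
  rw [map_hyperTerm, minusTerm]
  simp only [sub_neg_eq_add, ← sub_eq_add_neg, Int.cast_neg, neg_mul_neg]
  rfl

/-! ### Differentiability and growth of the hypergeometric terms -/

theorem pderiv_csmul {σ : Type*} (i : σ) (c : ℂ) (f : MvPowerSeries σ ℂ) :
    MvPowerSeries.pderiv ℂ i (c • f) = c • MvPowerSeries.pderiv ℂ i f :=
  Derivation.map_smul _ _ _

theorem pderiv_linear_plus (j : Fin n) :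
    MvPowerSeries.pderiv ℂ none ((1 / (2 * Real.pi * Complex.I) : ℂ) • weight ℂ .plus j) =
      MvPowerSeries.C (-(1 / (2 * Real.pi * Complex.I))) := by
  classical
  rw [pderiv_csmul, weight, map_sub, map_neg, xF, yF, MvPowerSeries.pderiv_X_of_ne (by simp),
    MvPowerSeries.pderiv_X_self, MvPowerSeries.smul_eq_C_mul, map_neg]
  ring

theorem pderiv_linear_minus (j : Fin n) :
    MvPowerSeries.pderiv ℂ none ((1 / (2 * Real.pi * Complex.I) : ℂ) • weight ℂ .minus j) =
      MvPowerSeries.C (1 / (2 * Real.pi * Complex.I)) := by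
  classical
  rw [pderiv_csmul, weight, map_add, zF, yF, MvPowerSeries.pderiv_X_of_ne (by simp),
    MvPowerSeries.pderiv_X_self, MvPowerSeries.smul_eq_C_mul]
  ring

theorem isTransportedAt_rGammaTaylor {σ : Type*} {i : σ} {ℓ : MvPowerSeries σ ℂ}
    (hℓ : PowerSeries.HasSubst ℓ) {d : ℂ} (hd : MvPowerSeries.pderiv ℂ i ℓ = MvPowerSeries.C d)
    {c ε : ℂ} (hε : c * d = ε) (p s : ℂ) :
    IsTransportedAt c i (fun u => (rGammaTaylor (p + ε * u)).subst ℓ) s := by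
  refine (hasCoeffDerivAt_rGammaTaylor hℓ p ε s).congr ?_
  rw [pderiv_subst hℓ hd, smul_smul, hε]

/-- The hypergeometric term is a function of `s - y / 2πi`. -/
theorem isTransportedAt_hyperTerm (a b : Fin n → ℤ) (w s : ℂ) :
    IsTransportedAt (-(2 * Real.pi * Complex.I)) none (hyperTerm a b w) s := by
  refine IsTransportedAt.mul ?_ (IsTransportedAt.prod _ fun j _ => IsTransportedAt.mul ?_ ?_)
  · have h := HasCoeffDerivAt.smul (f := fun u => Complex.exp (u * w))
      (((hasDerivAt_id s).mul_const w).cexp)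
      (hasCoeffDerivAt_const (expS ((-w / (2 * Real.pi * Complex.I)) • yF n ℂ)) s)
    refine h.congr ?_
    have e : MvPowerSeries.pderiv ℂ none (expS ((-w / (2 * Real.pi * Complex.I)) • yF n ℂ)) =
        (-w / (2 * Real.pi * Complex.I)) • expS ((-w / (2 * Real.pi * Complex.I)) • yF n ℂ) := by
      rw [expS, pderiv_subst (hasSubst_smul constantCoeff_yF _)
        (c := -w / (2 * Real.pi * Complex.I)), PowerSeries.derivative_exp]
      rw [pderiv_csmul, yF, MvPowerSeries.pderiv_X_self, MvPowerSeries.smul_eq_C_mul, mul_one]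
    rw [pderiv_csmul, e, smul_smul, smul_smul, smul_zero, add_zero]
    congr 1
    have := Complex.two_pi_I_ne_zero
    simp only [id]
    field_simp
  · refine isTransportedAt_rGammaTaylor (hasSubst_smul (constantCoeff_weight _ j) _)
      (pderiv_linear_plus j) ?_ _ _
    rw [neg_mul_neg, mul_one_div_cancel Complex.two_pi_I_ne_zero]
  · refine isTransportedAt_rGammaTaylor (hasSubst_smul (constantCoeff_weight _ j) _)
      (pderiv_linear_minus j) ?_ _ _
    rw [neg_mul, mul_one_div_cancel Complex.two_pi_I_ne_zero]

theorem coeffDifferentiableAt_gammaProd (a b : Fin n → ℤ) {ℓ ℓ' : Fin n → HFree n ℂ}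
    (hℓ : ∀ j, MvPowerSeries.constantCoeff (ℓ j) = 0)
    (hℓ' : ∀ j, MvPowerSeries.constantCoeff (ℓ' j) = 0) (s : ℂ) :
    CoeffDifferentiableAt (gammaProd a b ℓ ℓ') s :=
  CoeffDifferentiableAt.prod _ fun j _ => CoeffDifferentiableAt.mul
    (hasCoeffDerivAt_rGammaTaylor (hasSubst_smul (hℓ j) _) _ _ _).differentiableAt
    (hasCoeffDerivAt_rGammaTaylor (hasSubst_smul (hℓ' j) _) _ _ _).differentiableAt

theorem coeffGrowth_gammaProd (a b : Fin n → ℤ) {ℓ ℓ' : Fin n → HFree n ℂ}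
    (hℓ : ∀ j, MvPowerSeries.constantCoeff (ℓ j) = 0)
    (hℓ' : ∀ j, MvPowerSeries.constantCoeff (ℓ' j) = 0) :
    CoeffGrowth Set.univ (fun s => Real.exp (n * (Real.pi * |s.im|))) (gammaProd a b ℓ ℓ') := by
  have h := CoeffGrowth.prod (Ω := Set.univ) Finset.univ
    (ω := fun (_ : Fin n) s => Real.exp (Real.pi * |s.im|)) (fun _ s => (Real.exp_pos _).le)
    fun j _ => coeffGrowth_rGammaTaylor (hasSubst_smul (hℓ j) (1 / (2 * Real.pi * Complex.I)))
      (hasSubst_smul (hℓ' j) (1 / (2 * Real.pi * Complex.I))) (1 + a j) (1 - b j)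
  refine h.mono subset_rfl zero_le_one fun s _ => le_of_eq ?_
  rw [Finset.prod_const, Finset.card_univ, Fintype.card_fin, ← Real.exp_nat_mul, one_mul]

theorem constantCoeff_neg_xF (j : Fin n) :
    MvPowerSeries.constantCoeff (-xF n ℂ j) = 0 := by
  simp [xF]

theorem constantCoeff_zF {R : Type*} [CommRing R] (j : Fin n) :
    MvPowerSeries.constantCoeff (zF n R j) = 0 := by
  simp [zF]

theorem differentiable_coeff_expS_smul {σ : Type*} {ℓ : MvPowerSeries σ ℂ}
    (hℓ : MvPowerSeries.constantCoeff ℓ = 0) (α : σ →₀ ℕ) {f : ℂ → ℂ} (hf : Differentiable ℂ f) :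
    Differentiable ℂ fun w => MvPowerSeries.coeff α (expS (f w • ℓ)) := by
  obtain ⟨D, -, h⟩ := exists_coeff_subst_eq_sum (PowerSeries.HasSubst.of_constantCoeff_zero hℓ) α
  simp only [expS, ← subst_rescale hℓ, h, PowerSeries.coeff_rescale, smul_eq_mul]
  fun_prop

theorem isLaurentLike_coeff_hyperTerm (a b : Fin n → ℤ) (α : Option (BaseVar n) →₀ ℕ) :
    IsLaurentLike fun m w => MvPowerSeries.coeff α (hyperTerm a b w m) := by
  classical
  have hE : ∀ p, Differentiable ℂ fun w : ℂ => MvPowerSeries.coeff p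
      (expS ((-w / (2 * Real.pi * Complex.I)) • yF n ℂ)) := fun p =>
    differentiable_coeff_expS_smul constantCoeff_yF p (by fun_prop)
  have hform : ∀ (m w : ℂ), MvPowerSeries.coeff α (hyperTerm a b w m) =
      ∑ p ∈ Finset.HasAntidiagonal.antidiagonal α, Complex.exp (m * w) * MvPowerSeries.coeff p.1
        (expS ((-w / (2 * Real.pi * Complex.I)) • yF n ℂ)) *
        MvPowerSeries.coeff p.2 (gammaProd a b (weight ℂ .plus) (weight ℂ .minus) m) := by
    intro m w
    rw [hyperTerm, MvPowerSeries.coeff_mul]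
    refine Finset.sum_congr rfl fun p _ => ?_
    rw [coeff_csmul, smul_eq_mul]
  simp only [hform]
  refine ⟨fun m => ?_, fun R => ?_⟩
  · have := hE
    fun_prop
  · choose C N hC h using coeffGrowth_gammaProd a b
      (constantCoeff_weight (R := ℂ) (n := n) .plus) (constantCoeff_weight (R := ℂ) .minus)
    have hB : ∀ p, ∃ B : ℝ, 0 ≤ B ∧ ∀ w : ℂ, ‖w‖ ≤ R → ‖MvPowerSeries.coeff p
        (expS ((-w / (2 * Real.pi * Complex.I)) • yF n ℂ))‖ ≤ B := by
      intro p
      obtain ⟨B, hB⟩ := (isCompact_closedBall (0 : ℂ) R).exists_bound_of_continuousOn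
        (hE p).continuous.continuousOn
      exact ⟨max B 0, le_max_right _ _, fun w hw =>
        (hB w (by simpa using hw)).trans (le_max_left _ _)⟩
    choose B hB0 hB using hB
    refine ⟨∑ p ∈ Finset.HasAntidiagonal.antidiagonal α, B p.1 * C p.2,
      (Finset.HasAntidiagonal.antidiagonal α).sup fun p => N p.2,
      Finset.sum_nonneg fun p _ => mul_nonneg (hB0 _) (hC _), fun w hw m => ?_⟩
    rw [Finset.sum_mul, Finset.sum_mul]
    refine (norm_sum_le _ _).trans (Finset.sum_le_sum fun p hp => ?_)
    have h1 := h p.2 m (Set.mem_univ _)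
    have h2 : N p.2 ≤ (Finset.HasAntidiagonal.antidiagonal α).sup fun p => N p.2 :=
      Finset.le_sup (f := fun p : (Option (BaseVar n) →₀ ℕ) × _ => N p.2) hp
    simp only [Complex.intCast_im, abs_zero, mul_zero, Real.exp_zero, mul_one,
      Complex.norm_intCast] at h1
    rw [norm_mul, norm_mul, Complex.norm_exp]
    have e : ((m : ℂ) * w).re = m * w.re := by simp
    rw [e]
    have h3 : (1 : ℝ) ≤ 1 + |(m : ℝ)| := by linarith [abs_nonneg (m : ℝ)]
    have hC' := hC p.2
    have hB' := hB0 p.1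
    calc _ ≤ Real.exp (m * w.re) * B p.1 * (C p.2 * (1 + |(m : ℝ)|) ^
          ((Finset.HasAntidiagonal.antidiagonal α).sup fun p => N p.2)) := by
          gcongr
          · exact hB _ w hw
          · refine h1.trans ?_
            gcongr
      _ = _ := by ring

end Terms

/-! ### Kernels with poles at the integers -/

section Kernel

variable {σ : Type*}

/-- The power series `1 / (e^{2πis} - ξ)`, for `ξ` with constant term `1` and `s` off the integers,
as a geometric series in `ξ - 1`. -/
def kernelFactor (ξ : MvPowerSeries σ ℂ) (s : ℂ) : MvPowerSeries σ ℂ :=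
  (PowerSeries.mk fun r =>
    (Complex.exp (2 * Real.pi * Complex.I * s) - 1)⁻¹ ^ (r + 1)).subst (ξ - 1)

/-- The power series `2πi e^{2πis} / (e^{2πis} - ξ)`, a deformation of `expKernel`. -/
def shiftedKernel (ξ : MvPowerSeries σ ℂ) (s : ℂ) : MvPowerSeries σ ℂ :=
  (2 * Real.pi * Complex.I * Complex.exp (2 * Real.pi * Complex.I * s)) • kernelFactor ξ s

theorem hasSubst_sub_one {ξ : MvPowerSeries σ ℂ} (hξ : MvPowerSeries.constantCoeff ξ = 1) :
    PowerSeries.HasSubst (ξ - 1) :=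
  PowerSeries.HasSubst.of_constantCoeff_zero (by simp [hξ])

theorem sub_mul_kernelFactor {ξ : MvPowerSeries σ ℂ} (hξ : MvPowerSeries.constantCoeff ξ = 1)
    {s : ℂ} (hs : s ∈ offIntegers) :
    (MvPowerSeries.C (Complex.exp (2 * Real.pi * Complex.I * s)) - ξ) * kernelFactor ξ s = 1 := by
  have h := hasSubst_sub_one hξ
  have hne : Complex.exp (2 * Real.pi * Complex.I * s) - 1 ≠ 0 := sub_ne_zero.2 hs
  unfold kernelFactor
  set t := Complex.exp (2 * Real.pi * Complex.I * s) - 1 with ht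
  have e : (t • (1 : PowerSeries ℂ) - PowerSeries.X) *
      PowerSeries.mk (fun r => t⁻¹ ^ (r + 1)) = 1 := by
    ext r
    rw [sub_mul, smul_mul_assoc, one_mul, map_sub, map_smul, PowerSeries.coeff_mk,
      PowerSeries.coeff_one]
    rcases r with _ | r
    · simp [hne]
    · rw [PowerSeries.coeff_succ_X_mul, PowerSeries.coeff_mk, pow_succ t⁻¹ (r + 1), smul_eq_mul,
        mul_comm (t⁻¹ ^ (r + 1)), mul_inv_cancel_left₀ hne, sub_self, if_neg (by omega)]
  have e2 := congrArg (PowerSeries.subst (ξ - 1)) e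
  rw [PowerSeries.subst_mul h, subst_one' h, PowerSeries.subst_sub h, PowerSeries.subst_smul h,
    subst_one' h, PowerSeries.subst_X h] at e2
  refine Eq.trans ?_ e2
  congr 1
  have : MvPowerSeries.C (Complex.exp (2 * Real.pi * Complex.I * s)) =
      t • (1 : MvPowerSeries σ ℂ) + 1 := by
    rw [MvPowerSeries.smul_eq_C_mul, mul_one, ht, map_sub, map_one, sub_add_cancel]
  rw [this]
  ring

theorem coeffDifferentiableAt_kernelFactor {ξ : MvPowerSeries σ ℂ}
    (hξ : MvPowerSeries.constantCoeff ξ = 1) {s : ℂ} (hs : s ∈ offIntegers) :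
    CoeffDifferentiableAt (kernelFactor ξ) s := by
  intro α
  obtain ⟨D, -, h⟩ := exists_coeff_subst_eq_sum (hasSubst_sub_one hξ) α
  simp only [kernelFactor, h, PowerSeries.coeff_mk, smul_eq_mul]
  have hne : Complex.exp (2 * Real.pi * Complex.I * s) - 1 ≠ 0 := sub_ne_zero.2 hs
  have h1 : DifferentiableAt ℂ (fun s => (Complex.exp (2 * Real.pi * Complex.I * s) - 1)⁻¹) s :=
    ((hasDerivAt_exp_two_pi_I s).differentiableAt.sub_const 1).inv hne
  fun_prop

theorem coeffGrowth_kernelFactor {ξ : MvPowerSeries σ ℂ}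
    (hξ : MvPowerSeries.constantCoeff ξ = 1) :
    CoeffGrowth contourRegion (fun s => (1 + Real.exp (-(2 * Real.pi * s.im)))⁻¹)
      (kernelFactor ξ) := by
  intro α
  obtain ⟨D, -, h⟩ := exists_coeff_subst_eq_sum (hasSubst_sub_one hξ) α
  simp only [kernelFactor, h, PowerSeries.coeff_mk, smul_eq_mul]
  refine exists_bound_sum _ (fun s => by positivity) fun r _ => ?_
  refine ⟨2 ^ (r + 1) * ‖MvPowerSeries.coeff α ((ξ - 1) ^ r)‖, 0, by positivity, fun s hs => ?_⟩
  have h1 := le_norm_exp_sub_one hs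
  rw [norm_exp_two_pi_I_mul] at h1
  set q := Real.exp (-(2 * Real.pi * s.im)) with hq
  have hq0 : 0 < q := Real.exp_pos _
  have h2 : ‖(Complex.exp (2 * Real.pi * Complex.I * s) - 1)⁻¹‖ ≤ 2 * (1 + q)⁻¹ := by
    rw [norm_inv]
    refine (inv_anti₀ (by positivity) h1).trans (le_of_eq ?_)
    rw [inv_div, div_eq_mul_inv]
  have h3 : (1 + q)⁻¹ ≤ 1 := inv_le_one_of_one_le₀ (by linarith)
  have h4 : (0 : ℝ) ≤ (1 + q)⁻¹ := by positivity
  rw [norm_mul, norm_pow, pow_zero, mul_one]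
  calc _ ≤ (2 * (1 + q)⁻¹) ^ (r + 1) * ‖MvPowerSeries.coeff α ((ξ - 1) ^ r)‖ := by gcongr
    _ = 2 ^ (r + 1) * ‖MvPowerSeries.coeff α ((ξ - 1) ^ r)‖ * ((1 + q)⁻¹ ^ r * (1 + q)⁻¹) := by
        rw [mul_pow]; ring
    _ ≤ _ := by
        refine mul_le_mul_of_nonneg_left ?_ (by positivity)
        exact mul_le_of_le_one_left h4 (pow_le_one₀ h4 h3)

theorem coeffDifferentiableAt_shiftedKernel {ξ : MvPowerSeries σ ℂ}
    (hξ : MvPowerSeries.constantCoeff ξ = 1) {s : ℂ} (hs : s ∈ offIntegers) :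
    CoeffDifferentiableAt (shiftedKernel ξ) s :=
  (HasCoeffDerivAt.smul ((hasDerivAt_exp_two_pi_I s).const_mul _)
    (coeffDifferentiableAt_kernelFactor hξ hs).hasCoeffDerivAt).differentiableAt

theorem coeffGrowth_shiftedKernel {ξ : MvPowerSeries σ ℂ}
    (hξ : MvPowerSeries.constantCoeff ξ = 1) :
    CoeffGrowth contourRegion (fun s => Real.exp (-(2 * Real.pi * s.im)) *
      (1 + Real.exp (-(2 * Real.pi * s.im)))⁻¹) (shiftedKernel ξ) := by
  intro α
  obtain ⟨C, N, hC, h⟩ := coeffGrowth_kernelFactor hξ α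
  refine ⟨2 * Real.pi * C, N, by positivity, fun s hs => ?_⟩
  rw [shiftedKernel, coeff_csmul, smul_eq_mul, norm_mul, norm_mul, norm_exp_two_pi_I_mul]
  have : ‖(2 * Real.pi * Complex.I : ℂ)‖ = 2 * Real.pi := by
    simp [abs_of_pos Real.pi_pos]
  rw [this]
  have h1 := mul_le_mul_of_nonneg_left (h s hs)
    (show 0 ≤ 2 * Real.pi * Real.exp (-(2 * Real.pi * s.im)) by positivity)
  refine h1.trans (le_of_eq ?_)
  ring

theorem CoeffDifferentiableAt.continuousOn {Ψ : ℂ → MvPowerSeries σ ℂ}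
    (h : ∀ s ∈ offIntegers, CoeffDifferentiableAt Ψ s) (α : σ →₀ ℕ) :
    ContinuousOn (fun s => MvPowerSeries.coeff α (Ψ s)) contourRegion := fun s hs =>
  (h s (contourRegion_subset hs) α).continuousAt.continuousWithinAt

/-- If `∂ξ = -ξ`, then the kernel is a function of `s + Xᵢ / 2πi`. -/
theorem isTransportedAt_shiftedKernel {ξ : MvPowerSeries σ ℂ}
    (hξ : MvPowerSeries.constantCoeff ξ = 1) {i : σ} (hd : MvPowerSeries.pderiv ℂ i ξ = -ξ)
    {s : ℂ} (hs : s ∈ offIntegers) :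
    IsTransportedAt (2 * Real.pi * Complex.I) i (shiftedKernel ξ) s := by
  have hk := (coeffDifferentiableAt_kernelFactor hξ hs).hasCoeffDerivAt
  set K' : MvPowerSeries σ ℂ := fun α => deriv (fun u => MvPowerSeries.coeff α (kernelFactor ξ u)) s
  have he := hasDerivAt_exp_two_pi_I s
  have h1 := sub_mul_kernelFactor hξ hs
  have h2 : HasCoeffDerivAt (fun u => (MvPowerSeries.C (Complex.exp (2 * Real.pi * Complex.I * u)) -
      ξ) * kernelFactor ξ u) 0 s := by
    intro α
    have : (fun u => MvPowerSeries.coeff α ((MvPowerSeries.C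
        (Complex.exp (2 * Real.pi * Complex.I * u)) - ξ) * kernelFactor ξ u)) =ᶠ[𝓝 s]
        fun _ => MvPowerSeries.coeff α 1 :=
      Filter.eventually_of_mem (isOpen_offIntegers.mem_nhds hs)
        fun u hu => by simp only [sub_mul_kernelFactor hξ hu]
    rw [map_zero]
    exact (hasDerivAt_const s _).congr_of_eventuallyEq this
  have h3 := (((HasCoeffDerivAt.C he).sub (hasCoeffDerivAt_const ξ s)).mul hk).unique h2
  have h4 := congrArg (MvPowerSeries.pderiv ℂ i) h1
  rw [Derivation.leibniz, map_sub, hd, MvPowerSeries.pderiv_C, MvPowerSeries.pderiv_one,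
    smul_eq_mul, smul_eq_mul] at h4
  have h5 := HasCoeffDerivAt.smul (he.const_mul (2 * Real.pi * Complex.I)) hk
  refine HasCoeffDerivAt.congr h5 ?_
  rw [shiftedKernel, pderiv_csmul]
  set k := kernelFactor ξ s
  set v := Complex.exp (2 * Real.pi * Complex.I * s)
  set P : ℂ := 2 * Real.pi * Complex.I
  simp only [MvPowerSeries.smul_eq_C_mul, map_mul, sub_zero] at h3 ⊢
  have e1 : K' = -(MvPowerSeries.C P * MvPowerSeries.C v * k * k) := by
    linear_combination (-K') * h1 + k * h3
  have e2 : MvPowerSeries.pderiv ℂ i k = -(ξ * k * k) := by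
    linear_combination (-MvPowerSeries.pderiv ℂ i k) * h1 + k * h4
  rw [e1, e2]
  linear_combination (-MvPowerSeries.C P * MvPowerSeries.C P * MvPowerSeries.C v * k) * h1

theorem kernelFactor_one (s : ℂ) : kernelFactor (1 : MvPowerSeries σ ℂ) s =
    MvPowerSeries.C (Complex.exp (2 * Real.pi * Complex.I * s) - 1)⁻¹ := by
  rw [kernelFactor, sub_self, PowerSeries.subst_zero_eq_C_constantCoeff,
    ← PowerSeries.coeff_zero_eq_constantCoeff_apply, PowerSeries.coeff_mk]
  simp

theorem shiftedKernel_one (s : ℂ) : shiftedKernel (1 : MvPowerSeries σ ℂ) s =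
    MvPowerSeries.C (expKernel s) := by
  rw [shiftedKernel, kernelFactor_one, MvPowerSeries.smul_eq_C_mul, ← map_mul, expKernel]

variable {n : ℕ}

theorem setY_expS {c f : HFree n ℂ} (hc : MvPowerSeries.constantCoeff c = 0)
    (hf : MvPowerSeries.constantCoeff f = 0) : setY hc (expS f) = expS (setY hc f) :=
  algHom_subst _ (PowerSeries.HasSubst.of_constantCoeff_zero hf) _

theorem setY_shiftedKernel {c ξ : HFree n ℂ} (hc : MvPowerSeries.constantCoeff c = 0)
    (hξ : MvPowerSeries.constantCoeff ξ = 1) (s : ℂ) :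
    setY hc (shiftedKernel ξ s) = shiftedKernel (setY hc ξ) s := by
  rw [shiftedKernel, shiftedKernel, map_smul, kernelFactor, kernelFactor, setY,
    algHom_subst _ (hasSubst_sub_one hξ), map_sub, map_one]

variable (n) in
/-- The class `η = e^{-y}`. -/
def eta : HFree n ℂ := expS (-yF n ℂ)

variable (n) in
/-- The classes `ζ_i = e^{z_i}`. -/
def zeta (i : Fin n) : HFree n ℂ := expS (zF n ℂ i)

theorem constantCoeff_neg_yF : MvPowerSeries.constantCoeff (-yF n ℂ) = 0 := by
  simp [yF]

theorem constantCoeff_neg_zF (i : Fin n) : MvPowerSeries.constantCoeff (-zF n ℂ i) = 0 := by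
  simp [zF]

theorem constantCoeff_eta : MvPowerSeries.constantCoeff (eta n) = 1 :=
  constantCoeff_expS constantCoeff_neg_yF

theorem constantCoeff_zeta (i : Fin n) : MvPowerSeries.constantCoeff (zeta n i) = 1 :=
  constantCoeff_expS (constantCoeff_zF i)

theorem pderiv_eta : MvPowerSeries.pderiv ℂ none (eta n) = -eta n := by
  have h : MvPowerSeries.pderiv ℂ none (-yF n ℂ) = MvPowerSeries.C (-1) := by
    rw [map_neg, yF, MvPowerSeries.pderiv_X_self, map_neg, map_one]
  rw [eta, expS, pderiv_subst (PowerSeries.HasSubst.of_constantCoeff_zero constantCoeff_neg_yF) h,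
    PowerSeries.derivative_exp, neg_one_smul]

theorem setY_eta (k : Fin n) : setY (constantCoeff_neg_zF k) (eta n) = zeta n k := by
  rw [eta, setY_expS _ constantCoeff_neg_yF, map_neg, setY_y, neg_neg, zeta]

theorem setYZero_eta : setYZero n ℂ (eta n) = 1 := by
  rw [eta, setYZero, setY_expS _ constantCoeff_neg_yF, map_neg, setY_y, neg_zero, expS_zero]

theorem IsTransportedAt.pderiv {c : ℂ} {i : σ} {Ψ : ℂ → MvPowerSeries σ ℂ} {s : ℂ}
    (h : IsTransportedAt c i Ψ s) :
    IsTransportedAt c i (fun u => c • MvPowerSeries.pderiv ℂ i (Ψ u)) s := by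
  intro α
  simp only [coeff_csmul, MvPowerSeries.coeff_pderiv, smul_eq_mul]
  refine (((h (α + Finsupp.single i 1)).mul_const ((α i : ℂ) + 1)).const_mul c).congr_deriv ?_
  simp only [coeff_csmul, MvPowerSeries.coeff_pderiv, smul_eq_mul]

/-- The residue at `m` of `P|_{y = 0} κ`, where `P` is a function of `s - y / 2πi` and `κ` is the
kernel with pole where `e^{2πis + y} = 1`, is `P(m)`. For the dependence on `y`, the derivative
with respect to `y` of the kernel is turned into one with respect to `s`, and integration by parts
moves it to the other factor. -/
theorem rectInt_coeff_mul_shiftedKernel (m : ℤ) (r : ℕ) :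
    ∀ (P : ℂ → HFree n ℂ), (∀ s, IsTransportedAt (-(2 * Real.pi * Complex.I)) none P s) →
      ∀ α : Option (BaseVar n) →₀ ℕ, α none = r →
      rectInt (fun s => MvPowerSeries.coeff α (setYZero n ℂ (P s) * shiftedKernel (eta n) s)) m =
        MvPowerSeries.coeff α (P m) := by
  have hκd : ∀ s ∈ offIntegers, CoeffDifferentiableAt (shiftedKernel (eta n)) s := fun s hs =>
    coeffDifferentiableAt_shiftedKernel constantCoeff_eta hs
  have hκt : ∀ s ∈ offIntegers, IsTransportedAt (2 * Real.pi * Complex.I) none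
      (shiftedKernel (eta n)) s := fun s hs =>
    isTransportedAt_shiftedKernel constantCoeff_eta pderiv_eta hs
  induction r with
  | zero =>
    intro P hP α hα
    have e : ∀ s, MvPowerSeries.coeff α (setYZero n ℂ (P s) * shiftedKernel (eta n) s) =
        MvPowerSeries.coeff α (P s) * expKernel s := by
      intro s
      have h1 := coeff_setYZero (setYZero n ℂ (P s) * shiftedKernel (eta n) s) α
      rw [if_pos hα] at h1
      have h2 : setYZero n ℂ (shiftedKernel (eta n) s) = MvPowerSeries.C (expKernel s) := by
        rw [← shiftedKernel_one, ← setYZero_eta]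
        exact setY_shiftedKernel _ constantCoeff_eta s
      rw [← h1, map_mul, h2, mul_comm, MvPowerSeries.coeff_C_mul]
      have h3 : setYZero n ℂ (setYZero n ℂ (P s)) = setYZero n ℂ (P s) := setY_setYZero _ _
      rw [h3, coeff_setYZero, if_pos hα, mul_comm]
    simp only [e]
    exact rectInt_mul_expKernel (fun s => ((hP s) α).differentiableAt) m
  | succ r ih =>
    intro P hP α hα
    classical
    obtain ⟨β, rfl⟩ : ∃ β, α = β + Finsupp.single none 1 := by
      refine ⟨α - Finsupp.single none 1, (tsub_add_cancel_of_le ?_).symm⟩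
      rw [Finsupp.single_le_iff]
      omega
    have hβ : β none = r := by simpa using hα
    have hP' := ih _ (fun s => (hP s).pderiv) β hβ
    set c : ℂ := 2 * Real.pi * Complex.I with hc
    have hc0 : c ≠ 0 := Complex.two_pi_I_ne_zero
    -- the derivative of `P|_{y = 0}`
    have hF : ∀ s, HasCoeffDerivAt (fun u => setYZero n ℂ (P u))
        (setYZero n ℂ ((-c) • MvPowerSeries.pderiv ℂ none (P s))) s := by
      intro s α
      simp only [coeff_setYZero]
      split_ifs
      · exact hP s α
      · exact hasDerivAt_const _ _
    have hr : ((r : ℂ) + 1) ≠ 0 := by exact_mod_cast r.succ_ne_zero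
    -- `P|_{y = 0}` does not involve `y`, so that only the kernel is differentiated.
    have e1 : ∀ s, MvPowerSeries.coeff (β + Finsupp.single none 1)
        (setYZero n ℂ (P s) * shiftedKernel (eta n) s) = ((r : ℂ) + 1)⁻¹ * c⁻¹ *
          ∑ p ∈ Finset.HasAntidiagonal.antidiagonal β,
            MvPowerSeries.coeff p.1 (setYZero n ℂ (P s)) * MvPowerSeries.coeff p.2 (c •
              MvPowerSeries.pderiv ℂ none (shiftedKernel (eta n) s)) := by
      intro s
      have h := MvPowerSeries.coeff_pderiv (R := ℂ) (i := none) (n := β)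
        (f := setYZero n ℂ (P s) * shiftedKernel (eta n) s)
      rw [Derivation.leibniz, pderiv_setYZero, smul_zero, add_zero, smul_eq_mul, hβ] at h
      rw [← MvPowerSeries.coeff_mul, mul_smul_comm, coeff_csmul, smul_eq_mul, h]
      field_simp
    have hcont : ∀ q, ContinuousOn (fun s => MvPowerSeries.coeff q
        (c • MvPowerSeries.pderiv ℂ none (shiftedKernel (eta n) s))) contourRegion := by
      intro q
      simp only [coeff_csmul, MvPowerSeries.coeff_pderiv, smul_eq_mul]
      have := CoeffDifferentiableAt.continuousOn hκd (q + Finsupp.single none 1)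
      fun_prop
    have hF' : ∀ q, Continuous fun s => MvPowerSeries.coeff q
        (setYZero n ℂ ((-c) • MvPowerSeries.pderiv ℂ none (P s))) := by
      intro q
      simp only [coeff_setYZero]
      split_ifs
      · exact continuous_iff_continuousAt.2 fun s => ((hP s).pderiv q).continuousAt
      · exact continuous_const
    have hFc : ∀ q, Continuous fun s => MvPowerSeries.coeff q (setYZero n ℂ (P s)) := fun q =>
      continuous_iff_continuousAt.2 fun s => (hF s q).continuousAt
    simp only [MvPowerSeries.coeff_mul] at hP'
    rw [rectInt_sum _ _ fun p _ => (hF' p.1).continuousOn.mul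
      (CoeffDifferentiableAt.continuousOn hκd p.2)] at hP'
    simp only [e1]
    rw [rectInt_const_mul, rectInt_sum _ _ fun p _ => (hFc p.1).continuousOn.mul (hcont p.2)]
    -- The derivative of the kernel with respect to `y` is one with respect to `s`.
    have e2 : ∀ p : (Option (BaseVar n) →₀ ℕ) × (Option (BaseVar n) →₀ ℕ),
        rectInt (fun s => MvPowerSeries.coeff p.1 (setYZero n ℂ (P s)) *
          MvPowerSeries.coeff p.2 (c • MvPowerSeries.pderiv ℂ none (shiftedKernel (eta n) s))) m =
        -rectInt (fun s => MvPowerSeries.coeff p.1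
          (setYZero n ℂ ((-c) • MvPowerSeries.pderiv ℂ none (P s))) *
          MvPowerSeries.coeff p.2 (shiftedKernel (eta n) s)) m := fun p =>
      rectInt_mul_deriv (fun s => hF s p.1) (hF' p.1)
        (fun s hs => hκt s (contourRegion_subset hs) p.2) (hcont p.2) m
    rw [Finset.sum_congr rfl fun p _ => e2 p, Finset.sum_neg_distrib, hP', coeff_csmul,
      MvPowerSeries.coeff_pderiv, hβ, smul_eq_mul]
    field_simp

/-- The residue theorem after a substitution for `y`. -/
theorem rectInt_coeff_mul_shiftedKernel_setY {c : HFree n ℂ}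
    (hc : MvPowerSeries.constantCoeff c = 0) {P : ℂ → HFree n ℂ}
    (hP : ∀ s, IsTransportedAt (-(2 * Real.pi * Complex.I)) none P s) (m : ℤ)
    (β : Option (BaseVar n) →₀ ℕ) :
    rectInt (fun s => MvPowerSeries.coeff β
      (setYZero n ℂ (P s) * shiftedKernel (setY hc (eta n)) s)) m =
        MvPowerSeries.coeff β (setY hc (P m)) := by
  obtain ⟨D, k, hD⟩ := exists_coeff_substAlgHom_eq_sum (setYVar_hasSubst hc) β
  have hD' : ∀ f, MvPowerSeries.coeff β (setY hc f) = ∑ α ∈ D, MvPowerSeries.coeff α f * k α := hD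
  have e : ∀ s, setYZero n ℂ (P s) * shiftedKernel (setY hc (eta n)) s =
      setY hc (setYZero n ℂ (P s) * shiftedKernel (eta n) s) := by
    intro s
    rw [map_mul, setY_setYZero, setY_shiftedKernel _ constantCoeff_eta]
  have hcont : ∀ α, ContinuousOn (fun s => MvPowerSeries.coeff α
      (setYZero n ℂ (P s) * shiftedKernel (eta n) s)) contourRegion := fun α =>
    CoeffDifferentiableAt.continuousOn (fun s hs => CoeffDifferentiableAt.mul (fun q => by
      simp only [coeff_setYZero]
      split_ifs
      · exact (hP s q).differentiableAt
      · exact differentiableAt_const _)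
      (coeffDifferentiableAt_shiftedKernel constantCoeff_eta hs)) α
  simp only [e, hD']
  rw [rectInt_sum D (fun α s => MvPowerSeries.coeff α
    (setYZero n ℂ (P s) * shiftedKernel (eta n) s) * k α)
    fun α _ => (hcont α).mul continuousOn_const]
  refine Finset.sum_congr rfl fun α _ => ?_
  simp only [mul_comm _ (k α)]
  rw [rectInt_const_mul, rectInt_coeff_mul_shiftedKernel m _ P hP α rfl]

end Kernel

/-! ### Lagrange interpolation without denominators -/

section Lagrange

variable {ι : Type*} [Fintype ι] [DecidableEq ι] {R : Type*} [CommRing R]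

/-- The product of the differences of `v` with all nodes but the `k`-th. -/
def nodeProd (ζ : ι → R) (k : ι) (v : R) : R := ∏ i ∈ Finset.univ.erase k, (v - ζ i)

/-- The product of all differences of nodes; up to sign, the discriminant. -/
def nodeDiscr (ζ : ι → R) : R := ∏ k, nodeProd ζ k (ζ k)

/-- The cofactor of `∏_{i ≠ k} (ζ_k - ζ_i)` in the product of all differences. -/
def nodeCofactor (ζ : ι → R) (k : ι) : R := ∏ m ∈ Finset.univ.erase k, nodeProd ζ m (ζ m)

theorem nodeCofactor_mul (ζ : ι → R) (k : ι) :
    nodeCofactor ζ k * nodeProd ζ k (ζ k) = nodeDiscr ζ := by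
  rw [mul_comm]
  exact Finset.mul_prod_erase _ (fun m => nodeProd ζ m (ζ m)) (Finset.mem_univ k)

theorem mul_nodeProd (ζ : ι → R) (k : ι) (v : R) :
    (v - ζ k) * nodeProd ζ k v = ∏ i, (v - ζ i) :=
  Finset.mul_prod_erase _ (fun i => v - ζ i) (Finset.mem_univ k)

theorem nodeProd_of_ne (ζ : ι → R) {k m : ι} (h : m ≠ k) : nodeProd ζ k (ζ m) = 0 :=
  Finset.prod_eq_zero (i := m) (by simp [h]) (sub_self _)

theorem map_nodeProd {S : Type*} [CommRing S] (f : R →+* S) (ζ : ι → R) (k : ι) (v : R) :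
    f (nodeProd ζ k v) = nodeProd (fun i => f (ζ i)) k (f v) := by
  simp [nodeProd]

theorem map_nodeDiscr {S : Type*} [CommRing S] (f : R →+* S) (ζ : ι → R) :
    f (nodeDiscr ζ) = nodeDiscr fun i => f (ζ i) := by
  simp [nodeDiscr, map_nodeProd]

theorem map_nodeCofactor {S : Type*} [CommRing S] (f : R →+* S) (ζ : ι → R) (k : ι) :
    f (nodeCofactor ζ k) = nodeCofactor (fun i => f (ζ i)) k := by
  simp [nodeCofactor, map_nodeProd]

variable [IsDomain R] {ζ : ι → R}

theorem nodeDiscr_ne_zero (hζ : Function.Injective ζ) : nodeDiscr ζ ≠ 0 :=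
  Finset.prod_ne_zero_iff.2 fun _ _ => Finset.prod_ne_zero_iff.2 fun _ hi =>
    sub_ne_zero.2 fun h => Finset.ne_of_mem_erase hi (hζ h).symm

open Polynomial in
/-- Lagrange interpolation. -/
theorem nodeDiscr_mul_eval (hζ : Function.Injective ζ) {p : R[X]}
    (hp : p.degree < (Fintype.card ι : ℕ)) (v : R) :
    nodeDiscr ζ * p.eval v = ∑ k, nodeCofactor ζ k * p.eval (ζ k) * nodeProd ζ k v := by
  classical
  have hcard : (Finset.univ.image ζ).card = Fintype.card ι :=
    Finset.card_image_of_injective _ hζ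
  have h0 : C (nodeDiscr ζ) * p - ∑ k, C (nodeCofactor ζ k * p.eval (ζ k)) *
      ∏ i ∈ Finset.univ.erase k, (X - C (ζ i)) = 0 := by
    refine Polynomial.eq_zero_of_degree_lt_of_eval_finset_eq_zero (Finset.univ.image ζ) ?_ ?_
    · rw [hcard]
      refine (degree_sub_le _ _).trans_lt (max_lt ?_ ?_)
      · exact ((degree_mul_le_of_le degree_C_le le_rfl).trans_lt (by rwa [zero_add]))
      · refine (degree_sum_le _ _).trans_lt ((Finset.sup_lt_iff (WithBot.bot_lt_coe _)).2
          fun k _ => (degree_mul_le_of_le degree_C_le le_rfl).trans_lt ?_)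
        rw [zero_add, degree_prod]
        simp only [degree_X_sub_C, Finset.sum_const, nsmul_eq_mul, mul_one]
        rw [Finset.card_erase_of_mem (Finset.mem_univ k), Finset.card_univ]
        have : 0 < Fintype.card ι := Fintype.card_pos_iff.2 ⟨k⟩
        exact_mod_cast Nat.sub_lt this one_pos
    · intro x hx
      obtain ⟨m, -, rfl⟩ := Finset.mem_image.1 hx
      have e : ∀ k, eval (ζ m) (∏ i ∈ Finset.univ.erase k, (X - C (ζ i))) =
          nodeProd ζ k (ζ m) := fun k => by simp [eval_prod, nodeProd]
      simp only [eval_sub, eval_mul, eval_C, eval_finsetSum, e]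
      rw [Finset.sum_eq_single m (fun k _ hk => by rw [nodeProd_of_ne _ hk.symm, mul_zero])
        (by simp), ← nodeCofactor_mul ζ m]
      ring
  have h1 := congrArg (eval v) h0
  have e : ∀ k, eval v (∏ i ∈ Finset.univ.erase k, (X - C (ζ i))) = nodeProd ζ k v :=
    fun k => by simp [eval_prod, nodeProd]
  simp only [eval_sub, eval_mul, eval_C, eval_finsetSum, e, eval_zero] at h1
  exact sub_eq_zero.1 h1

open Polynomial in
theorem sum_nodeCofactor_mul_nodeProd [Nonempty ι] (hζ : Function.Injective ζ) (v : R) :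
    ∑ k, nodeCofactor ζ k * nodeProd ζ k v = nodeDiscr ζ := by
  have h := nodeDiscr_mul_eval hζ (p := 1) (by
    rw [degree_one]
    exact_mod_cast Fintype.card_pos) v
  simpa using h.symm

open Polynomial in
/-- The partial fraction expansion of `∏ (η - ζ_i) / ((v - η) ∏ (v - ζ_i))` as a function of `v`,
with denominators cleared. -/
theorem nodeDiscr_mul_prod [Nonempty ι] (hζ : Function.Injective ζ) {η : R} (hη : ∀ k, ζ k ≠ η)
    (v : R) : nodeDiscr ζ * ∏ i, (η - ζ i) = nodeDiscr ζ * ∏ i, (v - ζ i) -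
      (v - η) * ∑ k, nodeCofactor ζ k * nodeProd ζ k η * nodeProd ζ k v := by
  set q₀ : R[X] := ∏ i, (X - C (ζ i)) - C (∏ i, (η - ζ i)) with hq₀
  have hev : ∀ x, q₀.eval x = ∏ i, (x - ζ i) - ∏ i, (η - ζ i) := fun x => by
    simp [hq₀, eval_prod]
  obtain ⟨q, hq⟩ : X - C η ∣ q₀ := dvd_iff_isRoot.2 (by rw [IsRoot, hev, sub_self])
  have hqe : ∀ x, (x - η) * q.eval x = ∏ i, (x - ζ i) - ∏ i, (η - ζ i) := fun x => by
    rw [← hev, hq]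
    simp
  have hdeg : q.degree < (Fintype.card ι : ℕ) := by
    by_cases h0 : q = 0
    · rw [h0, degree_zero]
      exact WithBot.bot_lt_coe _
    have h1 : q₀.natDegree ≤ Fintype.card ι := by
      rw [hq₀, natDegree_sub_C, natDegree_prod_of_monic _ _ fun i _ => monic_X_sub_C _]
      simp
    rw [hq, natDegree_mul (X_sub_C_ne_zero η) h0, natDegree_X_sub_C] at h1
    rw [degree_eq_natDegree h0]
    exact_mod_cast (by omega : q.natDegree < Fintype.card ι)
  have hqk : ∀ k, q.eval (ζ k) = nodeProd ζ k η := by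
    intro k
    apply mul_left_cancel₀ (sub_ne_zero.2 (hη k))
    rw [hqe, ← mul_nodeProd ζ k η, Finset.prod_eq_zero (Finset.mem_univ k) (sub_self _)]
    ring
  have h := nodeDiscr_mul_eval hζ hdeg v
  simp only [hqk] at h
  rw [← h]
  linear_combination nodeDiscr ζ * hqe v

end Lagrange

/-! ### The Barnes integrand -/

section Barnes

variable {n : ℕ}

theorem pderiv_expS {σ : Type*} {i : σ} {f : MvPowerSeries σ ℂ}
    (hf : MvPowerSeries.constantCoeff f = 0) {d : ℂ}
    (hd : MvPowerSeries.pderiv ℂ i f = MvPowerSeries.C d) :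
    MvPowerSeries.pderiv ℂ i (expS f) = d • expS f := by
  rw [expS, pderiv_subst (PowerSeries.HasSubst.of_constantCoeff_zero hf) hd,
    PowerSeries.derivative_exp]

instance : IsDomain (HFree n ℂ) := NoZeroDivisors.to_isDomain _

theorem zeta_ne_zero (i : Fin n) : zeta n i ≠ 0 := by
  intro h
  have := constantCoeff_zeta i
  rw [h, map_zero] at this
  exact zero_ne_one this

theorem zeta_injective : Function.Injective (zeta n) := by
  classical
  intro i j h
  by_contra hij
  have h1 : MvPowerSeries.pderiv ℂ (some (Sum.inr i)) (zeta n i) = (1 : ℂ) • zeta n i :=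
    pderiv_expS (constantCoeff_zF i) (by rw [zF, MvPowerSeries.pderiv_X_self, map_one])
  have h2 : MvPowerSeries.pderiv ℂ (some (Sum.inr i)) (zeta n j) = (0 : ℂ) • zeta n j :=
    pderiv_expS (constantCoeff_zF j) (by
      rw [zF, MvPowerSeries.pderiv_X_of_ne (by simpa using Ne.symm hij), map_zero])
  rw [← h, h1, one_smul, zero_smul] at h2
  exact zeta_ne_zero i h2

theorem zeta_ne_eta (k : Fin n) : zeta n k ≠ eta n := by
  classical
  intro h
  have h2 : MvPowerSeries.pderiv ℂ none (zeta n k) = (0 : ℂ) • zeta n k :=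
    pderiv_expS (constantCoeff_zF k) (by rw [zF, MvPowerSeries.pderiv_X_of_ne (by simp), map_zero])
  rw [h, pderiv_eta, zero_smul, neg_eq_zero, ← h] at h2
  exact zeta_ne_zero k h2

/-- The integrand of the Barnes integral, up to the factor `e^{ws}`. It has poles only at the
integers; its factors `(η - ζ_i) / (e^{2πis} - ζ_i)` provide the exponential decay for
`Im s → -∞`. -/
def barnesKernel (a b : Fin n → ℤ) (s : ℂ) : HFree n ℂ :=
  gammaBase a b s * (shiftedKernel (eta n) s *
    ∏ i, ((eta n - zeta n i) * kernelFactor (zeta n i) s))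

theorem coeffDifferentiableAt_gammaBase (a b : Fin n → ℤ) (s : ℂ) :
    CoeffDifferentiableAt (gammaBase a b) s :=
  coeffDifferentiableAt_gammaProd a b constantCoeff_neg_xF constantCoeff_zF s

theorem coeffDifferentiableAt_barnesKernel (a b : Fin n → ℤ) {s : ℂ} (hs : s ∈ offIntegers) :
    CoeffDifferentiableAt (barnesKernel a b) s :=
  (coeffDifferentiableAt_gammaBase a b s).mul
    ((coeffDifferentiableAt_shiftedKernel constantCoeff_eta hs).mul
      (CoeffDifferentiableAt.prod _ fun i _ =>
        (hasCoeffDerivAt_const _ _).differentiableAt.mul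
          (coeffDifferentiableAt_kernelFactor (constantCoeff_zeta i) hs)))

/-- In the imaginary direction the Gamma factors grow like `e^{nπ|t|}`, and the kernel with its `n`
additional factors behaves like `e^{-2πt}` for `t → ∞` and like `e^{2πnt}` for `t → -∞`. The product
behaves like `e^{(n-2)πt}` and `e^{nπt}`, with exponents at distance `π` from `(n - 1)π`. -/
theorem exp_mul_inv_pow_le (n : ℕ) (t : ℝ) :
    Real.exp (n * (Real.pi * |t|)) * ((Real.exp (-(2 * Real.pi * t)) *
      (1 + Real.exp (-(2 * Real.pi * t)))⁻¹) * (1 + Real.exp (-(2 * Real.pi * t)))⁻¹ ^ n) ≤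
      Real.exp (((n : ℝ) - 1) * Real.pi * t - Real.pi * |t|) := by
  set q := Real.exp (-(2 * Real.pi * t)) with hq
  have hq0 : 0 < q := Real.exp_pos _
  have h0 : (0 : ℝ) ≤ (1 + q)⁻¹ := by positivity
  have h1 : (1 + q)⁻¹ ≤ 1 := inv_le_one_of_one_le₀ (by linarith)
  rcases le_total 0 t with ht | ht
  · rw [abs_of_nonneg ht]
    have h2 : q * (1 + q)⁻¹ * (1 + q)⁻¹ ^ n ≤ q := by
      rw [mul_assoc]
      exact mul_le_of_le_one_right hq0.le (mul_le_one₀ h1 (by positivity) (pow_le_one₀ h0 h1))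
    refine (mul_le_mul_of_nonneg_left h2 (Real.exp_pos _).le).trans (le_of_eq ?_)
    rw [hq, ← Real.exp_add]
    congr 1
    ring
  · rw [abs_of_nonpos ht]
    have h2 : q * (1 + q)⁻¹ ≤ 1 := by
      rw [← div_eq_mul_inv, div_le_one (by positivity)]
      linarith
    have h3 : (1 + q)⁻¹ ^ n ≤ Real.exp (n * (2 * Real.pi * t)) := by
      have : (1 + q)⁻¹ ≤ q⁻¹ := inv_anti₀ hq0 (by linarith)
      rw [Real.exp_nat_mul]
      refine pow_le_pow_left₀ h0 (this.trans (le_of_eq ?_)) n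
      rw [hq, ← Real.exp_neg, neg_neg]
    have h4 : q * (1 + q)⁻¹ * (1 + q)⁻¹ ^ n ≤ Real.exp (n * (2 * Real.pi * t)) := by
      calc _ ≤ 1 * Real.exp (n * (2 * Real.pi * t)) := by gcongr
        _ = _ := one_mul _
    refine (mul_le_mul_of_nonneg_left h4 (Real.exp_pos _).le).trans (le_of_eq ?_)
    rw [← Real.exp_add]
    congr 1
    ring

/-- The centre `(n - 1)π` of the strip of convergence is the height at which the path crosses the
imaginary axis. -/
theorem isBarnesKernel_coeff (a b : Fin n → ℤ) (α : Option (BaseVar n) →₀ ℕ) :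
    IsBarnesKernel (((n : ℝ) - 1) * Real.pi)
      fun s => MvPowerSeries.coeff α (barnesKernel a b s) := by
  refine ⟨fun s hs => coeffDifferentiableAt_barnesKernel a b hs α, ?_⟩
  have h1 := (coeffGrowth_gammaProd a b (constantCoeff_neg_xF (n := n))
    constantCoeff_zF).mono (Set.subset_univ contourRegion) zero_le_one
    (ω' := fun s => Real.exp (n * (Real.pi * |s.im|))) fun s _ => by rw [one_mul]
  have h2 := CoeffGrowth.prod (Ω := contourRegion) Finset.univ
    (ω := fun (_ : Fin n) s => (1 : ℝ) * (1 + Real.exp (-(2 * Real.pi * s.im)))⁻¹)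
    (fun _ s => by positivity)
    fun i _ => (coeffGrowth_const contourRegion (eta n - zeta n i)).mul (fun _ => zero_le_one)
      (fun s => by positivity) (coeffGrowth_kernelFactor (constantCoeff_zeta i))
  have h3 := h1.mul (fun s => (Real.exp_pos _).le) (fun s => by positivity)
    ((coeffGrowth_shiftedKernel (constantCoeff_eta (n := n))).mul (fun s => by positivity)
      (fun s => Finset.prod_nonneg fun i _ => by positivity) h2)
  refine h3.mono subset_rfl zero_le_one (fun s _ => ?_) α
  simp only [one_mul, Finset.prod_const, Finset.card_univ, Fintype.card_fin]
  exact exp_mul_inv_pow_le n s.im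

/-- Coefficientwise integration over rectangles. -/
def rectIntS {σ : Type*} (Ψ : ℂ → MvPowerSeries σ ℂ) (m : ℤ) : MvPowerSeries σ ℂ :=
  fun α => rectInt (fun s => MvPowerSeries.coeff α (Ψ s)) m

theorem coeff_rectIntS {σ : Type*} (Ψ : ℂ → MvPowerSeries σ ℂ) (m : ℤ) (α : σ →₀ ℕ) :
    MvPowerSeries.coeff α (rectIntS Ψ m) = rectInt (fun s => MvPowerSeries.coeff α (Ψ s)) m := rfl

theorem rectIntS_mul_left {σ : Type*} (g : MvPowerSeries σ ℂ) {Ψ : ℂ → MvPowerSeries σ ℂ}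
    (hΨ : ∀ s ∈ offIntegers, CoeffDifferentiableAt Ψ s) (m : ℤ) :
    rectIntS (fun s => g * Ψ s) m = g * rectIntS Ψ m := by
  classical
  ext α
  simp only [coeff_rectIntS, MvPowerSeries.coeff_mul]
  rw [rectInt_sum _ (fun (p : (σ →₀ ℕ) × (σ →₀ ℕ)) s => MvPowerSeries.coeff p.1 g *
    MvPowerSeries.coeff p.2 (Ψ s))
    fun p _ => continuousOn_const.mul (CoeffDifferentiableAt.continuousOn hΨ p.2)]
  simp only [rectInt_const_mul]

theorem rectIntS_sum {σ ι : Type*} (D : Finset ι) {Ψ : ι → ℂ → MvPowerSeries σ ℂ}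
    (hΨ : ∀ i, ∀ s ∈ offIntegers, CoeffDifferentiableAt (Ψ i) s) (m : ℤ) :
    rectIntS (fun s => ∑ i ∈ D, Ψ i s) m = ∑ i ∈ D, rectIntS (Ψ i) m := by
  ext α
  simp only [coeff_rectIntS, map_sum]
  exact rectInt_sum _ _ (fun i _ => CoeffDifferentiableAt.continuousOn (hΨ i) α) m

theorem rectIntS_add {σ : Type*} {Ψ Φ : ℂ → MvPowerSeries σ ℂ}
    (hΨ : ∀ s ∈ offIntegers, CoeffDifferentiableAt Ψ s)
    (hΦ : ∀ s ∈ offIntegers, CoeffDifferentiableAt Φ s) (m : ℤ) :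
    rectIntS (fun s => Ψ s + Φ s) m = rectIntS Ψ m + rectIntS Φ m := by
  ext α
  simp only [coeff_rectIntS, map_add]
  exact rectInt_add (CoeffDifferentiableAt.continuousOn hΨ α)
    (CoeffDifferentiableAt.continuousOn hΦ α) m

/-- The residue at `m` of the integrand of the Barnes integral. -/
def barnesResidue (a b : Fin n → ℤ) (w : ℂ) (m : ℤ) : HFree n ℂ :=
  fun α => residueInt (fun s => MvPowerSeries.coeff α (barnesKernel a b s)) m w

theorem coeff_barnesResidue (a b : Fin n → ℤ) (w : ℂ) (m : ℤ) (α : Option (BaseVar n) →₀ ℕ) :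
    MvPowerSeries.coeff α (barnesResidue a b w m) =
      residueInt (fun s => MvPowerSeries.coeff α (barnesKernel a b s)) m w := rfl

theorem kernel_identity {R : Type*} [CommRing R] {D κ K S v η E V : R} (u : R)
    (h : D * E = D * V - (v - η) * S) (hV : V * K = 1) (hκ : (v - η) * κ = 1) :
    D * (u * κ * (E * K)) = D * (u * κ) - u * (S * K) := by
  linear_combination u * κ * K * h + u * κ * D * hV - u * K * S * hκ

/-- Partial fractions for the kernel of the Barnes integral. -/
theorem nodeDiscr_mul_kernel [NeZero n] {s : ℂ} (hs : s ∈ offIntegers) :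
    nodeDiscr (zeta n) * (shiftedKernel (eta n) s *
      ∏ i, ((eta n - zeta n i) * kernelFactor (zeta n i) s)) =
    nodeDiscr (zeta n) * shiftedKernel (eta n) s -
      ∑ k, nodeCofactor (zeta n) k * nodeProd (zeta n) k (eta n) *
        shiftedKernel (zeta n k) s := by
  set v : HFree n ℂ := MvPowerSeries.C (Complex.exp (2 * Real.pi * Complex.I * s)) with hv
  have h0 := sub_mul_kernelFactor (constantCoeff_eta (n := n)) hs
  have h1 := fun i => sub_mul_kernelFactor (constantCoeff_zeta (n := n) i) hs
  rw [← hv] at h0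
  simp only [← hv] at h1
  have hprod : (∏ i, (v - zeta n i)) * ∏ i, kernelFactor (zeta n i) s = 1 := by
    rw [← Finset.prod_mul_distrib]
    exact Finset.prod_eq_one fun i _ => h1 i
  have hk : ∀ k, nodeProd (zeta n) k v * ∏ i, kernelFactor (zeta n i) s =
      kernelFactor (zeta n k) s := by
    intro k
    rw [← mul_nodeProd _ k] at hprod
    linear_combination (kernelFactor (zeta n k) s) * hprod -
      nodeProd (zeta n) k v * (∏ i, kernelFactor (zeta n i) s) * h1 k
  have key := nodeDiscr_mul_prod (zeta_injective (n := n)) zeta_ne_eta v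
  have hsum : ∑ k, nodeCofactor (zeta n) k * nodeProd (zeta n) k (eta n) *
        shiftedKernel (zeta n k) s = (2 * Real.pi * Complex.I *
          Complex.exp (2 * Real.pi * Complex.I * s)) • ((∑ k, nodeCofactor (zeta n) k *
            nodeProd (zeta n) k (eta n) * nodeProd (zeta n) k v) *
              ∏ i, kernelFactor (zeta n i) s) := by
    rw [Finset.sum_mul, Finset.smul_sum]
    refine Finset.sum_congr rfl fun k _ => ?_
    rw [mul_assoc _ (nodeProd (zeta n) k v), hk, shiftedKernel, mul_smul_comm]
  rw [hsum, shiftedKernel, Finset.prod_mul_distrib]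
  simp only [MvPowerSeries.smul_eq_C_mul]
  exact kernel_identity _ key hprod h0

theorem rectIntS_congr {σ : Type*} {Ψ Φ : ℂ → MvPowerSeries σ ℂ}
    (h : ∀ s ∈ offIntegers, Ψ s = Φ s) (m : ℤ) : rectIntS Ψ m = rectIntS Φ m := by
  ext α
  rw [coeff_rectIntS, coeff_rectIntS]
  exact rectInt_congr (fun s hs => congrArg _ (h s (contourRegion_subset hs))) m

theorem nodeDiscr_mul_exp_smul_barnesKernel [NeZero n] (a b : Fin n → ℤ) (w : ℂ) :
    ∀ s ∈ offIntegers, nodeDiscr (zeta n) * Complex.exp (w * s) • barnesKernel a b s =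
      nodeDiscr (zeta n) * (setYZero n ℂ (hyperTerm a b w s) * shiftedKernel (eta n) s) +
        ∑ k, -(nodeCofactor (zeta n) k * nodeProd (zeta n) k (eta n)) *
          (setYZero n ℂ (hyperTerm a b w s) * shiftedKernel (zeta n k) s) := by
  intro s hs
  have h := nodeDiscr_mul_kernel (n := n) hs
  rw [setYZero_hyperTerm, barnesKernel, mul_comm w s]
  set e := Complex.exp (s * w)
  have h5 : ∑ k, -(nodeCofactor (zeta n) k * nodeProd (zeta n) k (eta n)) *
      (e • gammaBase a b s * shiftedKernel (zeta n k) s) = -(e • gammaBase a b s) *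
      ∑ k, nodeCofactor (zeta n) k * nodeProd (zeta n) k (eta n) *
        shiftedKernel (zeta n k) s := by
    rw [Finset.mul_sum]
    exact Finset.sum_congr rfl fun k _ => by ring
  rw [h5, ← smul_mul_assoc]
  generalize e • gammaBase a b s = E
  rw [mul_left_comm, h, mul_sub, neg_mul, sub_eq_add_neg, mul_left_comm]

/-- The residues of the Barnes integrand, in terms of the hypergeometric terms and their
restrictions to the fixed loci of `X₋`. -/
theorem nodeDiscr_mul_barnesResidue [NeZero n] (a b : Fin n → ℤ) (w : ℂ) (m : ℤ) :
    nodeDiscr (zeta n) * barnesResidue a b w m = nodeDiscr (zeta n) * hyperTerm a b w m -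
      ∑ k, nodeCofactor (zeta n) k * nodeProd (zeta n) k (eta n) *
        setY (constantCoeff_neg_zF k) (hyperTerm a b w m) := by
  have hd : ∀ s, CoeffDifferentiableAt (fun s => setYZero n ℂ (hyperTerm a b w s)) s := by
    intro s
    simp only [setYZero_hyperTerm]
    exact (HasCoeffDerivAt.smul (f := fun s => Complex.exp (s * w))
      (((hasDerivAt_id s).mul_const w).cexp)
      (coeffDifferentiableAt_gammaBase a b s).hasCoeffDerivAt).differentiableAt
  have hd' : ∀ (ξ : HFree n ℂ), MvPowerSeries.constantCoeff ξ = 1 → ∀ s ∈ offIntegers,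
      CoeffDifferentiableAt (fun s => setYZero n ℂ (hyperTerm a b w s) * shiftedKernel ξ s) s :=
    fun ξ hξ s hs => (hd s).mul (coeffDifferentiableAt_shiftedKernel hξ hs)
  have h1 : rectIntS (fun s => setYZero n ℂ (hyperTerm a b w s) * shiftedKernel (eta n) s) m =
      hyperTerm a b w m := by
    ext α
    exact rectInt_coeff_mul_shiftedKernel m _ _ (isTransportedAt_hyperTerm a b w) α rfl
  have h2 : ∀ k, rectIntS (fun s => setYZero n ℂ (hyperTerm a b w s) *
      shiftedKernel (zeta n k) s) m = setY (constantCoeff_neg_zF k) (hyperTerm a b w m) := by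
    intro k
    ext α
    rw [← setY_eta k]
    exact rectInt_coeff_mul_shiftedKernel_setY _ (isTransportedAt_hyperTerm a b w) m α
  have h3 : barnesResidue a b w m =
      rectIntS (fun s => Complex.exp (w * s) • barnesKernel a b s) m := by
    ext α
    simp only [coeff_barnesResidue, coeff_rectIntS, coeff_csmul, smul_eq_mul, residueInt]
  rw [h3, ← rectIntS_mul_left]
  · rw [rectIntS_congr (nodeDiscr_mul_exp_smul_barnesKernel a b w) m,
      rectIntS_add, rectIntS_sum, rectIntS_mul_left _ (hd' _ constantCoeff_eta), h1,
      sub_eq_add_neg, ← Finset.sum_neg_distrib]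
    · congr 1
      refine Finset.sum_congr rfl fun k _ => ?_
      rw [rectIntS_mul_left _ (hd' _ (constantCoeff_zeta k)), h2, neg_mul]
    · exact fun k s hs => (hasCoeffDerivAt_const _ _).differentiableAt.mul
        (hd' _ (constantCoeff_zeta k) s hs)
    · exact fun s hs => (hasCoeffDerivAt_const _ _).differentiableAt.mul
        (hd' _ constantCoeff_eta s hs)
    · intro s hs α
      simp only [map_sum]
      exact DifferentiableAt.fun_sum fun k _ => ((hasCoeffDerivAt_const _ _).differentiableAt.mul
        (hd' _ (constantCoeff_zeta k) s hs)) α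
  · exact fun s hs => (HasCoeffDerivAt.smul (f := fun s => Complex.exp (w * s))
      (((hasDerivAt_id s).const_mul w).cexp)
      (coeffDifferentiableAt_barnesKernel a b hs).hasCoeffDerivAt).differentiableAt

/-! ### Vanishing of hypergeometric terms -/

theorem dvd_subst_smul {σ : Type*} {ℓ : MvPowerSeries σ ℂ}
    (hℓ : MvPowerSeries.constantCoeff ℓ = 0) (c : ℂ) {g : PowerSeries ℂ}
    (hg : PowerSeries.coeff 0 g = 0) : ℓ ∣ g.subst (c • ℓ) := by
  rw [PowerSeries.coeff_zero_eq_constantCoeff_apply, ← PowerSeries.X_dvd_iff] at hg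
  obtain ⟨h, rfl⟩ := hg
  rw [PowerSeries.subst_mul (hasSubst_smul hℓ c), PowerSeries.subst_X (hasSubst_smul hℓ c),
    MvPowerSeries.smul_eq_C_mul]
  exact ⟨MvPowerSeries.C c * h.subst (MvPowerSeries.C c * ℓ), by ring⟩

/-- If `1/Γ` is expanded at nonpositive integers in the directions along the projective bundle, then
the term is divisible by all Chern roots in these directions. -/
theorem relation_plus_dvd_hyperTerm {a b : Fin n → ℤ} {m : ℤ} (hm : ∀ j, 1 + a j + m ≤ 0) (w : ℂ) :
    relation n ℂ .plus ∣ hyperTerm a b w m := by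
  refine Dvd.dvd.mul_left (Finset.prod_dvd_prod_of_dvd _ _ fun j _ => ?_) _
  refine Dvd.dvd.mul_right (dvd_subst_smul (constantCoeff_weight _ j) _ ?_) _
  rw [show ((1 + a j) + 1 * m : ℂ) = ((1 + a j + m : ℤ) : ℂ) by push_cast; ring]
  exact coeff_zero_rGammaTaylor_of_nonpos (hm j)

theorem relation_minus_dvd_hyperTerm {a b : Fin n → ℤ} {m : ℤ} (hm : ∀ j, 1 - b j - m ≤ 0)
    (w : ℂ) : relation n ℂ .minus ∣ hyperTerm a b w m := by
  refine Dvd.dvd.mul_left (Finset.prod_dvd_prod_of_dvd _ _ fun j _ => ?_) _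
  refine Dvd.dvd.mul_left (dvd_subst_smul (constantCoeff_weight _ j) _ ?_) _
  rw [show ((1 - b j) + -1 * m : ℂ) = ((1 - b j - m : ℤ) : ℂ) by push_cast; ring]
  exact coeff_zero_rGammaTaylor_of_nonpos (hm j)

theorem setY_relation_minus (k : Fin n) :
    setY (constantCoeff_neg_zF k) (relation n ℂ .minus) = 0 := by
  rw [relation, map_prod]
  refine Finset.prod_eq_zero (Finset.mem_univ k) ?_
  rw [setY_weight_minus, add_neg_cancel]

theorem setY_hyperTerm_eq_zero {a b : Fin n → ℤ} {m : ℤ} (hm : ∀ j, 1 - b j - m ≤ 0) (w : ℂ)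
    (k : Fin n) : setY (constantCoeff_neg_zF k) (hyperTerm a b w m) = 0 := by
  have h := map_dvd (setY (constantCoeff_neg_zF k)) (relation_minus_dvd_hyperTerm (a := a) hm w)
  rwa [setY_relation_minus, zero_dvd_iff] at h

/-- The Barnes integrand has the hypergeometric terms as residues, as long as these vanish on
`X₋`. -/
theorem barnesResidue_eq [NeZero n] {a b : Fin n → ℤ} {m : ℤ} (hm : ∀ j, 1 - b j - m ≤ 0)
    (w : ℂ) : barnesResidue a b w m = hyperTerm a b w m := by
  have h := nodeDiscr_mul_barnesResidue a b w m
  simp only [setY_hyperTerm_eq_zero hm, mul_zero, Finset.sum_const_zero, sub_zero] at h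
  exact mul_left_cancel₀ (nodeDiscr_ne_zero zeta_injective) h

/-- The terms with index below `m₁` vanish on `X₊`, and those with index at least `m₀` vanish on
`X₋`. -/
theorem exists_cutoff (a b : Fin n → ℤ) : ∃ m₁ m₀ : ℤ, m₁ ≤ m₀ ∧
    (∀ m < m₁, ∀ j, 1 + a j + m ≤ 0) ∧ ∀ m, m₀ ≤ m → ∀ j, 1 - b j - m ≤ 0 := by
  have h1 : ∀ j, |a j| ≤ ∑ j, |a j| := fun j =>
    Finset.single_le_sum (f := fun j => |a j|) (fun _ _ => abs_nonneg _) (Finset.mem_univ j)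
  have h2 : ∀ j, |b j| ≤ ∑ j, |b j| := fun j =>
    Finset.single_le_sum (f := fun j => |b j|) (fun _ _ => abs_nonneg _) (Finset.mem_univ j)
  have h3 : 0 ≤ ∑ j, |a j| := Finset.sum_nonneg fun _ _ => abs_nonneg _
  have h4 : 0 ≤ ∑ j, |b j| := Finset.sum_nonneg fun _ _ => abs_nonneg _
  refine ⟨-∑ j, |a j|, 1 + ∑ j, |b j|, by omega, fun m hm j => ?_, fun m hm j => ?_⟩
  · have := h1 j
    have := le_abs_self (a j)
    omega
  · have := h2 j
    have := neg_abs_le (b j)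
    omega

end Barnes

/-! ### Coefficientwise convergence in the cohomology of `X₊` and `X₋` -/

section Topology

variable {n : ℕ} {A : Type*} [CommRing A] {s : Chamber}

theorem isHomogeneous_weight (s : Chamber) (i : Fin n) : (weight A s i).IsHomogeneous 1 := by
  classical
  have hX : ∀ j : Option (BaseVar n), (MvPowerSeries.X j : HFree n A).IsHomogeneous 1 := by
    intro j d hd
    rw [MvPowerSeries.coeff_X] at hd
    have h : d = Finsupp.single j 1 := by
      by_contra h
      exact hd (if_neg h)
    rw [h]
    simp [Finsupp.weight_single]
  intro d hd
  by_contra h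
  have h0 : ∀ j : Option (BaseVar n), MvPowerSeries.coeff d (MvPowerSeries.X j : HFree n A) = 0 :=
    fun j => by
      by_contra h'
      exact h (hX j h')
  apply hd
  cases s <;> simp [weight, xF, yF, zF, h0]

theorem isHomogeneous_relation (s : Chamber) : (relation n A s).IsHomogeneous n := by
  have h : ∀ D : Finset (Fin n), (∏ i ∈ D, weight A s i).IsHomogeneous D.card := by
    classical
    intro D
    induction D using Finset.induction_on with
    | empty =>
      intro d hd
      rw [Finset.prod_empty, MvPowerSeries.coeff_one] at hd
      have h : d = 0 := by
        by_contra h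
        exact hd (if_neg h)
      simp [h]
    | insert i D hi ih =>
      rw [Finset.prod_insert hi, Finset.card_insert_of_notMem hi, add_comm]
      exact MvPowerSeries.IsHomogeneous.mul (isHomogeneous_weight s i) ih
  have h1 : (relation n A s).IsHomogeneous (Finset.univ : Finset (Fin n)).card := h Finset.univ
  rwa [Finset.card_univ, Fintype.card_fin] at h1

/-- Multiplication by a homogeneous series of degree `n` shifts the degree by `n`. -/
theorem coeff_mul_of_isHomogeneous {σ : Type*} {R : Type*} [CommRing R] {r : MvPowerSeries σ R}
    (hr : r.IsHomogeneous n) {g g' : MvPowerSeries σ R} {m : σ →₀ ℕ}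
    (h : ∀ q : σ →₀ ℕ, q.degree + n = m.degree →
      MvPowerSeries.coeff q g = MvPowerSeries.coeff q g') :
    MvPowerSeries.coeff m (r * g) = MvPowerSeries.coeff m (r * g') := by
  classical
  rw [MvPowerSeries.coeff_mul, MvPowerSeries.coeff_mul]
  refine Finset.sum_congr rfl fun p hp => ?_
  by_cases hp0 : MvPowerSeries.coeff p.1 r = 0
  · rw [hp0, zero_mul, zero_mul]
  · have h1 : p.1.degree = n := by
      by_contra h1
      exact hp0 (hr.coeff_eq_zero h1)
    rw [h p.2]
    rw [← Finset.HasAntidiagonal.mem_antidiagonal.1 hp, map_add, h1, add_comm]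

/-- A series lies in the ideal of a homogeneous series if its homogeneous components do. -/
theorem dvd_of_dvd_homogeneousComponent {σ : Type*} {R : Type*} [CommRing R]
    {r : MvPowerSeries σ R} (hr : r.IsHomogeneous n) {f : MvPowerSeries σ R}
    (h : ∀ d, r ∣ MvPowerSeries.homogeneousComponent d f) : r ∣ f := by
  choose g hg using h
  refine ⟨fun q => MvPowerSeries.coeff q (g (q.degree + n)), ?_⟩
  ext m
  have h1 : MvPowerSeries.coeff m f =
      MvPowerSeries.coeff m (MvPowerSeries.homogeneousComponent m.degree f) := by
    rw [MvPowerSeries.coeff_homogeneousComponent, if_pos rfl]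
  rw [h1, hg]
  refine coeff_mul_of_isHomogeneous hr fun q hq => ?_
  rw [← hq]
  rfl

theorem dvd_homogeneousComponent {σ : Type*} {R : Type*} [CommRing R]
    {r : MvPowerSeries σ R} (hr : r.IsHomogeneous n) {f : MvPowerSeries σ R} (h : r ∣ f) (d : ℕ) :
    r ∣ MvPowerSeries.homogeneousComponent d f := by
  classical
  obtain ⟨g, rfl⟩ := h
  refine ⟨(fun q => if q.degree + n = d then MvPowerSeries.coeff q g else 0 :
    MvPowerSeries σ R), ?_⟩
  ext m
  rw [MvPowerSeries.coeff_homogeneousComponent]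
  split_ifs with hm
  · refine coeff_mul_of_isHomogeneous hr fun q hq => ?_
    exact (if_pos (hq.trans hm)).symm
  · refine Eq.trans ?_ (coeff_mul_of_isHomogeneous hr (g := 0) fun q hq => ?_)
    · rw [mul_zero, map_zero]
    change (0 : R) = if q.degree + n = d then MvPowerSeries.coeff q g else 0
    rw [if_neg fun h => hm (hq.symm.trans h)]

variable [Algebra ℂ A]

/-- The functionals that define the topology separate points: the ideal of relations is homogeneous,
so that it is closed. -/
theorem eq_zero_of_isCoeffFunctional {x : HX n A s}
    (h : ∀ φ : HX n A s →ₗ[ℂ] ℂ, IsCoeffFunctional φ → φ x = 0) : x = 0 := by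
  obtain ⟨f, rfl⟩ := Ideal.Quotient.mk_surjective x
  rw [Ideal.Quotient.eq_zero_iff_dvd] at *
  refine dvd_of_dvd_homogeneousComponent (isHomogeneous_relation s) fun d => ?_
  rw [← Ideal.Quotient.eq_zero_iff_dvd, ← Module.forall_dual_apply_eq_zero_iff ℂ]
  intro ψ
  -- the functional `ψ` composed with the projection to the homogeneous component
  set p : HFree n A →ₗ[ℂ] HFree n A :=
    (MvPowerSeries.homogeneousComponent (R := A) d).restrictScalars ℂ with hp
  set π : HFree n A →ₗ[ℂ] HX n A s := (Ideal.Quotient.mkₐ ℂ _).toLinearMap with hπ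
  set φ : HX n A s →ₗ[ℂ] ℂ :=
    Submodule.liftQ (Submodule.restrictScalars ℂ (Ideal.span {relation n A s})) (ψ ∘ₗ π ∘ₗ p) (by
      intro g hg
      have : π (p g) = 0 := (Ideal.Quotient.eq_zero_iff_dvd _ _).2
        (dvd_homogeneousComponent (isHomogeneous_relation s) (Ideal.mem_span_singleton.1 hg) d)
      rw [LinearMap.mem_ker, LinearMap.comp_apply, LinearMap.comp_apply, this, map_zero]) with hφ
  have hφ' : ∀ g, φ (Ideal.Quotient.mk _ g) = ψ (π (p g)) := fun g => rfl
  refine (hφ' f).symm.trans (h φ ?_)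
  have hfin : {m : Option (BaseVar n) →₀ ℕ | m.degree = d}.Finite :=
    (Finsupp.finite_of_degree_le d).subset fun m hm => le_of_eq hm
  refine ⟨hfin.toFinset, fun g hg => ?_⟩
  rw [hφ']
  have : p g = 0 := by
    ext m
    change MvPowerSeries.coeff m (MvPowerSeries.homogeneousComponent d g) = _
    rw [MvPowerSeries.coeff_homogeneousComponent, map_zero]
    split_ifs with hm
    · exact hg m (hfin.mem_toFinset.2 hm)
    · rfl
  rw [this, map_zero, map_zero]

instance : T2Space (HX n A s) := by
  refine ⟨fun x y hxy => ?_⟩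
  obtain ⟨φ, hφ, hne⟩ : ∃ φ : HX n A s →ₗ[ℂ] ℂ, IsCoeffFunctional φ ∧ φ (x - y) ≠ 0 := by
    by_contra! h
    exact hxy (sub_eq_zero.1 (eq_zero_of_isCoeffFunctional h))
  have hc : Continuous fun f : HX n A s => φ f :=
    continuous_iInf_dom (i := ⟨φ, hφ⟩) continuous_induced_dom
  rw [map_sub, sub_ne_zero] at hne
  exact separated_by_continuous hc hne

/-- A coefficient functional is a linear combination of finitely many coefficients on series with
complex coefficients. -/
theorem IsCoeffFunctional.exists_eq_sum {φ : HX n A s →ₗ[ℂ] ℂ} (hφ : IsCoeffFunctional φ) :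
    ∃ (D : Finset (Option (BaseVar n) →₀ ℕ)) (c : (Option (BaseVar n) →₀ ℕ) → ℂ),
      ∀ f : HFree n ℂ, φ (Ideal.Quotient.mk _ (MvPowerSeries.map (algebraMap ℂ A) f)) =
        ∑ α ∈ D, c α * MvPowerSeries.coeff α f := by
  classical
  obtain ⟨D, hD⟩ := hφ
  refine ⟨D, fun α => φ (Ideal.Quotient.mk _ (MvPowerSeries.monomial α 1)), fun f => ?_⟩
  set π : HFree n A →ₗ[ℂ] HX n A s := (Ideal.Quotient.mkₐ ℂ _).toLinearMap with hπ
  have h := hD (MvPowerSeries.map (algebraMap ℂ A) f -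
    ∑ α ∈ D, MvPowerSeries.coeff α f • MvPowerSeries.monomial α (1 : A)) (by
      intro m hm
      rw [map_sub, map_sum, MvPowerSeries.coeff_map, Finset.sum_eq_single m]
      · rw [coeff_csmul, MvPowerSeries.coeff_monomial_same, Algebra.smul_def, mul_one, sub_self]
      · intro α _ hα
        rw [coeff_csmul, MvPowerSeries.coeff_monomial, if_neg hα.symm, smul_zero]
      · exact fun h => absurd hm h)
  change φ (π _) = 0 at h
  rw [map_sub, map_sub, sub_eq_zero] at h
  refine h.trans ?_
  simp only [map_sum, map_smul, smul_eq_mul]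
  exact Finset.sum_congr rfl fun α _ => mul_comm _ _

theorem hasSum_mk_map {ι : Type*} {f : ι → HFree n ℂ} {g : HFree n ℂ}
    (h : ∀ α, HasSum (fun m => MvPowerSeries.coeff α (f m)) (MvPowerSeries.coeff α g)) :
    HasSum (fun m => (Ideal.Quotient.mk _ (MvPowerSeries.map (algebraMap ℂ A) (f m)) : HX n A s))
      (Ideal.Quotient.mk _ (MvPowerSeries.map (algebraMap ℂ A) g)) := by
  rw [HasSum, nhds_iInf, tendsto_iInf]
  intro φ
  rw [nhds_induced, tendsto_comap_iff]
  obtain ⟨D, c, hc⟩ := φ.2.exists_eq_sum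
  have h1 : HasSum (fun m => φ.1 (Ideal.Quotient.mk _ (MvPowerSeries.map (algebraMap ℂ A) (f m))))
      (φ.1 (Ideal.Quotient.mk _ (MvPowerSeries.map (algebraMap ℂ A) g))) := by
    simp only [hc]
    exact hasSum_sum fun α _ => (h α).mul_left (c α)
  refine Tendsto.congr (fun S => ?_) h1
  rw [Function.comp_apply, map_sum]

theorem coeffAnalyticAt_mk_map {f : ℂ → HFree n ℂ} {w : ℂ}
    (h : ∀ α, AnalyticAt ℂ (fun u => MvPowerSeries.coeff α (f u)) w) :
    CoeffAnalyticAt (fun u => (Ideal.Quotient.mk _ (MvPowerSeries.map (algebraMap ℂ A) (f u)) :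
      HX n A s)) w := by
  intro φ hφ
  obtain ⟨D, c, hc⟩ := hφ.exists_eq_sum
  simp only [hc]
  exact Finset.analyticAt_fun_sum D fun α _ => analyticAt_const.mul (h α)

end Topology

/-! ### Localization to the fixed loci -/

section Localization

variable {n : ℕ} {A : Type*} [CommRing A]

theorem expS_sub_expS [Algebra ℂ A] {f g : HBase n A} (hf : MvPowerSeries.constantCoeff f = 0)
    (hg : MvPowerSeries.constantCoeff g = 0) :
    expS f - expS g = expS ((1 / 2 : ℂ) • (f + g)) * ((2 * Complex.I : ℂ) • sinHalf (f - g)) := by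
  have h1 : ∀ (c : ℂ) {h : HBase n A}, MvPowerSeries.constantCoeff h = 0 →
      MvPowerSeries.constantCoeff (c • h) = 0 := fun c h hh => by
    rw [constantCoeff_csmul, hh, smul_zero]
  have hs : MvPowerSeries.constantCoeff (f + g) = 0 := by rw [map_add, hf, hg, add_zero]
  have hd : MvPowerSeries.constantCoeff (f - g) = 0 := by rw [map_sub, hf, hg, sub_zero]
  rw [sinHalf_mul hd, mul_sub, ← expS_add (h1 _ hs) (h1 _ hd), ← expS_add (h1 _ hs) (h1 _ hd)]
  congr 2
  · rw [← smul_add, show f + g + (f - g) = (2 : ℂ) • f by rw [two_smul]; ring, smul_smul]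
    norm_num
  · rw [neg_div, neg_smul, ← sub_eq_add_neg, ← smul_sub,
      show f + g - (f - g) = (2 : ℂ) • g by rw [two_smul]; ring, smul_smul]
    norm_num

theorem constantCoeff_xB (j : Fin n) : MvPowerSeries.constantCoeff (xB n A j) = 0 := by
  simp [xB]

theorem constantCoeff_zB (j : Fin n) : MvPowerSeries.constantCoeff (zB n A j) = 0 := by
  simp [zB]

variable (n A) in
/-- The pullback `Ĥ_T(B) → H^*(B)[[x_j, z_i, y]]`. -/
def pullbackFree : HBase n A →ₐ[A] HFree n A :=
  MvPowerSeries.substAlgHom (some_hasSubst (n := n) (A := A))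

theorem pullback_apply (s : Chamber) (f : HBase n A) :
    pullback n A s f = Ideal.Quotient.mk _ (pullbackFree n A f) := rfl

theorem pullbackFree_X (i : BaseVar n) :
    pullbackFree n A (MvPowerSeries.X i) = MvPowerSeries.X (some i) :=
  MvPowerSeries.substAlgHom_X (R := A) (some_hasSubst (n := n) (A := A)) i

/-- The class `∏_{j ≠ k}` of the weights along the projective bundle; it is the class of the
restriction of `X_±` to the `k`-th fixed section. -/
def sectionClass (s : Chamber) (k : Fin n) : HX n A s :=
  Ideal.Quotient.mk _ (∏ j ∈ Finset.univ.erase k, weight A s j)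

theorem sectionClass_mul_weight (s : Chamber) (k : Fin n) :
    sectionClass (A := A) s k * Ideal.Quotient.mk _ (weight A s k) = 0 := by
  rw [sectionClass, ← map_mul, Finset.prod_erase_mul _ _ (Finset.mem_univ k)]
  exact Ideal.Quotient.eq_zero_iff_mem.2 (Ideal.subset_span rfl)

/-- Multiplication by the class of a section of the projective bundle factors over the restriction
to that section. For polynomials this follows from the relation that holds for `y`; the general case
follows by continuity. -/
theorem sectionClass_mul_mk [Algebra ℂ A] (s : Chamber) (k : Fin n) (f : HFree n A) :
    sectionClass s k * Ideal.Quotient.mk _ f =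
      sectionClass s k * pullback n A s (restrictFree s k f) := by
  classical
  have hX : ∀ i, sectionClass (A := A) s k * Ideal.Quotient.mk _ (MvPowerSeries.X i) =
      sectionClass s k * pullback n A s (restrictFree s k (MvPowerSeries.X i)) := by
    intro i
    rw [restrictFree_X, pullback_apply]
    rcases i with _ | i
    · have h := sectionClass_mul_weight (A := A) s k
      cases s
      · rw [restrictVar, root, xB, map_neg, pullbackFree_X, ← sub_eq_zero, ← mul_sub, ← map_sub]
        rw [weight] at h
        rw [← neg_eq_zero, ← mul_neg, ← map_neg, ← h]
        congr 2
        rw [xF, yF]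
        ring
      · rw [restrictVar, root, zB, map_neg, pullbackFree_X, ← sub_eq_zero, ← mul_sub, ← map_sub]
        rw [weight] at h
        rw [← h]
        congr 2
        rw [zF, yF]
        ring
    · rw [restrictVar, pullbackFree_X]
  -- the subalgebra on which the statement holds contains the polynomials
  let S : Subalgebra A (HFree n A) :=
    { carrier := {f | sectionClass s k * Ideal.Quotient.mk _ f =
        sectionClass s k * pullback n A s (restrictFree s k f)}
      mul_mem' := by
        intro f g hf hg
        simp only [Set.mem_ofPred_eq, map_mul] at hf hg ⊢
        rw [← mul_assoc, hf, mul_right_comm, hg]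
        ring
      add_mem' := by
        intro f g hf hg
        simp only [Set.mem_ofPred_eq, map_add] at hf hg ⊢
        rw [mul_add, mul_add, hf, hg]
      algebraMap_mem' := by
        intro a
        simp only [Set.mem_ofPred_eq]
        rw [AlgHom.commutes, pullback_apply, AlgHom.commutes] }
  have hmono : ∀ (α : Option (BaseVar n) →₀ ℕ) (a : A), MvPowerSeries.monomial α a ∈ S := by
    intro α a
    have : MvPowerSeries.monomial α a = a • MvPowerSeries.monomial α (1 : A) := by
      rw [← map_smul, smul_eq_mul, mul_one]
    rw [this, MvPowerSeries.monomial_one_eq]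
    exact S.smul_mem (S.prod_mem fun i _ => S.pow_mem (hX i) _) _
  have hpoly : ∀ (D : Finset (Option (BaseVar n) →₀ ℕ)) (c : (Option (BaseVar n) →₀ ℕ) → A),
      ∑ α ∈ D, MvPowerSeries.monomial α (c α) ∈ S := fun D c =>
    S.sum_mem fun α _ => hmono α _
  rw [← sub_eq_zero]
  refine eq_zero_of_isCoeffFunctional fun φ hφ => ?_
  obtain ⟨D, hD⟩ := hφ
  obtain ⟨e, he⟩ : ∃ e : HFree n A, Ideal.Quotient.mk _ e = sectionClass (A := A) s k :=
    Ideal.Quotient.mk_surjective _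
  choose D₁ c₁ h₁ using exists_coeff_substAlgHom_eq_sum (restrictVar_hasSubst (A := A) s k)
  choose D₂ c₂ h₂ using exists_coeff_substAlgHom_eq_sum (some_hasSubst (n := n) (A := A))
  -- the coefficients of a series that the functional depends on
  set D' : Finset (Option (BaseVar n) →₀ ℕ) := D.biUnion fun m =>
    (Finset.HasAntidiagonal.antidiagonal m).biUnion fun p => {p.2} ∪ (D₂ p.2).biUnion fun q => D₁ q
    with hD'
  have hvan : ∀ g : HFree n A, (∀ α ∈ D', MvPowerSeries.coeff α g = 0) →
      φ (sectionClass s k * Ideal.Quotient.mk _ g -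
        sectionClass s k * pullback n A s (restrictFree s k g)) = 0 := by
    intro g hg
    rw [pullback_apply, ← he, ← mul_sub, ← map_sub, ← map_mul]
    refine hD _ fun m hm => ?_
    rw [MvPowerSeries.coeff_mul]
    refine Finset.sum_eq_zero fun p hp => ?_
    have e1 : MvPowerSeries.coeff p.2 g = 0 := hg _ (Finset.mem_biUnion.2 ⟨m, hm,
      Finset.mem_biUnion.2 ⟨p, hp, Finset.mem_union_left _ (Finset.mem_singleton_self _)⟩⟩)
    have e2 : MvPowerSeries.coeff p.2 (pullbackFree n A (restrictFree s k g)) = 0 := by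
      refine (h₂ p.2 _).trans (Finset.sum_eq_zero fun q hq => ?_)
      have e3 : MvPowerSeries.coeff q (restrictFree s k g) = 0 := by
        refine (h₁ q g).trans (Finset.sum_eq_zero fun α hα => ?_)
        rw [hg, zero_mul]
        exact Finset.mem_biUnion.2 ⟨m, hm, Finset.mem_biUnion.2 ⟨p, hp,
          Finset.mem_union_right _ (Finset.mem_biUnion.2 ⟨q, hq, hα⟩)⟩⟩
      rw [e3, zero_mul]
    rw [map_sub, e1, e2, sub_zero, mul_zero]
  set P : HFree n A := ∑ α ∈ D', MvPowerSeries.monomial α (MvPowerSeries.coeff α f) with hP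
  have h0 := hvan (f - P) (by
    intro α hα
    rw [map_sub, hP, map_sum, Finset.sum_eq_single α]
    · rw [MvPowerSeries.coeff_monomial_same, sub_self]
    · intro β _ hβ
      rw [MvPowerSeries.coeff_monomial, if_neg hβ.symm]
    · exact fun h => absurd hα h)
  have hPS : sectionClass s k * Ideal.Quotient.mk _ P =
      sectionClass s k * pullback n A s (restrictFree s k P) := hpoly D' _
  simp only [map_sub, mul_sub, hPS] at h0
  rw [map_sub]
  linear_combination h0

theorem map_xF [Algebra ℂ A] (j : Fin n) :
    MvPowerSeries.map (algebraMap ℂ A) (xF n ℂ j) = xF n A j := by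
  simp [xF]

theorem xF_injective : Function.Injective (xF n ℂ) := by
  classical
  intro i j h
  by_contra hij
  have := congrArg (MvPowerSeries.coeff (Finsupp.single (some (Sum.inl i)) 1)) h
  rw [xF, xF, MvPowerSeries.coeff_index_single_self_X, MvPowerSeries.coeff_index_single_X,
    if_neg (by simpa using hij)] at this
  exact one_ne_zero this

/-- Lagrange interpolation in the Chern roots. -/
theorem sum_nodeCofactor_mul_prod_weight [Algebra ℂ A] [NeZero n] :
    ∑ l, nodeCofactor (xF n A) l * ∏ j ∈ Finset.univ.erase l, weight A .plus j =
      nodeDiscr (xF n A) := by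
  have h := congrArg (MvPowerSeries.map (algebraMap ℂ A))
    (sum_nodeCofactor_mul_nodeProd (xF_injective (n := n)) (-yF n ℂ))
  rw [map_sum, map_nodeDiscr] at h
  simp only [map_mul, map_nodeCofactor, map_nodeProd, map_xF] at h
  rw [← h]
  refine Finset.sum_congr rfl fun l _ => ?_
  congr 1
  refine Finset.prod_congr rfl fun j _ => ?_
  rw [weight, map_neg, yF, yF, MvPowerSeries.map_X]
  ring

theorem pullbackFree_xB (j : Fin n) : pullbackFree n A (xB n A j) = xF n A j :=
  pullbackFree_X _

theorem restrictFree_plus_weight_plus (l j : Fin n) :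
    restrictFree (A := A) .plus l (weight A .plus j) = xB n A l - xB n A j := by
  simp [weight, xF, yF, restrictFree_X, restrictVar, root, xB]
  ring

theorem restrict_mk (s : Chamber) (k : Fin n) (f : HFree n A) :
    restrict s k (Ideal.Quotient.mk _ f) = restrictFree s k f := rfl

variable [Algebra ℂ A]

theorem isUnit_nodeDiscr_xB :
    IsUnit (algebraMap (HBase n A) (HBaseLoc n A) (nodeDiscr (xB n A))) := by
  rw [nodeDiscr, map_prod, IsUnit.prod_univ_iff]
  intro k
  rw [nodeProd, map_prod, IsUnit.prod_iff]
  intro i hi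
  exact IsLocalization.map_units (M := baseDenominators n A) (HBaseLoc n A)
    ⟨_, sub_mem_baseDenominators (by simpa using (Finset.ne_of_mem_erase hi).symm)⟩

/-- The pushforward from a fixed locus of the quotient of a restriction by the Euler class. -/
theorem pushforward_divEuler_restrictFree (s : Chamber) (l : Fin n) (f : HFree n A) :
    pushforward s l (divEuler s l (algebraMap _ _ (restrictFree s l f))) =
      toLoc n A s (Ideal.Quotient.mk _ f) * pushforward s l (divEuler s l 1) := by
  have h : fixedClass s l * pullback n A s (restrictFree s l f) =
      fixedClass s l * Ideal.Quotient.mk _ f := by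
    have e : fixedClass (A := A) s l =
        sectionClass s l * Ideal.Quotient.mk _ (∏ i, weight A s.swap i) := by
      rw [sectionClass, ← map_mul]
      rfl
    rw [e, mul_right_comm, ← sectionClass_mul_mk, mul_right_comm]
  have h' := congrArg (algebraMap (HX n A s) (HXLoc n A s)) h
  rw [map_mul, map_mul] at h'
  rw [pushforward, divEuler, pushforward, divEuler, map_mul, map_mul, map_one,
    pullbackLoc_algebraMap, toLoc]
  linear_combination (pullbackLoc n A s (Ring.inverse
    (algebraMap (HBase n A) (HBaseLoc n A) (eulerNormal s l)))) * h'

/-- The class `1` is the sum of the pushforwards of the inverse Euler classes. -/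
theorem sum_pushforward_divEuler_one [NeZero n] :
    ∑ l, pushforward .plus l (divEuler .plus l (1 : HBaseLoc n A)) = 1 := by
  have hu := (isUnit_nodeDiscr_xB (n := n) (A := A)).map (pullbackLoc n A .plus)
  apply hu.mul_left_cancel
  rw [mul_one, Finset.mul_sum]
  have hl : ∀ l, pullbackLoc n A .plus (algebraMap _ _ (nodeDiscr (xB n A))) *
      pushforward .plus l (divEuler .plus l (1 : HBaseLoc n A)) =
      algebraMap _ _ (pullback n A .plus (nodeCofactor (xB n A) l) * sectionClass .plus l) := by
    intro l
    set E : HBase n A := ∏ i, restrictFree .plus l (weight A Chamber.plus.swap i) with hE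
    have e1 : fixedClass (A := A) .plus l = sectionClass .plus l * pullback n A .plus E := by
      have : fixedClass (A := A) .plus l = sectionClass .plus l *
          Ideal.Quotient.mk _ (∏ i, weight A Chamber.plus.swap i) := by
        rw [sectionClass, ← map_mul]
        rfl
      rw [this, sectionClass_mul_mk, map_prod]
    have e2 : eulerNormal (A := A) .plus l = nodeProd (xB n A) l (xB n A l) * E := by
      rw [eulerNormal, hE]
      simp only [restrictFree_plus_weight_plus]
      rfl
    have e3 : nodeDiscr (xB n A) * E = nodeCofactor (xB n A) l * eulerNormal .plus l := by
      rw [e2, ← nodeCofactor_mul _ l]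
      ring
    have e4 : algebraMap (HBase n A) (HBaseLoc n A) (nodeDiscr (xB n A)) *
        Ring.inverse (algebraMap (HBase n A) (HBaseLoc n A) (eulerNormal .plus l)) *
        algebraMap (HBase n A) (HBaseLoc n A) E =
        algebraMap (HBase n A) (HBaseLoc n A) (nodeCofactor (xB n A) l) := by
      rw [mul_right_comm, ← map_mul, e3, map_mul, mul_assoc,
        Ring.mul_inverse_cancel _ (isUnit_eulerNormal _ l), mul_one]
    have e5 := congrArg (pullbackLoc n A .plus) e4
    rw [map_mul, map_mul, pullbackLoc_algebraMap, pullbackLoc_algebraMap,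
      pullbackLoc_algebraMap] at e5
    rw [pushforward, divEuler, one_mul, e1, map_mul, map_mul, pullbackLoc_algebraMap, ← e5]
    ring
  rw [Finset.sum_congr rfl fun l _ => hl l, ← map_sum, pullbackLoc_algebraMap]
  congr 1
  have h := congrArg (Ideal.Quotient.mk (Ideal.span {relation n A .plus}))
    (sum_nodeCofactor_mul_prod_weight (n := n) (A := A))
  have ex : ∀ l, pullbackFree n A (nodeCofactor (xB n A) l) = nodeCofactor (xF n A) l := fun l => by
    have := map_nodeCofactor (pullbackFree n A).toRingHom (xB n A) l
    refine this.trans ?_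
    exact congrArg (fun x => nodeCofactor x l) (funext fun j => pullbackFree_xB j)
  have ed : pullbackFree n A (nodeDiscr (xB n A)) = nodeDiscr (xF n A) := by
    have := map_nodeDiscr (pullbackFree n A).toRingHom (xB n A)
    refine this.trans ?_
    exact congrArg (fun x => nodeDiscr x) (funext fun j => pullbackFree_xB j)
  rw [map_sum] at h
  simp only [pullback_apply, ex, ed, ← h, map_mul]
  rfl

/-- The localization theorem for `X₊`: a class is the sum of the pushforwards of its restrictions to
the fixed loci, divided by the Euler classes of the normal bundles. -/
theorem toLoc_eq_sum_pushforward [NeZero n] (f : HFree n A) :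
    toLoc n A .plus (Ideal.Quotient.mk _ f) =
      ∑ l, pushforward .plus l (divEuler .plus l (algebraMap _ _ (restrictFree .plus l f))) := by
  simp only [pushforward_divEuler_restrictFree]
  rw [← Finset.mul_sum, sum_pushforward_divEuler_one, mul_one]

theorem isUnit_expS_sub {i k : Fin n} (h : k ≠ i) :
    IsUnit (algebraMap (HBase n A) (HBaseLoc n A) (expS (zB n A k) - expS (zB n A i))) := by
  rw [expS_sub_expS (constantCoeff_zB _) (constantCoeff_zB _), map_mul]
  refine IsUnit.mul (IsUnit.map _ ?_) ?_
  · rw [MvPowerSeries.isUnit_iff_constantCoeff, constantCoeff_expS]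
    · exact isUnit_one
    · rw [constantCoeff_csmul, map_add, constantCoeff_zB, constantCoeff_zB, add_zero, smul_zero]
  · rw [algebra_compatible_smul A, Algebra.smul_def, map_mul]
    refine IsUnit.mul ?_ (isUnit_sinHalf_sub h)
    rw [← IsScalarTower.algebraMap_apply ℂ A]
    exact ((IsUnit.mk0 (2 * Complex.I : ℂ) (by simp)).map
      (algebraMap ℂ (HBase n A))).map (algebraMap _ _)

theorem isUnit_nodeDiscr_expS :
    IsUnit (algebraMap (HBase n A) (HBaseLoc n A) (nodeDiscr fun i => expS (zB n A i))) := by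
  rw [nodeDiscr, map_prod, IsUnit.prod_univ_iff]
  intro k
  rw [nodeProd, map_prod, IsUnit.prod_iff]
  intro i hi
  exact isUnit_expS_sub (Finset.ne_of_mem_erase hi).symm

/-- The half-angle factors `e^{(f - g)/2}` turn a ratio of sines into a ratio of differences of
exponentials. -/
theorem expS_sub_mul_sinHalf {f g h : HBase n A} (hf : MvPowerSeries.constantCoeff f = 0)
    (hg : MvPowerSeries.constantCoeff g = 0) (hh : MvPowerSeries.constantCoeff h = 0) :
    (expS g - expS h) * (expS ((1 / 2 : ℂ) • (f - g)) * sinHalf (f - h)) =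
      (expS f - expS h) * sinHalf (g - h) := by
  have e : expS ((1 / 2 : ℂ) • (f + h)) =
      expS ((1 / 2 : ℂ) • (g + h)) * expS ((1 / 2 : ℂ) • (f - g)) := by
    rw [← expS_add, ← smul_add]
    · congr 2
      ring
    · rw [constantCoeff_csmul, map_add, hg, hh, add_zero, smul_zero]
    · rw [constantCoeff_csmul, map_sub, hf, hg, sub_zero, smul_zero]
  rw [expS_sub_expS hg hh, expS_sub_expS hf hh, e]
  simp only [mul_smul_comm, smul_mul_assoc]
  congr 1
  ring

/-- The coefficients of the transformation `U_H` are the values at the fixed loci of the Lagrange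
basis for the nodes `e^{z_i}`. -/
theorem coeffC_mul_nodeProd (k l : Fin n) :
    coeffC A k l * algebraMap _ _ (nodeProd (fun i => expS (zB n A i)) k (expS (zB n A k))) =
      algebraMap _ _ (nodeProd (fun i => expS (zB n A i)) k (expS (xB n A l))) := by
  have hx := constantCoeff_xB (n := n) (A := A)
  have hz := constantCoeff_zB (n := n) (A := A)
  have hn : 0 < n := Fin.pos k
  have e1 : expS ((((n : ℂ) - 1) / 2) • (xB n A l - zB n A k)) =
      ∏ _i ∈ Finset.univ.erase k, expS ((1 / 2 : ℂ) • (xB n A l - zB n A k)) := by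
    rw [Finset.prod_const, Finset.card_erase_of_mem (Finset.mem_univ k), Finset.card_univ,
      Fintype.card_fin, ← expS_nsmul, smul_smul]
    · congr 2
      rw [Nat.cast_sub hn]
      push_cast
      ring
    · rw [constantCoeff_csmul, map_sub, hx, hz, sub_zero, smul_zero]
  have e2 : nodeProd (fun i => expS (zB n A i)) k (expS (zB n A k)) *
      (expS ((((n : ℂ) - 1) / 2) • (xB n A l - zB n A k)) *
        ∏ i ∈ Finset.univ.erase k, sinHalf (xB n A l - zB n A i)) =
      nodeProd (fun i => expS (zB n A i)) k (expS (xB n A l)) *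
        ∏ i ∈ Finset.univ.erase k, sinHalf (zB n A k - zB n A i) := by
    rw [e1, nodeProd, nodeProd, ← Finset.prod_mul_distrib, ← Finset.prod_mul_distrib,
      ← Finset.prod_mul_distrib]
    exact Finset.prod_congr rfl fun i _ => expS_sub_mul_sinHalf (hx l) (hz k) (hz i)
  have hu : IsUnit (algebraMap (HBase n A) (HBaseLoc n A)
      (∏ i ∈ Finset.univ.erase k, sinHalf (zB n A k - zB n A i))) := by
    rw [map_prod, IsUnit.prod_iff]
    exact fun i hi => isUnit_sinHalf_sub (Finset.ne_of_mem_erase hi).symm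
  rw [mul_comm] at e2
  rw [coeffC, mul_right_comm, ← map_mul, e2, map_mul, mul_assoc, Ring.mul_inverse_cancel _ hu,
    mul_one]

end Localization

/-! ### Coefficientwise sums of power series -/

section CoeffSum

variable {σ ι : Type*}

/-- Coefficientwise convergence of a series of power series. -/
def HasCoeffSum (f : ι → MvPowerSeries σ ℂ) (g : MvPowerSeries σ ℂ) : Prop :=
  ∀ α, HasSum (fun m => MvPowerSeries.coeff α (f m)) (MvPowerSeries.coeff α g)

theorem HasCoeffSum.mul_left {f : ι → MvPowerSeries σ ℂ} {g : MvPowerSeries σ ℂ}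
    (h : HasCoeffSum f g) (c : MvPowerSeries σ ℂ) : HasCoeffSum (fun m => c * f m) (c * g) := by
  classical
  intro α
  simp only [MvPowerSeries.coeff_mul]
  exact hasSum_sum fun p _ => (h p.2).mul_left _

theorem HasCoeffSum.sum {κ : Type*} (D : Finset κ) {f : κ → ι → MvPowerSeries σ ℂ}
    {g : κ → MvPowerSeries σ ℂ} (h : ∀ k, HasCoeffSum (f k) (g k)) :
    HasCoeffSum (fun m => ∑ k ∈ D, f k m) (∑ k ∈ D, g k) := by
  intro α
  simp only [map_sum]
  exact hasSum_sum fun k _ => h k α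

theorem HasCoeffSum.unique {f : ι → MvPowerSeries σ ℂ} {g g' : MvPowerSeries σ ℂ}
    (h : HasCoeffSum f g) (h' : HasCoeffSum f g') : g = g' := by
  ext α
  exact (h α).unique (h' α)

theorem HasCoeffSum.setY {n : ℕ} {c : HFree n ℂ} (hc : MvPowerSeries.constantCoeff c = 0)
    {f : ι → HFree n ℂ} {g : HFree n ℂ} (h : HasCoeffSum f g) :
    HasCoeffSum (fun m => setY hc (f m)) (setY hc g) := by
  intro β
  obtain ⟨D, k, hD⟩ := exists_coeff_substAlgHom_eq_sum (setYVar_hasSubst hc) β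
  have hD' : ∀ f, MvPowerSeries.coeff β (ToricFlop.setY hc f) =
      ∑ α ∈ D, MvPowerSeries.coeff α f * k α := hD
  simp only [hD']
  exact hasSum_sum fun α _ => (h α).mul_right _

end CoeffSum

/-! ### The analytic continuation -/

section Continuation

variable {n : ℕ} (a b : Fin n → ℤ)

/-- The sum of the hypergeometric terms over the indices in `S`. -/
def hyperSum (S : Set ℤ) (w : ℂ) : HFree n ℂ :=
  fun α => ∑' m, S.indicator (fun m : ℤ => MvPowerSeries.coeff α (hyperTerm a b w m)) m

/-- The sum of the residues of the Barnes integrand over the indices in `S`. -/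
def residueSum (S : Set ℤ) (w : ℂ) : HFree n ℂ :=
  fun α => ∑' m, S.indicator
    (fun m : ℤ => residueInt (fun s => MvPowerSeries.coeff α (barnesKernel a b s)) m w) m

/-- The Barnes integral over the line `Re s = m₀ - 1/2`. -/
def barnesIntegral (m₀ : ℤ) (w : ℂ) : HFree n ℂ :=
  fun α => lineInt (fun s => MvPowerSeries.coeff α (barnesKernel a b s)) m₀ w

theorem coeff_indicator {σ : Type*} (S : Set ℤ) (f : ℤ → MvPowerSeries σ ℂ) (m : ℤ) (α : σ →₀ ℕ) :
    MvPowerSeries.coeff α (S.indicator f m) =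
      S.indicator (fun m => MvPowerSeries.coeff α (f m)) m := by
  by_cases h : m ∈ S
  · rw [Set.indicator_of_mem h, Set.indicator_of_mem h]
  · rw [Set.indicator_of_notMem h, Set.indicator_of_notMem h, map_zero]

theorem hasCoeffSum_hyperSum_Ici (m₀ : ℤ) {w : ℂ} (hw : w.re < 0) :
    HasCoeffSum ((Set.Ici m₀).indicator fun m : ℤ => hyperTerm a b w m)
      (hyperSum a b (Set.Ici m₀) w) := by
  intro α
  simp only [coeff_indicator]
  exact ((isLaurentLike_coeff_hyperTerm a b α).summable_Ici m₀ hw).hasSum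

theorem hasCoeffSum_hyperSum_Iio (m₁ : ℤ) {w : ℂ} (hw : 0 < w.re) :
    HasCoeffSum ((Set.Iio m₁).indicator fun m : ℤ => hyperTerm a b w m)
      (hyperSum a b (Set.Iio m₁) w) := by
  intro α
  simp only [coeff_indicator]
  exact ((isLaurentLike_coeff_hyperTerm a b α).summable_Iio m₁ hw).hasSum

theorem hasCoeffSum_residueSum_Iio (m₁ : ℤ) {w : ℂ} (hw : 0 < w.re) :
    HasCoeffSum ((Set.Iio m₁).indicator fun m : ℤ => barnesResidue a b w m)
      (residueSum a b (Set.Iio m₁) w) := by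
  intro α
  simp only [coeff_indicator]
  exact ((isBarnesKernel_coeff a b α).isLaurentLike_residueInt.summable_Iio m₁ hw).hasSum

theorem hasSum_coeff_hyperTerm_Ico (m₁ m₀ : ℤ) (w : ℂ) (α : Option (BaseVar n) →₀ ℕ) :
    HasSum (fun m => MvPowerSeries.coeff α
      ((Finset.Ico m₁ m₀ : Set ℤ).indicator (fun m : ℤ => hyperTerm a b w m) m))
      (∑ m ∈ Finset.Ico m₁ m₀, MvPowerSeries.coeff α (hyperTerm a b w m)) := by
  simp only [coeff_indicator]
  rw [← Finset.sum_indicator_subset _ (Finset.Subset.refl _)]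
  exact hasSum_sum_of_ne_finset_zero fun m hm => Set.indicator_of_notMem hm _

variable {a b} {A : Type*} [CommRing A] [Algebra ℂ A]

theorem mk_map_eq_zero {s : Chamber} {f : HFree n ℂ} (h : relation n ℂ s ∣ f) :
    (Ideal.Quotient.mk _ (MvPowerSeries.map (algebraMap ℂ A) f) : HX n A s) = 0 := by
  rw [Ideal.Quotient.eq_zero_iff_dvd]
  have h' := map_dvd (MvPowerSeries.map (algebraMap ℂ A)) h
  have e : MvPowerSeries.map (algebraMap ℂ A) (relation n ℂ s) = relation n A s := by
    rw [relation, map_prod]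
    exact Finset.prod_congr rfl fun i _ => map_weight s i
  rwa [e] at h'

theorem hasSum_plusTerm {m₁ : ℤ} (h₁ : ∀ m < m₁, ∀ j, 1 + a j + m ≤ 0) {w : ℂ} (hw : w.re < 0) :
    HasSum (plusTerm A a b w)
      (Ideal.Quotient.mk _ (MvPowerSeries.map (algebraMap ℂ A) (hyperSum a b (Set.Ici m₁) w))) := by
  refine (hasSum_mk_map (A := A) (s := .plus) (hasCoeffSum_hyperSum_Ici a b m₁ hw)).congr_fun ?_
  intro m
  rw [plusTerm_eq]
  by_cases hm : m ∈ Set.Ici m₁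
  · rw [Set.indicator_of_mem hm]
  · rw [Set.indicator_of_notMem hm, map_zero, map_zero,
      mk_map_eq_zero (relation_plus_dvd_hyperTerm (h₁ m (not_le.1 hm)) w)]

theorem hasSum_minusTerm {m₀ : ℤ} (h₀ : ∀ m, m₀ ≤ m → ∀ j, 1 - b j - m ≤ 0) {w : ℂ}
    (hw : 0 < w.re) : HasSum (minusTerm A a b (-w))
      (Ideal.Quotient.mk _ (MvPowerSeries.map (algebraMap ℂ A) (hyperSum a b (Set.Iio m₀) w))) := by
  rw [← (Equiv.neg ℤ).hasSum_iff]
  refine (hasSum_mk_map (A := A) (s := .minus) (hasCoeffSum_hyperSum_Iio a b m₀ hw)).congr_fun ?_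
  intro m
  rw [Function.comp_apply, Equiv.neg_apply, minusTerm_neg_eq]
  by_cases hm : m ∈ Set.Iio m₀
  · rw [Set.indicator_of_mem hm]
  · rw [Set.indicator_of_notMem hm, map_zero, map_zero,
      mk_map_eq_zero (relation_minus_dvd_hyperTerm (h₀ m (not_lt.1 hm)) w)]

variable (a b) in
/-- The continuation near the imaginary axis: finitely many hypergeometric terms, and the Barnes
integral in place of the others. -/
def middleSum (m₁ m₀ : ℤ) (w : ℂ) : HFree n ℂ :=
  (∑ m ∈ Finset.Ico m₁ m₀, hyperTerm a b w m) - barnesIntegral a b m₀ w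

variable (a b) in
/-- The continuation to the right half plane: the hypergeometric terms with index less than `m₀`,
corrected by the residues that arise when the Barnes integral is closed to the left. -/
def rightSum (m₀ : ℤ) (w : ℂ) : HFree n ℂ :=
  hyperSum a b (Set.Iio m₀) w - residueSum a b (Set.Iio m₀) w

/-- In the left half plane the Barnes integral is closed to the right, where its residues are the
hypergeometric terms. -/
theorem hyperSum_Ici_eq_middleSum [NeZero n] {m₁ m₀ : ℤ} (h : m₁ ≤ m₀)
    (h₀ : ∀ m, m₀ ≤ m → ∀ j, 1 - b j - m ≤ 0) {w : ℂ} (hw : w.re < 0)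
    (hs : w ∈ barnesStrip (((n : ℝ) - 1) * Real.pi)) :
    hyperSum a b (Set.Ici m₁) w = middleSum a b m₁ m₀ w := by
  refine (hasCoeffSum_hyperSum_Ici a b m₁ hw).unique fun α => ?_
  have h1 := hasSum_coeff_hyperTerm_Ico a b m₁ m₀ w α
  have h2 := (isBarnesKernel_coeff a b α).hasSum_Ici hs hw m₀
  rw [middleSum, map_sub, map_sum, sub_eq_add_neg]
  refine (h1.add h2).congr_fun fun m => ?_
  rw [coeff_indicator, coeff_indicator]
  by_cases hm : m₀ ≤ m
  · rw [Set.indicator_of_mem (Set.mem_Ici.2 (h.trans hm)), Set.indicator_of_notMem (by simp [hm]),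
      Set.indicator_of_mem (Set.mem_Ici.2 hm), zero_add, ← coeff_barnesResidue,
      barnesResidue_eq (h₀ m hm)]
  · rw [Set.indicator_of_notMem (s := Set.Ici m₀) hm, add_zero]
    by_cases hm' : m₁ ≤ m
    · rw [Set.indicator_of_mem (Set.mem_Ici.2 hm'),
        Set.indicator_of_mem (by simpa using ⟨hm', not_le.1 hm⟩)]
    · rw [Set.indicator_of_notMem (s := Set.Ici m₁) hm', Set.indicator_of_notMem (by simp [hm'])]

/-- In the right half plane the Barnes integral is closed to the left. The hypergeometric terms with
index less than `m₁`, which are added here, vanish in the cohomology of `X₊`. -/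
theorem mk_rightSum_eq_mk_middleSum {m₁ m₀ : ℤ} (h : m₁ ≤ m₀)
    (h₁ : ∀ m < m₁, ∀ j, 1 + a j + m ≤ 0) {w : ℂ} (hw : 0 < w.re)
    (hs : w ∈ barnesStrip (((n : ℝ) - 1) * Real.pi)) :
    (Ideal.Quotient.mk _ (MvPowerSeries.map (algebraMap ℂ A) (rightSum a b m₀ w)) : HX n A .plus) =
      Ideal.Quotient.mk _ (MvPowerSeries.map (algebraMap ℂ A) (middleSum a b m₁ m₀ w)) := by
  have e1 : residueSum a b (Set.Iio m₀) w = barnesIntegral a b m₀ w := by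
    ext α
    exact ((isBarnesKernel_coeff a b α).hasSum_Iio hs hw m₀).tsum_eq
  have e2 : hyperSum a b (Set.Iio m₀) w =
      hyperSum a b (Set.Iio m₁) w + ∑ m ∈ Finset.Ico m₁ m₀, hyperTerm a b w m := by
    refine (hasCoeffSum_hyperSum_Iio a b m₀ hw).unique fun α => ?_
    have h1 := hasSum_coeff_hyperTerm_Ico a b m₁ m₀ w α
    rw [map_add, map_sum]
    refine ((hasCoeffSum_hyperSum_Iio a b m₁ hw α).add h1).congr_fun fun m => ?_
    rw [← map_add]
    congr 1
    by_cases hm : m < m₁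
    · rw [Set.indicator_of_mem (Set.mem_Iio.2 (hm.trans_le h)),
        Set.indicator_of_mem (Set.mem_Iio.2 hm), Set.indicator_of_notMem (by simp [hm]), add_zero]
    · rw [Set.indicator_of_notMem (s := Set.Iio m₁) hm, zero_add]
      by_cases hm' : m < m₀
      · rw [Set.indicator_of_mem (Set.mem_Iio.2 hm'),
          Set.indicator_of_mem (by simpa using ⟨not_lt.1 hm, hm'⟩)]
      · rw [Set.indicator_of_notMem (s := Set.Iio m₀) hm',
          Set.indicator_of_notMem (by simp [not_lt.1 hm'])]
  have e3 : (Ideal.Quotient.mk _ (MvPowerSeries.map (algebraMap ℂ A)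
      (hyperSum a b (Set.Iio m₁) w)) : HX n A .plus) = 0 := by
    refine (hasSum_mk_map (A := A) (s := .plus) (hasCoeffSum_hyperSum_Iio a b m₁ hw)).unique ?_
    refine hasSum_zero.congr_fun fun m => ?_
    by_cases hm : m ∈ Set.Iio m₁
    · rw [Set.indicator_of_mem hm, mk_map_eq_zero (relation_plus_dvd_hyperTerm (h₁ m hm) w)]
    · rw [Set.indicator_of_notMem hm, map_zero, map_zero]
  rw [rightSum, middleSum, e1, e2, add_sub_assoc, map_add, map_add, e3, zero_add]

theorem analyticAt_coeff_hyperSum_Ici (m₁ : ℤ) {w : ℂ} (hw : w.re < 0)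
    (α : Option (BaseVar n) →₀ ℕ) :
    AnalyticAt ℂ (fun u => MvPowerSeries.coeff α (hyperSum a b (Set.Ici m₁) u)) w :=
  ((isLaurentLike_coeff_hyperTerm a b α).differentiableOn_Ici m₁).analyticAt
    ((isOpen_lt Complex.continuous_re continuous_const).mem_nhds hw)

theorem analyticAt_coeff_rightSum (m₀ : ℤ) {w : ℂ} (hw : 0 < w.re)
    (α : Option (BaseVar n) →₀ ℕ) :
    AnalyticAt ℂ (fun u => MvPowerSeries.coeff α (rightSum a b m₀ u)) w := by
  have hmem := (isOpen_lt continuous_const Complex.continuous_re).mem_nhds hw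
  simp only [rightSum, map_sub]
  exact (((isLaurentLike_coeff_hyperTerm a b α).differentiableOn_Iio m₀).analyticAt hmem).fun_sub
    (((isBarnesKernel_coeff a b α).isLaurentLike_residueInt.differentiableOn_Iio m₀).analyticAt
      hmem)

theorem analyticAt_coeff_middleSum (m₁ m₀ : ℤ) {w : ℂ}
    (hs : w ∈ barnesStrip (((n : ℝ) - 1) * Real.pi)) (α : Option (BaseVar n) →₀ ℕ) :
    AnalyticAt ℂ (fun u => MvPowerSeries.coeff α (middleSum a b m₁ m₀ u)) w := by
  simp only [middleSum, map_sub, map_sum]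
  refine AnalyticAt.fun_sub (Finset.analyticAt_fun_sum _ fun m _ => ?_) ?_
  · exact ((isLaurentLike_coeff_hyperTerm a b α).differentiable m).analyticAt w
  · exact ((isBarnesKernel_coeff a b α).differentiableOn_lineInt m₀).analyticAt
      ((isOpen_barnesStrip _).mem_nhds hs)

variable (a b A) in
/-- The analytic continuation of `H_{X₊}` along the path `γ`: the series `H_{X₊}` itself as long as
`Re γ(t) < 0`, the Barnes integral where the path meets the imaginary axis, and the sum over the
remaining residues where `Re γ(t) > 0`. -/
def continuation (m₁ m₀ : ℤ) (γ : ℝ → ℂ) (t : ℝ) (w : ℂ) : HX n A .plus :=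
  Ideal.Quotient.mk _ (MvPowerSeries.map (algebraMap ℂ A)
    (if (γ t).re < 0 then hyperSum a b (Set.Ici m₁) w
      else if 0 < (γ t).re then rightSum a b m₀ w else middleSum a b m₁ m₀ w))

theorem isAnalyticContinuation_continuation [NeZero n] {m₁ m₀ : ℤ} (h : m₁ ≤ m₀)
    (h₁ : ∀ m < m₁, ∀ j, 1 + a j + m ≤ 0) (h₀ : ∀ m, m₀ ≤ m → ∀ j, 1 - b j - m ≤ 0)
    {γ : ℝ → ℂ} (hγ : IsContinuationPath n γ) :
    IsAnalyticContinuation γ (HPlus A a b) (continuation a b A m₁ m₀ γ) := by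
  have hL : ∀ {t}, (γ t).re < 0 → continuation a b A m₁ m₀ γ t = fun w =>
      Ideal.Quotient.mk _ (MvPowerSeries.map (algebraMap ℂ A) (hyperSum a b (Set.Ici m₁) w)) := by
    intro t ht
    funext w
    rw [continuation, if_pos ht]
  have hR : ∀ {t}, 0 < (γ t).re → continuation a b A m₁ m₀ γ t = fun w =>
      Ideal.Quotient.mk _ (MvPowerSeries.map (algebraMap ℂ A) (rightSum a b m₀ w)) := by
    intro t ht
    funext w
    rw [continuation, if_neg (not_lt.2 ht.le), if_pos ht]
  have hM : ∀ {t}, (γ t).re = 0 → continuation a b A m₁ m₀ γ t = fun w =>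
      Ideal.Quotient.mk _ (MvPowerSeries.map (algebraMap ℂ A) (middleSum a b m₁ m₀ w)) := by
    intro t ht
    funext w
    rw [continuation, if_neg ht.not_lt, if_neg ht.not_gt]
  have hstrip : ∀ {t}, (γ t).re = 0 → γ t ∈ barnesStrip (((n : ℝ) - 1) * Real.pi) :=
    fun ht => hγ.crossing _ ht
  have hcre : Continuous fun t => (γ t).re := Complex.continuous_re.comp hγ.continuous
  have oL : IsOpen {w : ℂ | w.re < 0} := isOpen_lt Complex.continuous_re continuous_const
  have oR : IsOpen {w : ℂ | 0 < w.re} := isOpen_lt continuous_const Complex.continuous_re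
  refine ⟨fun t => ?_, fun t => ?_, ?_⟩
  · rcases lt_trichotomy (γ t).re 0 with ht | ht | ht
    · rw [hL ht]
      exact coeffAnalyticAt_mk_map (analyticAt_coeff_hyperSum_Ici m₁ ht)
    · rw [hM ht]
      exact coeffAnalyticAt_mk_map (analyticAt_coeff_middleSum m₁ m₀ (hstrip ht))
    · rw [hR ht]
      exact coeffAnalyticAt_mk_map (analyticAt_coeff_rightSum m₀ ht)
  · rcases lt_trichotomy (γ t).re 0 with ht | ht | ht
    · filter_upwards [hcre.continuousAt.eventually_lt continuousAt_const ht] with t' ht'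
      rw [hL ht, hL ht']
    · have hs := hγ.continuous.continuousAt.eventually ((isOpen_barnesStrip _).mem_nhds (hstrip ht))
      filter_upwards [hs] with t' hs'
      rw [hM ht]
      have os := (isOpen_barnesStrip (((n : ℝ) - 1) * Real.pi)).mem_nhds hs'
      rcases lt_trichotomy (γ t').re 0 with ht' | ht' | ht'
      · rw [hL ht']
        filter_upwards [os, oL.mem_nhds ht'] with w hw hw'
        rw [hyperSum_Ici_eq_middleSum h h₀ hw' hw]
      · rw [hM ht']
      · rw [hR ht']
        filter_upwards [os, oR.mem_nhds ht'] with w hw hw'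
        exact mk_rightSum_eq_mk_middleSum h h₁ hw' hw
    · filter_upwards [continuousAt_const.eventually_lt hcre.continuousAt ht] with t' ht'
      rw [hR ht, hR ht']
  · filter_upwards [hγ.start.eventually_lt_atBot 0] with t ht
    rw [hL ht]
    filter_upwards [oL.mem_nhds ht] with w hw
    exact (hasSum_plusTerm h₁ hw).tsum_eq.symm

/-! ### Comparison with the transformation `U_H` -/

/-- By the residue formula the hypergeometric terms cancel, and only their restrictions to the fixed
loci of `X₋` remain. -/
theorem nodeDiscr_mul_rightSum [NeZero n] (m₀ : ℤ) {w : ℂ} (hw : 0 < w.re) :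
    nodeDiscr (zeta n) * rightSum a b m₀ w =
      ∑ k, nodeCofactor (zeta n) k * nodeProd (zeta n) k (eta n) *
        setY (constantCoeff_neg_zF k) (hyperSum a b (Set.Iio m₀) w) := by
  have h1 := hasCoeffSum_hyperSum_Iio a b m₀ hw
  have h2 := hasCoeffSum_residueSum_Iio a b m₀ hw
  have h3 := HasCoeffSum.sum Finset.univ fun k => (h1.setY (constantCoeff_neg_zF k)).mul_left
    (nodeCofactor (zeta n) k * nodeProd (zeta n) k (eta n))
  have h4 : HasCoeffSum (fun m => (Set.Iio m₀).indicator (fun m : ℤ => hyperTerm a b w m) m -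
      (Set.Iio m₀).indicator (fun m : ℤ => barnesResidue a b w m) m) (rightSum a b m₀ w) := by
    intro α
    simp only [rightSum, map_sub]
    exact (h1 α).sub (h2 α)
  refine (h4.mul_left (nodeDiscr (zeta n))).unique fun α => (h3 α).congr_fun fun m => ?_
  congr 1
  by_cases hm : m ∈ Set.Iio m₀
  · simp only [Set.indicator_of_mem hm]
    rw [mul_sub, nodeDiscr_mul_barnesResidue, sub_sub_cancel]
  · simp only [Set.indicator_of_notMem hm, map_zero, mul_zero, sub_self, Finset.sum_const_zero]

theorem restrictFree_expS (s : Chamber) (k : Fin n) {f : HFree n A}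
    (hf : MvPowerSeries.constantCoeff f = 0) :
    restrictFree s k (expS f) = expS (restrictFree s k f) :=
  algHom_subst _ (PowerSeries.HasSubst.of_constantCoeff_zero hf) _

theorem restrictFree_map_zeta (s : Chamber) (k i : Fin n) :
    restrictFree s k (MvPowerSeries.map (algebraMap ℂ A) (zeta n i)) = expS (zB n A i) := by
  rw [zeta, map_expS (constantCoeff_zF i), zF, MvPowerSeries.map_X,
    restrictFree_expS _ _ (by simp), restrictFree_X]
  rfl

theorem restrictFree_map_eta (l : Fin n) :
    restrictFree .plus l (MvPowerSeries.map (algebraMap ℂ A) (eta n)) = expS (xB n A l) := by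
  rw [eta, map_expS constantCoeff_neg_yF, map_neg, yF, MvPowerSeries.map_X,
    restrictFree_expS _ _ (by simp), map_neg, restrictFree_X, restrictVar, root, neg_neg]

theorem restrictFree_map_setY (l k : Fin n) (f : HFree n ℂ) :
    restrictFree .plus l (MvPowerSeries.map (algebraMap ℂ A)
      (setY (constantCoeff_neg_zF k) f)) =
      restrictFree .minus k (MvPowerSeries.map (algebraMap ℂ A) f) := by
  have hc : MvPowerSeries.constantCoeff (-zF n A k) = 0 := by simp [zF]
  rw [setY, map_substAlgHom _ (setYVar_hasSubst hc)]
  · have := MvPowerSeries.substAlgHom_comp_substAlgHom_apply (R := A) (S := A) (T := A)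
      (setYVar_hasSubst hc) (restrictVar_hasSubst .plus l) (MvPowerSeries.map (algebraMap ℂ A) f)
    refine this.trans ?_
    rw [restrictFree, MvPowerSeries.substAlgHom_apply, MvPowerSeries.substAlgHom_apply]
    congr 1
    funext i
    change restrictFree .plus l (setYVar (-zF n A k) i) = _
    rcases i with _ | i
    · rw [setYVar, map_neg, zF, restrictFree_X]
      rfl
    · rw [setYVar, restrictFree_X]
      rfl
  · rintro (_ | i)
    · simp [setYVar, zF]
    · simp [setYVar]

/-- The restrictions of the continuation to the fixed loci of `X₊`, in terms of those of
`H_{X₋}`. -/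
theorem sum_coeffC_mul [NeZero n] (m₀ : ℤ) {w : ℂ} (hw : 0 < w.re) (l : Fin n) :
    ∑ k, coeffC A k l * algebraMap (HBase n A) (HBaseLoc n A) (restrictFree .minus k
      (MvPowerSeries.map (algebraMap ℂ A) (hyperSum a b (Set.Iio m₀) w))) =
    algebraMap (HBase n A) (HBaseLoc n A) (restrictFree .plus l
      (MvPowerSeries.map (algebraMap ℂ A) (rightSum a b m₀ w))) := by
  have h := congrArg ((restrictFree (A := A) .plus l).toRingHom.comp
    (MvPowerSeries.map (algebraMap ℂ A))) (nodeDiscr_mul_rightSum (a := a) (b := b) m₀ hw)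
  have ez : ∀ i, (restrictFree (A := A) .plus l).toRingHom.comp
      (MvPowerSeries.map (algebraMap ℂ A)) (zeta n i) = expS (zB n A i) :=
    fun i => restrictFree_map_zeta _ _ _
  have ee : (restrictFree (A := A) .plus l).toRingHom.comp
      (MvPowerSeries.map (algebraMap ℂ A)) (eta n) = expS (xB n A l) := restrictFree_map_eta l
  have es : ∀ k f, (restrictFree (A := A) .plus l).toRingHom.comp
      (MvPowerSeries.map (algebraMap ℂ A)) (setY (constantCoeff_neg_zF k) f) =
      restrictFree .minus k (MvPowerSeries.map (algebraMap ℂ A) f) :=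
    fun k f => restrictFree_map_setY l k f
  rw [map_mul, map_nodeDiscr, map_sum] at h
  simp only [map_mul, map_nodeCofactor, map_nodeProd, ez, ee, es] at h
  have h' := congrArg (algebraMap (HBase n A) (HBaseLoc n A)) h
  rw [map_mul, map_sum] at h'
  apply (isUnit_nodeDiscr_expS (n := n) (A := A)).mul_left_cancel
  refine Eq.trans ?_ h'.symm
  rw [Finset.mul_sum]
  refine Finset.sum_congr rfl fun k _ => ?_
  rw [map_mul, map_mul, ← coeffC_mul_nodeProd, ← nodeCofactor_mul _ k, map_mul]
  ring

/-- The transformation `U_H` maps `H_{X₋}` to the continuation of `H_{X₊}`: by the localization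
theorem it suffices to compare the restrictions to the fixed loci of `X₊`. -/
theorem UH_HMinus [NeZero n] {m₀ : ℤ} (h₀ : ∀ m, m₀ ≤ m → ∀ j, 1 - b j - m ≤ 0) {w : ℂ}
    (hw : 0 < w.re) : UH n A (toLoc n A .minus (HMinus A a b (-w))) =
      toLoc n A .plus (Ideal.Quotient.mk _
        (MvPowerSeries.map (algebraMap ℂ A) (rightSum a b m₀ w))) := by
  rw [HMinus, (hasSum_minusTerm h₀ hw).tsum_eq, toLoc_eq_sum_pushforward]
  change ∑ k, ∑ l, pushforward .plus l (divEuler .plus l (coeffC A k l *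
    restrictLoc .minus k (algebraMap _ _ _))) = _
  rw [Finset.sum_comm]
  refine Finset.sum_congr rfl fun l _ => ?_
  rw [← sum_coeffC_mul m₀ hw]
  simp only [restrictLoc_algebraMap, restrict_mk, pushforward, divEuler, Finset.sum_mul, map_sum]

end Continuation

end

end ToricFlop

theorem mainTheorem6 {B : Type u} [TopologicalSpace B] (n : ℕ) (hn : 1 < n)
    (L M : Fin n → ComplexLineBundle.{u, v} B) (β : TwoCycle B) :
    (∀ w : ℂ, w.re < 0 → Summable
      (plusTerm (EvenCohomology B) (fun j => (L j).degree β) (fun i => (M i).degree β) w)) ∧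
    (∀ w : ℂ, w.re < 0 → Summable
      (minusTerm (EvenCohomology B) (fun j => (L j).degree β) (fun i => (M i).degree β) w)) ∧
    ∀ γ : ℝ → ℂ, IsContinuationPath n γ →
      ∃ F : ℝ → ℂ → HX n (EvenCohomology B) .plus,
        IsAnalyticContinuation γ
          (HPlus (EvenCohomology B) (fun j => (L j).degree β) (fun i => (M i).degree β)) F ∧
        ∀ᶠ t in atTop, ∀ᶠ w in 𝓝 (γ t),
          UH n (EvenCohomology B) (toLoc n (EvenCohomology B) .minus
            (HMinus (EvenCohomology B) (fun j => (L j).degree β) (fun i => (M i).degree β) (-w))) =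
          toLoc n (EvenCohomology B) .plus (F t w) := by
  have : NeZero n := ⟨by omega⟩
  obtain ⟨m₁, m₀, h, h₁, h₀⟩ := exists_cutoff (fun j => (L j).degree β) fun i => (M i).degree β
  refine ⟨fun w hw => (hasSum_plusTerm h₁ hw).summable, fun w hw => ?_, fun γ hγ =>
    ⟨_, isAnalyticContinuation_continuation h h₁ h₀ hγ, ?_⟩⟩
  · have := (hasSum_minusTerm (A := EvenCohomology B) (a := fun j => (L j).degree β) (w := -w) h₀
      (by simpa using hw)).summable
    rwa [neg_neg] at this
  · filter_upwards [hγ.finish.eventually_gt_atTop 0] with t ht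
    filter_upwards [(isOpen_lt continuous_const Complex.continuous_re).mem_nhds ht] with w hw
    rw [UH_HMinus h₀ hw, continuation, if_neg (not_lt.2 ht.le), if_pos ht]
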